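/- Let $\mathbb D$ be the open unit disc, $\mathbb T$ the unit circle, $dA$ normalized area measure on $\mathbb D$. For a finite positive Borel measure $\mu$ on $\overline{\mathbb D}$ put $$U_\mu(w)=\int_{\mathbb D}\log\left|\frac{1-\overline\zeta w}{w-\zeta}\right|^2\frac{d\mu(\zeta)}{1-|\zeta|^2}+\int_{\mathbb T}\frac{1-|w|^2}{|\zeta-w|^2}\,d\mu(\zeta),\qquad w\in\mathbb D.$$ For finite positive Borel measures $\mu_1,\mu_2$ on $\overline{\mathbb D}$ and $f$ holomorphic on $\mathbb D^2$ let $$\mathcal D_{\mu_1,\mu_2}(f)=\sup_{0<r<1}\int_0^{2\pi}\!\int_{\mathbb D}|\partial_1f(z_1,re^{i\theta})|^2U_{\mu_1}(z_1)\,dA(z_1)\frac{d\theta}{2\pi}+\sup_{0<r<1}\int_0^{2\pi}\!\int_{\mathbb D}|\partial_2f(re^{i\theta},z_2)|^2U_{\mu_2}(z_2)\,dA(z_2)\frac{d\theta}{2\pi},$$ and let $\mathcal D(\mu_1,\mu_2)=\{f\in H^2(\mathbb D^2):\mathcal D_{\mu_1,\mu_2}(f)<\infty\}$ with the norm $\|f\|^2=\|f\|^2_{H^2(\mathbb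 D^2)}+\mathcal D_{\mu_1,\mu_2}(f)$, where $\|f\|_{H^2(\mathbb D^2)}^2=\sup_{0<r<1}\frac1{4\pi^2}\int_0^{2\pi}\!\int_0^{2\pi}|f(re^{i\theta_1},re^{i\theta_2})|^2d\theta_1d\theta_2$. For bounded operators $T_1,T_2$ on a Hilbert space with $T_1T_2=T_2T_1$ and $\alpha\in\mathbb Z_+^2$ let $$\beta_\alpha(T)=\sum_{0\le\beta\le\alpha}(-1)^{\beta_1+\beta_2}\binom{\alpha_1}{\beta_1}\binom{\alpha_2}{\beta_2}T_1^{*\beta_1}T_2^{*\beta_2}T_1^{\beta_1}T_2^{\beta_2}.$$ The pair $T=(T_1,T_2)$ is called toral completely hyperexpansive if $\beta_\alpha(T)\le0$ for every $\alpha\in\mathbb Z_+^2\setminus\{0\}$; its defect operator is $\beta_{(1,1)}(T)=I-T_1^*T_1-T_2^*T_2+T_1^*T_2^*T_1T_2$. **Lemma.** For all finite positive Borel measures $\mu_1,\mu_2$ on $\overline{\mathbb D}$, $\mathcal D(\mu_1,\mu_2)$ is a separable complex Hilbert space, multiplication by the coordinate functions $z_1$ and $z_2$ defines bounded operators $\mathscr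 M_{z_1},\mathscr M_{z_2}$ on it, and the pair $\mathscr M_z=(\mathscr M_{z_1},\mathscr M_{z_2})$ is commuting and toral completely hyperexpansive, with zero defect operator. -/

import Mathlib

open MeasureTheory Set Filter Topology Metric Complex
open scoped ENNReal ComplexConjugate InnerProduct

noncomputable section

namespace Bidisc

/-! ### Operators on a Hilbert space -/

section Operators

variable {H : Type*} [NormedAddCommGroup H] [InnerProductSpace ℂ H] [CompleteSpace H]

/-- `β_α(T) = ∑_{0 ≤ β ≤ α} (-1)^{|β|} (α choose β) T^{*β} T^β` for the pair `T = (T₁, T₂)`. -/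
def betaOp (T₁ T₂ : H →L[ℂ] H) (a : ℕ × ℕ) : H →L[ℂ] H :=
  ∑ b ∈ Finset.Iic a, ((-1 : ℂ) ^ (b.1 + b.2) * (a.1.choose b.1 : ℂ) * (a.2.choose b.2 : ℂ)) •
    ((T₁†) ^ b.1 * (T₂†) ^ b.2 * (T₁ ^ b.1 * T₂ ^ b.2))

/-- A commuting pair of bounded operators is toral completely hyperexpansive if `β_α(T) ≤ 0`
(in the order of self-adjoint operators) for every multi-index `α ≠ 0`. -/
structure IsToralCompletelyHyperexpansive (T₁ T₂ : H →L[ℂ] H) : Prop where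
  commute : T₁ * T₂ = T₂ * T₁
  betaOp_nonpos : ∀ a : ℕ × ℕ, a ≠ 0 → betaOp T₁ T₂ a ≤ 0

/-- The defect operator `I - T₁* T₁ - T₂* T₂ + T₁* T₂* T₁ T₂`. -/
def defectOp (T₁ T₂ : H →L[ℂ] H) : H →L[ℂ] H :=
  1 - T₁† * T₁ - T₂† * T₂ + T₁† * T₂† * T₁ * T₂

end Operators

/-! ### The Dirichlet integral -/

/-- The open unit bidisc. -/
def bidisc : Set (ℂ × ℂ) := ball 0 1 ×ˢ ball 0 1

/-- The measure `dθ / 2π` on `(0, 2π]`. -/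
def angle : Measure ℝ := (ENNReal.ofReal (2 * Real.pi))⁻¹ • volume.restrict (Ioc 0 (2 * Real.pi))

/-- Normalized area measure on the open unit disc. -/
def area : Measure ℂ := (ENNReal.ofReal Real.pi)⁻¹ • volume.restrict (ball 0 1)

/-- The kernel `log |(1 - ζ̄ w) / (w - ζ)|² / (1 - |ζ|²)`, equal to `∞` at `w = ζ`. -/
def greenKernel (ζ w : ℂ) : ℝ≥0∞ :=
  open Classical in
  if w = ζ then ⊤ else
    ENNReal.ofReal (Real.log (‖(1 - conj ζ * w) / (w - ζ)‖ ^ 2) / (1 - ‖ζ‖ ^ 2))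

/-- The Poisson kernel `(1 - |w|²) / |ζ - w|²`. -/
def poisson (ζ w : ℂ) : ℝ≥0∞ := ENNReal.ofReal ((1 - ‖w‖ ^ 2) / ‖ζ - w‖ ^ 2)

/-- The superharmonic weight `U_μ` of a measure `μ` on the closed unit disc (its values in the
open unit disc matter only). -/
def weight (μ : Measure (closedBall (0 : ℂ) 1)) (w : ℂ) : ℝ≥0∞ :=
  (∫⁻ ζ in {ζ | ‖(ζ : ℂ)‖ < 1}, greenKernel ζ w ∂μ) + ∫⁻ ζ in {ζ | ‖(ζ : ℂ)‖ = 1}, poisson ζ w ∂μ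

/-- `∂₁ f`. -/
def partial₁ (f : ℂ × ℂ → ℂ) (z : ℂ × ℂ) : ℂ := fderiv ℂ f z (1, 0)

/-- `∂₂ f`. -/
def partial₂ (f : ℂ × ℂ → ℂ) (z : ℂ × ℂ) : ℂ := fderiv ℂ f z (0, 1)

/-- The integral of `|f|²` over the torus of radius `r`; here `circleMap 0 r θ = r e^{iθ}`. -/
def hardyMean (f : ℂ × ℂ → ℂ) (r : ℝ) : ℝ≥0∞ :=
  ∫⁻ θ₁, ∫⁻ θ₂, ‖f (circleMap 0 r θ₁, circleMap 0 r θ₂)‖ₑ ^ 2 ∂angle ∂angle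

/-- `∫ ∫ |∂₁ f (z₁, r e^{iθ})|² U_μ(z₁) dA(z₁) dθ/2π`. -/
def dirichletMean₁ (μ : Measure (closedBall (0 : ℂ) 1)) (f : ℂ × ℂ → ℂ) (r : ℝ) : ℝ≥0∞ :=
  ∫⁻ θ, ∫⁻ z, ‖partial₁ f (z, circleMap 0 r θ)‖ₑ ^ 2 * weight μ z ∂area ∂angle

/-- `∫ ∫ |∂₂ f (r e^{iθ}, z₂)|² U_μ(z₂) dA(z₂) dθ/2π`. -/
def dirichletMean₂ (μ : Measure (closedBall (0 : ℂ) 1)) (f : ℂ × ℂ → ℂ) (r : ℝ) : ℝ≥0∞ :=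
  ∫⁻ θ, ∫⁻ z, ‖partial₂ f (circleMap 0 r θ, z)‖ₑ ^ 2 * weight μ z ∂area ∂angle

/-- The square of the norm of `H²(𝔻²)`. -/
def hardySq (f : ℂ × ℂ → ℂ) : ℝ≥0∞ := ⨆ r ∈ Ioo (0 : ℝ) 1, hardyMean f r

/-- The Dirichlet integral `D_{μ₁, μ₂}(f)`. -/
def dirichletIntegral (μ₁ μ₂ : Measure (closedBall (0 : ℂ) 1)) (f : ℂ × ℂ → ℂ) : ℝ≥0∞ :=
  (⨆ r ∈ Ioo (0 : ℝ) 1, dirichletMean₁ μ₁ f r) + ⨆ r ∈ Ioo (0 : ℝ) 1, dirichletMean₂ μ₂ f r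

/-- Holomorphic functions on the bidisc, represented by their extension by zero to `ℂ × ℂ`. -/
structure IsHolo (f : ℂ × ℂ → ℂ) : Prop where
  analytic : AnalyticOnNhd ℂ f bidisc
  zero_off : ∀ z ∉ bidisc, f z = 0

/-! ### Auxiliary facts -/

lemma isOpen_bidisc : IsOpen bidisc := isOpen_ball.prod isOpen_ball

lemma circleMap_mem {r : ℝ} (hr : r ∈ Ioo (0 : ℝ) 1) (θ : ℝ) :
    circleMap 0 r θ ∈ ball (0 : ℂ) 1 := by
  simp [abs_of_pos hr.1, hr.2]

instance : IsFiniteMeasure angle := by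
  unfold angle
  have : ENNReal.ofReal (2 * Real.pi) ≠ 0 := by simp [Real.pi_pos]
  exact Measure.smul_finite _ (ENNReal.inv_ne_top.2 this)

instance : IsFiniteMeasure area := by
  unfold area
  have : ENNReal.ofReal Real.pi ≠ 0 := by simp [Real.pi_pos]
  have : IsFiniteMeasure ((volume : Measure ℂ).restrict (ball 0 1)) :=
    ⟨by simp⟩
  exact Measure.smul_finite _ (ENNReal.inv_ne_top.2 ‹_›)

lemma ae_area : ∀ᵐ z ∂area, z ∈ ball (0 : ℂ) 1 :=
  Measure.ae_smul_measure (ae_restrict_mem measurableSet_ball) _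

lemma measurable_weight (μ : Measure (closedBall (0 : ℂ) 1)) [IsFiniteMeasure μ] :
    Measurable (weight μ) := by
  refine Measurable.add ?_ ?_
  · refine Measurable.lintegral_prod_right' (f := fun p : ℂ × closedBall (0 : ℂ) 1 =>
      greenKernel p.2 p.1) ?_
    refine Measurable.ite (measurableSet_eq_fun (by fun_prop) (by fun_prop)) (by fun_prop) ?_
    refine ENNReal.measurable_ofReal.comp (Measurable.div (Real.measurable_log.comp ?_) ?_)
    · refine (Measurable.norm (Measurable.div ?_ ?_)).pow_const 2
      · exact (Continuous.measurable (by fun_prop))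
      · exact (Continuous.measurable (by fun_prop))
    · exact (Continuous.measurable (by fun_prop))
  · refine Measurable.lintegral_prod_right' (f := fun p : ℂ × closedBall (0 : ℂ) 1 =>
      poisson p.2 p.1) ?_
    refine ENNReal.measurable_ofReal.comp (Measurable.div ?_ ?_)
    · exact (Continuous.measurable (by fun_prop))
    · exact (Continuous.measurable (by fun_prop))

/-- Circular square means of a holomorphic function increase with the radius. -/
lemma circle_mono {g : ℂ → ℂ} (hg : DifferentiableOn ℂ g (ball 0 1)) {r s : ℝ}
    (hr : r ∈ Ioo (0 : ℝ) 1) (hs : s ∈ Ioo (0 : ℝ) 1) (hrs : r ≤ s) :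
    ∫⁻ θ, ‖g (circleMap 0 r θ)‖ₑ ^ 2 ∂angle ≤ ∫⁻ θ, ‖g (circleMap 0 s θ)‖ₑ ^ 2 ∂angle := by
  have hcont : ∀ t ∈ Ioo (0 : ℝ) 1, Continuous fun θ => g (circleMap 0 t θ) := fun t ht =>
    hg.continuousOn.comp_continuous (continuous_circleMap 0 t) (circleMap_mem ht)
  have h2pi : (0 : ℝ) < 2 * Real.pi := by positivity
  have hL2 : ∀ t ∈ Ioo (0 : ℝ) 1, MemLp (fun θ => g (circleMap 0 t θ)) 2
      (volume.restrict (Ioc 0 (2 * Real.pi))) := by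
    intro t ht
    refine MemLp.mono_measure (Measure.restrict_mono Ioc_subset_Icc_self le_rfl) ?_
    obtain ⟨C, hC⟩ := isCompact_Icc.exists_bound_of_continuousOn
      (s := Icc 0 (2 * Real.pi)) (hcont t ht).continuousOn
    refine MemLp.of_bound (hcont t ht).aestronglyMeasurable C ?_
    exact (ae_restrict_mem measurableSet_Icc).mono hC
  have hcoef : ∀ t ∈ Ioo (0 : ℝ) 1, ∀ n : ℤ,
      (∮ z in C(0, t), z⁻¹ • (z ^ (-n) * g z)) =
        (t : ℂ) ^ (-n) * (2 * Real.pi * I) *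
          fourierCoeffOn h2pi (fun θ => g (circleMap 0 t θ)) n := by
    intro t ht n
    have ht0 : (t : ℂ) ≠ 0 := by exact_mod_cast ht.1.ne'
    rw [fourierCoeffOn_eq_integral, circleIntegral]
    rw [Complex.real_smul, ← intervalIntegral.integral_const_mul,
      ← intervalIntegral.integral_const_mul]
    refine intervalIntegral.integral_congr fun θ _ => ?_
    have hz : circleMap 0 t θ ≠ 0 := by simp [circleMap, ht0]
    have hpi : (Real.pi : ℂ) ≠ 0 := by exact_mod_cast Real.pi_ne_zero
    have e1 : (circleMap 0 t θ) ^ (-n) = (t : ℂ) ^ (-n) * Complex.exp (-(n * θ * I)) := by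
      rw [circleMap_zero, mul_zpow, ← Complex.exp_int_mul]
      congr 2
      push_cast
      ring
    have e2 : (fourier (-n) ((θ : ℝ) : AddCircle (2 * Real.pi - 0)) : ℂ)
        = Complex.exp (-(n * θ * I)) := by
      rw [fourier_coe_apply]
      congr 1
      push_cast
      field_simp
      ring
    simp only [deriv_circleMap, smul_eq_mul, e2, e1]
    push_cast
    field_simp
    simp
    ring
  have hle : ∀ n : ℤ, ‖fourierCoeffOn h2pi (fun θ => g (circleMap 0 r θ)) n‖ ≤
      ‖fourierCoeffOn h2pi (fun θ => g (circleMap 0 s θ)) n‖ := by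
    intro n
    have hs0 : (s : ℂ) ≠ 0 := by exact_mod_cast hs.1.ne'
    have hr0 : (r : ℂ) ≠ 0 := by exact_mod_cast hr.1.ne'
    have hne : (2 * Real.pi * I : ℂ) ≠ 0 := Complex.two_pi_I_ne_zero
    rcases lt_or_ge n 0 with hn | hn
    · have hz : (∮ z in C(0, r), z⁻¹ • (z ^ (-n) * g z)) = 0 := by
        have hsub : closedBall (0 : ℂ) r ⊆ ball 0 1 := closedBall_subset_ball hr.2
        obtain ⟨k, hk⟩ : ∃ k : ℕ, -n = k + 1 := ⟨(-n - 1).toNat, by omega⟩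
        have : (∮ z in C(0, r), z⁻¹ • (z ^ (-n) * g z)) = ∮ z in C(0, r), z ^ k * g z := by
          refine circleIntegral.integral_congr hr.1.le fun z hz => ?_
          have hz0 : z ≠ 0 := by
            rintro rfl
            simp at hz
            exact hr.1.ne hz
          simp only [hk, smul_eq_mul]
          rw [zpow_add_one₀ hz0, zpow_natCast]
          field_simp
        rw [this]
        refine circleIntegral_eq_zero_of_differentiable_on_off_countable hr.1.le
          (s := ∅) countable_empty ?_ ?_
        · exact (continuousOn_id.pow k).mul (hg.continuousOn.mono hsub)
        · intro z hz
          have := (hg.differentiableAt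
            (isOpen_ball.mem_nhds (hsub (ball_subset_closedBall hz.1))))
          fun_prop
      rw [hcoef r hr n] at hz
      have : fourierCoeffOn h2pi (fun θ => g (circleMap 0 r θ)) n = 0 := by
        exact (mul_eq_zero.1 hz).resolve_left (mul_ne_zero (zpow_ne_zero _ hr0) hne)
      simp [this]
    · have heq := circleIntegral_sub_center_inv_smul_eq_of_differentiable_on_annulus_off_countable
        (c := 0) (f := fun z => z ^ (-n) * g z) (s := ∅) hr.1 hrs countable_empty ?_ ?_
      · simp only [sub_zero] at heq
        rw [hcoef r hr n, hcoef s hs n] at heq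
        have h3 : fourierCoeffOn h2pi (fun θ => g (circleMap 0 r θ)) n =
            ((r : ℂ) / s) ^ n * fourierCoeffOn h2pi (fun θ => g (circleMap 0 s θ)) n := by
          have h4 : (s : ℂ) ^ (-n) * fourierCoeffOn h2pi (fun θ => g (circleMap 0 s θ)) n
            = (r : ℂ) ^ (-n) * fourierCoeffOn h2pi (fun θ => g (circleMap 0 r θ)) n := by
            apply mul_left_cancel₀ hne
            linear_combination heq
          rw [div_zpow, zpow_neg, zpow_neg] at *
          have := zpow_ne_zero n hs0
          have := zpow_ne_zero n hr0
          field_simp at h4 ⊢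
          linear_combination -h4
        rw [h3, norm_mul]
        refine mul_le_of_le_one_left (norm_nonneg _) ?_
        rw [norm_zpow, norm_div, Complex.norm_real, Complex.norm_real, Real.norm_of_nonneg hr.1.le,
          Real.norm_of_nonneg hs.1.le]
        lift n to ℕ using hn
        rw [zpow_natCast]
        exact pow_le_one₀ (by have := hr.1; have := hs.1; positivity) ((div_le_one hs.1).2 hrs)
      · intro z hz
        have hz0 : z ≠ 0 := by
          rintro rfl
          exact hz.2 (by simpa using hr.1)
        have h1 : ContinuousAt g z := hg.continuousOn.continuousAt
          (isOpen_ball.mem_nhds (closedBall_subset_ball hs.2 hz.1))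
        exact ((continuousAt_zpow₀ z (-n) (Or.inl hz0)).mul h1).continuousWithinAt
      · intro z hz
        have hz0 : z ≠ 0 := by
          rintro rfl
          exact hz.1.2 (by simpa using hr.1.le)
        have h1 : DifferentiableAt ℂ g z := hg.differentiableAt
          (isOpen_ball.mem_nhds (closedBall_subset_ball hs.2 (ball_subset_closedBall hz.1.1)))
        exact (differentiableAt_zpow.2 (Or.inl hz0)).mul h1
  have hconv : ∀ t ∈ Ioo (0 : ℝ) 1, ∫⁻ θ, ‖g (circleMap 0 t θ)‖ₑ ^ 2 ∂angle =
      (ENNReal.ofReal (2 * Real.pi))⁻¹ * ENNReal.ofReal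
        (∫ θ in (0 : ℝ)..(2 * Real.pi), ‖g (circleMap 0 t θ)‖ ^ 2) := by
    intro t ht
    rw [angle, lintegral_smul_measure, smul_eq_mul, intervalIntegral.integral_of_le h2pi.le,
      ofReal_integral_eq_lintegral_ofReal (hL2 t ht).integrable_norm_pow'
        (Eventually.of_forall fun _ => by positivity)]
    congr 2
    ext θ
    rw [ENNReal.ofReal_pow (norm_nonneg _), ofReal_norm]
  rw [hconv r hr, hconv s hs]
  gcongr
  have hA := hasSum_sq_fourierCoeffOn h2pi (hL2 r hr)
  have hB := hasSum_sq_fourierCoeffOn h2pi (hL2 s hs)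
  have hAB := hasSum_le (fun n => by gcongr; exact hle n) hA hB
  simp only [smul_eq_mul] at hAB
  exact le_of_mul_le_mul_left hAB (by simpa using h2pi)

/-! ### Hermitian forms through polarization -/

section Herm

variable {V : Type*} [AddCommGroup V] [Module ℂ V]

/-- The form obtained from `q` by polarization (conjugate-linear in the first variable). -/
def polar (q : V → ℝ) (f g : V) : ℂ :=
  ((q (f + g) : ℂ) - q (f - g) + ((q (f - I • g) : ℂ) - q (f + I • g)) * I) / 4

/-- `q` is the quadratic form of a positive semidefinite Hermitian form. -/
structure IsHerm (q : V → ℝ) : Prop where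
  nonneg : ∀ f, 0 ≤ q f
  self : ∀ f, polar q f f = q f
  symm : ∀ f g, conj (polar q g f) = polar q f g
  add_left : ∀ f g h, polar q (f + g) h = polar q f h + polar q g h
  smul_left : ∀ f g (c : ℂ), polar q (c • f) g = conj c * polar q f g

lemma IsHerm.of_linear {E : Type*} [NormedAddCommGroup E] [InnerProductSpace ℂ E]
    (Φ : V →ₗ[ℂ] E) : IsHerm fun f => ‖Φ f‖ ^ 2 := by
  have h : ∀ f g, polar (fun f => ‖Φ f‖ ^ 2) f g = inner ℂ (Φ f) (Φ g) := by
    intro f g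
    rw [inner_eq_sum_norm_sq_div_four, polar]
    simp
  refine ⟨fun f => by positivity, fun f => ?_, fun f g => ?_, fun f g k => ?_, fun f g c => ?_⟩
  · rw [h, inner_self_eq_norm_sq_to_K]
    simp
  · rw [h, h, inner_conj_symm]
  · simp only [h, map_add, inner_add_left]
  · simp only [h, map_smul, inner_smul_left]

lemma IsHerm.add {p q : V → ℝ} (hp : IsHerm p) (hq : IsHerm q) : IsHerm fun f => p f + q f := by
  have h : ∀ f g, polar (fun f => p f + q f) f g = polar p f g + polar q f g := by
    intro f g
    simp only [polar]
    push_cast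
    ring
  refine ⟨fun f => add_nonneg (hp.nonneg f) (hq.nonneg f), fun f => ?_, fun f g => ?_,
    fun f g k => ?_, fun f g c => ?_⟩
  · rw [h, hp.self, hq.self]
    push_cast
    rfl
  · rw [h, h, map_add, hp.symm, hq.symm]
  · rw [h, h, h, hp.add_left, hq.add_left]
    ring
  · rw [h, h, hp.smul_left, hq.smul_left]
    ring

lemma IsHerm.of_tendsto {ι : Type*} {l : Filter ι} [l.NeBot] {q : ι → V → ℝ} {p : V → ℝ}
    (hq : ∀ᶠ i in l, IsHerm (q i)) (h : ∀ f, Tendsto (fun i => q i f) l (𝓝 (p f))) :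
    IsHerm p := by
  have hc : ∀ f, Tendsto (fun i => (q i f : ℂ)) l (𝓝 (p f : ℂ)) := fun f =>
    (Complex.continuous_ofReal.tendsto _).comp (h f)
  have hp : ∀ f g, Tendsto (fun i => polar (q i) f g) l (𝓝 (polar p f g)) := fun f g =>
    (((hc _).sub (hc _)).add (((hc _).sub (hc _)).mul_const I)).div_const 4
  refine ⟨fun f => ?_, fun f => ?_, fun f g => ?_, fun f g k => ?_, fun f g c => ?_⟩
  · exact ge_of_tendsto (h f) (hq.mono fun i hi => hi.nonneg f)
  · exact tendsto_nhds_unique_of_eventuallyEq (hp f f) (hc f) (hq.mono fun i hi => hi.self f)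
  · exact tendsto_nhds_unique_of_eventuallyEq
      ((Complex.continuous_conj.tendsto _).comp (hp g f)) (hp f g)
      (hq.mono fun i hi => hi.symm f g)
  · exact tendsto_nhds_unique_of_eventuallyEq (hp _ _) ((hp _ _).add (hp _ _))
      (hq.mono fun i hi => hi.add_left f g k)
  · exact tendsto_nhds_unique_of_eventuallyEq (hp _ _) ((hp _ _).const_mul _)
      (hq.mono fun i hi => hi.smul_left f g c)

lemma IsHerm.of_lintegral {X : Type*} [MeasurableSpace X] (ν : Measure X) (F : V → X → ℂ)
    (hm : ∀ f, Measurable (F f)) (hfin : ∀ f, ∫⁻ x, ‖F f x‖ₑ ^ 2 ∂ν < ⊤)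
    (hadd : ∀ f g, F (f + g) =ᵐ[ν] F f + F g) (hsmul : ∀ (c : ℂ) f, F (c • f) =ᵐ[ν] c • F f) :
    IsHerm fun f => (∫⁻ x, ‖F f x‖ₑ ^ 2 ∂ν).toReal := by
  have hL : ∀ f, MemLp (F f) 2 ν := by
    intro f
    refine ⟨(hm f).aestronglyMeasurable, ?_⟩
    rw [eLpNorm_lt_top_iff_lintegral_rpow_enorm_lt_top two_ne_zero ENNReal.ofNat_ne_top]
    simpa using hfin f
  let Φ : V →ₗ[ℂ] Lp ℂ 2 ν :=
    { toFun := fun f => (hL f).toLp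
      map_add' := fun f g => by
        rw [← MemLp.toLp_add]
        exact (MemLp.toLp_eq_toLp_iff _ _).2 (hadd f g)
      map_smul' := fun c f => by
        rw [RingHom.id_apply, ← MemLp.toLp_const_smul]
        exact (MemLp.toLp_eq_toLp_iff _ _).2 (hsmul c f) }
  convert IsHerm.of_linear Φ using 2 with f
  change _ = ‖(hL f).toLp‖ ^ 2
  rw [Lp.norm_toLp, ← ENNReal.toReal_pow]
  congr 1
  rw [eLpNorm_eq_lintegral_rpow_enorm_toReal two_ne_zero ENNReal.ofNat_ne_top]
  simp only [ENNReal.toReal_ofNat, ENNReal.rpow_ofNat]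
  rw [← ENNReal.rpow_natCast, ← ENNReal.rpow_mul]
  simp

end Herm

/-! ### The square means as quadratic forms -/

section Means

variable {X : Type*} [MeasurableSpace X] {ν : Measure X}

lemma sup_add_lt_top {F G K : ℝ → X → ℂ} (hF : ∀ r, Measurable (F r))
    (hK : ∀ r ∈ Ioo (0 : ℝ) 1, K r =ᵐ[ν] F r + G r)
    (h1 : ⨆ r ∈ Ioo (0 : ℝ) 1, ∫⁻ x, ‖F r x‖ₑ ^ 2 ∂ν < ⊤)
    (h2 : ⨆ r ∈ Ioo (0 : ℝ) 1, ∫⁻ x, ‖G r x‖ₑ ^ 2 ∂ν < ⊤) :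
    ⨆ r ∈ Ioo (0 : ℝ) 1, ∫⁻ x, ‖K r x‖ₑ ^ 2 ∂ν < ⊤ := by
  refine lt_of_le_of_lt (iSup₂_le fun r hr => ?_) (ENNReal.add_lt_top.2
    ⟨ENNReal.mul_lt_top (ENNReal.ofNat_lt_top (n := 2)) h1,
      ENNReal.mul_lt_top (ENNReal.ofNat_lt_top (n := 2)) h2⟩)
  calc ∫⁻ x, ‖K r x‖ₑ ^ 2 ∂ν
      ≤ ∫⁻ x, (2 * ‖F r x‖ₑ ^ 2 + 2 * ‖G r x‖ₑ ^ 2) ∂ν := by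
        refine lintegral_mono_ae ((hK r hr).mono fun x hx => ?_)
        rw [hx, Pi.add_apply]
        have h := parallelogram_law_with_norm ℝ (F r x) (G r x)
        have h3 : ‖F r x + G r x‖ ^ 2 ≤ 2 * ‖F r x‖ ^ 2 + 2 * ‖G r x‖ ^ 2 := by
          nlinarith [sq_nonneg ‖F r x - G r x‖]
        have h4 := ENNReal.ofReal_le_ofReal h3
        rwa [ENNReal.ofReal_add (by positivity) (by positivity), ENNReal.ofReal_mul (by norm_num),
          ENNReal.ofReal_mul (by norm_num), ENNReal.ofReal_pow (norm_nonneg _),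
          ENNReal.ofReal_pow (norm_nonneg _), ENNReal.ofReal_pow (norm_nonneg _),
          ofReal_norm, ofReal_norm, ofReal_norm, ENNReal.ofReal_ofNat] at h4
    _ = 2 * (∫⁻ x, ‖F r x‖ₑ ^ 2 ∂ν) + 2 * ∫⁻ x, ‖G r x‖ₑ ^ 2 ∂ν := by
        rw [lintegral_add_left (((hF r).enorm.pow_const 2).const_mul 2),
          lintegral_const_mul' _ _ (by simp), lintegral_const_mul' _ _ (by simp)]
    _ ≤ _ := by
        gcongr
        · exact le_iSup₂ (f := fun r (_ : r ∈ Ioo (0 : ℝ) 1) => ∫⁻ x, ‖F r x‖ₑ ^ 2 ∂ν) r hr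
        · exact le_iSup₂ (f := fun r (_ : r ∈ Ioo (0 : ℝ) 1) => ∫⁻ x, ‖G r x‖ₑ ^ 2 ∂ν) r hr

lemma sup_smul_lt_top {F K : ℝ → X → ℂ} {c : ℂ}
    (hK : ∀ r ∈ Ioo (0 : ℝ) 1, K r =ᵐ[ν] c • F r)
    (h1 : ⨆ r ∈ Ioo (0 : ℝ) 1, ∫⁻ x, ‖F r x‖ₑ ^ 2 ∂ν < ⊤) :
    ⨆ r ∈ Ioo (0 : ℝ) 1, ∫⁻ x, ‖K r x‖ₑ ^ 2 ∂ν < ⊤ := by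
  refine lt_of_le_of_lt (iSup₂_le fun r hr => ?_)
    (ENNReal.mul_lt_top (a := ‖c‖ₑ ^ 2) (by simp) h1)
  calc ∫⁻ x, ‖K r x‖ₑ ^ 2 ∂ν = ∫⁻ x, ‖c‖ₑ ^ 2 * ‖F r x‖ₑ ^ 2 ∂ν := by
        refine lintegral_congr_ae ((hK r hr).mono fun x hx => ?_)
        simp only [hx, Pi.smul_apply, smul_eq_mul, enorm_mul, mul_pow]
    _ = ‖c‖ₑ ^ 2 * ∫⁻ x, ‖F r x‖ₑ ^ 2 ∂ν := lintegral_const_mul' _ _ (by simp)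
    _ ≤ _ := by
        gcongr
        exact le_iSup₂ (f := fun r (_ : r ∈ Ioo (0 : ℝ) 1) => ∫⁻ x, ‖F r x‖ₑ ^ 2 ∂ν) r hr

lemma tendsto_sup {A : ℝ → ℝ≥0∞} (hA : MonotoneOn A (Ioo 0 1))
    (hfin : ⨆ r ∈ Ioo (0 : ℝ) 1, A r < ⊤) :
    Tendsto (fun r => (A r).toReal) (𝓝[<] 1) (𝓝 (⨆ r ∈ Ioo (0 : ℝ) 1, A r).toReal) := by
  refine (ENNReal.tendsto_toReal hfin.ne).comp ?_
  rw [← sSup_image]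
  exact hA.tendsto_nhdsWithin_Ioo_left (by simp) (OrderTop.bddAbove _)

end Means

lemma IsHolo.zero : IsHolo 0 := ⟨fun _ _ => analyticAt_const, fun _ _ => rfl⟩

lemma IsHolo.add {f g : ℂ × ℂ → ℂ} (hf : IsHolo f) (hg : IsHolo g) : IsHolo (f + g) :=
  ⟨hf.analytic.add hg.analytic, fun z hz => by simp [hf.zero_off z hz, hg.zero_off z hz]⟩

lemma IsHolo.smul {f : ℂ × ℂ → ℂ} (c : ℂ) (hf : IsHolo f) : IsHolo (c • f) :=
  ⟨fun z hz => analyticAt_const.smul (hf.analytic z hz), fun z hz => by simp [hf.zero_off z hz]⟩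

lemma IsHolo.measurable {f : ℂ × ℂ → ℂ} (hf : IsHolo f) : Measurable f := by
  classical
  have h := ContinuousOn.measurable_piecewise (s := bidisc) (f := f) (g := 0)
    hf.analytic.continuousOn continuousOn_const isOpen_bidisc.measurableSet
  convert h using 1
  ext z
  by_cases hz : z ∈ bidisc
  · simp [hz]
  · simp [hz, hf.zero_off z hz]

lemma measurable_partial₁ (f : ℂ × ℂ → ℂ) : Measurable (partial₁ f) :=
  (ContinuousLinearMap.measurable_apply _).comp (measurable_fderiv ℂ f)

lemma measurable_partial₂ (f : ℂ × ℂ → ℂ) : Measurable (partial₂ f) :=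
  (ContinuousLinearMap.measurable_apply _).comp (measurable_fderiv ℂ f)

/-- The pullback of `f` to the torus of radius `r`. -/
def torusFun (f : ℂ × ℂ → ℂ) (r : ℝ) (p : ℝ × ℝ) : ℂ := f (circleMap 0 r p.1, circleMap 0 r p.2)

/-- The pullback of `∂₁ f` to `(θ, z) ↦ (z, r e^{iθ})`. -/
def derivFun₁ (f : ℂ × ℂ → ℂ) (r : ℝ) (p : ℝ × ℂ) : ℂ := partial₁ f (p.2, circleMap 0 r p.1)

/-- The pullback of `∂₂ f` to `(θ, z) ↦ (r e^{iθ}, z)`. -/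
def derivFun₂ (f : ℂ × ℂ → ℂ) (r : ℝ) (p : ℝ × ℂ) : ℂ := partial₂ f (circleMap 0 r p.1, p.2)

/-- The measure `dθ/2π × U_μ dA`. -/
def prodWeight (μ : Measure (closedBall (0 : ℂ) 1)) : Measure (ℝ × ℂ) :=
  angle.prod (area.withDensity (weight μ))

lemma measurable_torusFun {f : ℂ × ℂ → ℂ} (hf : IsHolo f) (r : ℝ) : Measurable (torusFun f r) :=
  hf.measurable.comp (Continuous.measurable (by fun_prop))

lemma measurable_derivFun₁ (f : ℂ × ℂ → ℂ) (r : ℝ) : Measurable (derivFun₁ f r) :=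
  (measurable_partial₁ f).comp (Continuous.measurable (by fun_prop))

lemma measurable_derivFun₂ (f : ℂ × ℂ → ℂ) (r : ℝ) : Measurable (derivFun₂ f r) :=
  (measurable_partial₂ f).comp (Continuous.measurable (by fun_prop))

lemma hardyMean_eq {f : ℂ × ℂ → ℂ} (hf : IsHolo f) (r : ℝ) :
    hardyMean f r = ∫⁻ p, ‖torusFun f r p‖ₑ ^ 2 ∂(angle.prod angle) := by
  rw [lintegral_prod _ ((measurable_torusFun hf r).enorm.pow_const 2).aemeasurable]
  rfl

lemma lintegral_weight (μ : Measure (closedBall (0 : ℂ) 1)) [IsFiniteMeasure μ] {G : ℝ × ℂ → ℂ}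
    (hG : Measurable G) : ∫⁻ θ, ∫⁻ z, ‖G (θ, z)‖ₑ ^ 2 * weight μ z ∂area ∂angle =
      ∫⁻ p, ‖G p‖ₑ ^ 2 ∂(prodWeight μ) := by
  rw [prodWeight, lintegral_prod _ (hG.enorm.pow_const 2).aemeasurable]
  refine lintegral_congr fun θ => ?_
  rw [lintegral_withDensity_eq_lintegral_mul _ (measurable_weight μ)
    (g := fun z => ‖G (θ, z)‖ₑ ^ 2) ((hG.comp measurable_prodMk_left).enorm.pow_const 2)]
  refine lintegral_congr fun z => ?_
  simp [mul_comm]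

lemma dirichletMean₁_eq (μ : Measure (closedBall (0 : ℂ) 1)) [IsFiniteMeasure μ]
    (f : ℂ × ℂ → ℂ) (r : ℝ) :
    dirichletMean₁ μ f r = ∫⁻ p, ‖derivFun₁ f r p‖ₑ ^ 2 ∂(prodWeight μ) :=
  lintegral_weight μ (measurable_derivFun₁ f r)

lemma dirichletMean₂_eq (μ : Measure (closedBall (0 : ℂ) 1)) [IsFiniteMeasure μ]
    (f : ℂ × ℂ → ℂ) (r : ℝ) :
    dirichletMean₂ μ f r = ∫⁻ p, ‖derivFun₂ f r p‖ₑ ^ 2 ∂(prodWeight μ) :=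
  lintegral_weight μ (measurable_derivFun₂ f r)

lemma ae_prodWeight (μ : Measure (closedBall (0 : ℂ) 1)) : ∀ᵐ p ∂(prodWeight μ), p.2 ∈ ball (0 : ℂ) 1 :=
  Measure.quasiMeasurePreserving_snd.ae
    ((withDensity_absolutelyContinuous area (weight μ)).ae_le ae_area)

lemma derivFun₁_add (μ : Measure (closedBall (0 : ℂ) 1))
    {f g : ℂ × ℂ → ℂ} (hf : IsHolo f) (hg : IsHolo g) {r : ℝ}
    (hr : r ∈ Ioo (0 : ℝ) 1) :
    derivFun₁ (f + g) r =ᵐ[prodWeight μ] derivFun₁ f r + derivFun₁ g r := by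
  filter_upwards [ae_prodWeight μ] with p hp
  have hz : (p.2, circleMap 0 r p.1) ∈ bidisc := ⟨hp, circleMap_mem hr _⟩
  simp [derivFun₁, partial₁, fderiv_add (hf.analytic _ hz).differentiableAt
    (hg.analytic _ hz).differentiableAt]

lemma derivFun₂_add (μ : Measure (closedBall (0 : ℂ) 1))
    {f g : ℂ × ℂ → ℂ} (hf : IsHolo f) (hg : IsHolo g) {r : ℝ}
    (hr : r ∈ Ioo (0 : ℝ) 1) :
    derivFun₂ (f + g) r =ᵐ[prodWeight μ] derivFun₂ f r + derivFun₂ g r := by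
  filter_upwards [ae_prodWeight μ] with p hp
  have hz : (circleMap 0 r p.1, p.2) ∈ bidisc := ⟨circleMap_mem hr _, hp⟩
  simp [derivFun₂, partial₂, fderiv_add (hf.analytic _ hz).differentiableAt
    (hg.analytic _ hz).differentiableAt]

lemma derivFun₁_smul {f : ℂ × ℂ → ℂ} (c : ℂ) (r : ℝ) :
    derivFun₁ (c • f) r = c • derivFun₁ f r := by
  ext p
  simp [derivFun₁, partial₁, fderiv_const_smul_field]

lemma derivFun₂_smul {f : ℂ × ℂ → ℂ} (c : ℂ) (r : ℝ) :
    derivFun₂ (c • f) r = c • derivFun₂ f r := by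
  ext p
  simp [derivFun₂, partial₂, fderiv_const_smul_field]

lemma mean_mono (μ : Measure (closedBall (0 : ℂ) 1)) [IsFiniteMeasure μ]
    {G : ℂ → ℂ → ℂ} (hG : Measurable (Function.uncurry G))
    (hd : ∀ z ∈ ball (0 : ℂ) 1, DifferentiableOn ℂ (G z) (ball 0 1)) :
    MonotoneOn (fun r : ℝ => ∫⁻ θ, ∫⁻ z, ‖G z (circleMap 0 r θ)‖ₑ ^ 2 * weight μ z ∂area ∂angle)
      (Ioo 0 1) := by
  intro r hr s hs hrs
  have hsw : ∀ t : ℝ, ∫⁻ θ, ∫⁻ z, ‖G z (circleMap 0 t θ)‖ₑ ^ 2 * weight μ z ∂area ∂angle =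
      ∫⁻ z, (∫⁻ θ, ‖G z (circleMap 0 t θ)‖ₑ ^ 2 ∂angle) * weight μ z ∂area := by
    intro t
    have hm : Measurable fun p : ℝ × ℂ => G p.2 (circleMap 0 t p.1) :=
      hG.comp (g := Function.uncurry G) (f := fun p : ℝ × ℂ => (p.2, circleMap 0 t p.1))
        (Continuous.measurable (by fun_prop))
    rw [lintegral_lintegral_swap ((hm.enorm.pow_const 2).mul
      ((measurable_weight μ).comp measurable_snd)).aemeasurable]
    refine lintegral_congr fun z => ?_
    rw [lintegral_mul_const]
    exact (hm.comp measurable_prodMk_right).enorm.pow_const 2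
  simp only [hsw]
  refine lintegral_mono_ae (ae_area.mono fun z hz => ?_)
  exact mul_le_mul_left (circle_mono (hd z hz) hr hs hrs) _

lemma dirichletMean₁_mono (μ : Measure (closedBall (0 : ℂ) 1)) [IsFiniteMeasure μ]
    {f : ℂ × ℂ → ℂ} (hf : IsHolo f) :
    MonotoneOn (dirichletMean₁ μ f) (Ioo 0 1) := by
  refine mean_mono μ (G := fun z w => partial₁ f (z, w)) (measurable_partial₁ f) fun z hz w hw => ?_
  have h := (hf.analytic.fderiv (z, w) ⟨hz, hw⟩).differentiableAt
  have h2 : DifferentiableAt ℂ (fun w => fderiv ℂ f (z, w)) w :=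
    h.comp w (f := fun w => (z, w)) (by fun_prop)
  exact (h2.clm_apply (differentiableAt_const _)).differentiableWithinAt

lemma dirichletMean₂_mono (μ : Measure (closedBall (0 : ℂ) 1)) [IsFiniteMeasure μ]
    {f : ℂ × ℂ → ℂ} (hf : IsHolo f) :
    MonotoneOn (dirichletMean₂ μ f) (Ioo 0 1) := by
  refine mean_mono μ (G := fun z w => partial₂ f (w, z))
    ((measurable_partial₂ f).comp measurable_swap) fun z hz w hw => ?_
  have h := (hf.analytic.fderiv (w, z) ⟨hw, hz⟩).differentiableAt
  have h2 : DifferentiableAt ℂ (fun w => fderiv ℂ f (w, z)) w :=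
    h.comp w (f := fun w => (w, z)) (by fun_prop)
  exact (h2.clm_apply (differentiableAt_const _)).differentiableWithinAt

lemma torus_mono {f : ℂ × ℂ → ℂ} (hf : IsHolo f) {r₁ r₂ s₁ s₂ : ℝ} (hr₁ : r₁ ∈ Ioo (0 : ℝ) 1)
    (hr₂ : r₂ ∈ Ioo (0 : ℝ) 1) (hs₁ : s₁ ∈ Ioo (0 : ℝ) 1) (hs₂ : s₂ ∈ Ioo (0 : ℝ) 1)
    (h₁ : r₁ ≤ s₁) (h₂ : r₂ ≤ s₂) :
    ∫⁻ θ₁, ∫⁻ θ₂, ‖f (circleMap 0 r₁ θ₁, circleMap 0 r₂ θ₂)‖ₑ ^ 2 ∂angle ∂angle ≤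
      ∫⁻ θ₁, ∫⁻ θ₂, ‖f (circleMap 0 s₁ θ₁, circleMap 0 s₂ θ₂)‖ₑ ^ 2 ∂angle ∂angle := by
  calc _ ≤ ∫⁻ θ₁, ∫⁻ θ₂, ‖f (circleMap 0 r₁ θ₁, circleMap 0 s₂ θ₂)‖ₑ ^ 2 ∂angle ∂angle := by
        refine lintegral_mono fun θ₁ => ?_
        refine circle_mono (g := fun w => f (circleMap 0 r₁ θ₁, w)) (fun w hw => ?_) hr₂ hs₂ h₂
        have h := (hf.analytic (circleMap 0 r₁ θ₁, w) ⟨circleMap_mem hr₁ _, hw⟩).differentiableAt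
        exact (h.comp w (f := fun w => (circleMap 0 r₁ θ₁, w))
          (by fun_prop)).differentiableWithinAt
    _ = ∫⁻ θ₂, ∫⁻ θ₁, ‖f (circleMap 0 r₁ θ₁, circleMap 0 s₂ θ₂)‖ₑ ^ 2 ∂angle ∂angle :=
        lintegral_lintegral_swap ((hf.measurable.comp
          (Continuous.measurable (by fun_prop))).enorm.pow_const 2).aemeasurable
    _ ≤ ∫⁻ θ₂, ∫⁻ θ₁, ‖f (circleMap 0 s₁ θ₁, circleMap 0 s₂ θ₂)‖ₑ ^ 2 ∂angle ∂angle := by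
        refine lintegral_mono fun θ₂ => ?_
        refine circle_mono (g := fun w => f (w, circleMap 0 s₂ θ₂)) (fun w hw => ?_) hr₁ hs₁ h₁
        have h := (hf.analytic (w, circleMap 0 s₂ θ₂) ⟨hw, circleMap_mem hs₂ _⟩).differentiableAt
        exact (h.comp w (f := fun w => (w, circleMap 0 s₂ θ₂))
          (by fun_prop)).differentiableWithinAt
    _ = _ := lintegral_lintegral_swap ((hf.measurable.comp
          (Continuous.measurable (by fun_prop))).enorm.pow_const 2).aemeasurable

lemma hardyMean_mono {f : ℂ × ℂ → ℂ} (hf : IsHolo f) : MonotoneOn (hardyMean f) (Ioo 0 1) :=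
  fun _ hr _ hs h => torus_mono hf hr hr hs hs h h

lemma eq_zero_of_punctured {h : ℂ → ℂ} (hc : ContinuousOn h (ball 0 1))
    (h0 : ∀ z ∈ ball (0 : ℂ) 1, z ≠ 0 → h z = 0) : ∀ z ∈ ball (0 : ℂ) 1, h z = 0 := by
  intro z hz
  by_cases hz0 : z = 0
  · subst hz0
    have h1 : Tendsto h (𝓝[≠] 0) (𝓝 (h 0)) :=
      ((hc.continuousAt (isOpen_ball.mem_nhds hz)).tendsto).mono_left nhdsWithin_le_nhds
    have h2 : h =ᶠ[𝓝[≠] 0] fun _ => 0 := by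
      filter_upwards [self_mem_nhdsWithin, nhdsWithin_le_nhds (isOpen_ball.mem_nhds hz)] with w hw hw2
      exact h0 w hw2 hw
    exact tendsto_nhds_unique (h1.congr' h2) tendsto_const_nhds
  · exact h0 z hz hz0

/-- A function of Hardy norm zero vanishes. -/
lemma eq_zero_of_hardySq {f : ℂ × ℂ → ℂ} (hf : IsHolo f) (h : hardySq f = 0) : f = 0 := by
  have hmean : ∀ r ∈ Ioo (0 : ℝ) 1, hardyMean f r = 0 := fun r hr =>
    le_antisymm ((le_iSup₂ (f := fun r (_ : r ∈ Ioo (0 : ℝ) 1) => hardyMean f r) r hr).trans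
      h.le) zero_le
  have hpi : (0 : ℝ) < 2 * Real.pi := by positivity
  have key : ∀ z₁ ∈ ball (0 : ℂ) 1, z₁ ≠ 0 → ∀ z₂ ∈ ball (0 : ℂ) 1, z₂ ≠ 0 → f (z₁, z₂) = 0 := by
    intro z₁ hz₁ h₁ z₂ hz₂ h₂
    have hr₁ : ‖z₁‖ ∈ Ioo (0 : ℝ) 1 := ⟨by positivity, by simpa using hz₁⟩
    have hr₂ : ‖z₂‖ ∈ Ioo (0 : ℝ) 1 := ⟨by positivity, by simpa using hz₂⟩
    have hR : max ‖z₁‖ ‖z₂‖ ∈ Ioo (0 : ℝ) 1 := ⟨lt_max_of_lt_left hr₁.1, max_lt hr₁.2 hr₂.2⟩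
    have hle := torus_mono hf hr₁ hr₂ hR hR (le_max_left _ _) (le_max_right _ _)
    have hmz : ∫⁻ θ₁, ∫⁻ θ₂, ‖f (circleMap 0 ‖z₁‖ θ₁, circleMap 0 ‖z₂‖ θ₂)‖ₑ ^ 2
        ∂angle ∂angle = 0 := le_antisymm (hle.trans (hmean _ hR).le) zero_le
    set F : ℝ × ℝ → ℂ := fun p => f (circleMap 0 ‖z₁‖ p.1, circleMap 0 ‖z₂‖ p.2) with hF
    have hFc : Continuous F := hf.analytic.continuousOn.comp_continuous (by fun_prop)
      fun p => ⟨circleMap_mem hr₁ _, circleMap_mem hr₂ _⟩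
    have h0 : ∫⁻ p, ‖F p‖ₑ ^ 2 ∂(angle.prod angle) = 0 := by
      rw [lintegral_prod _ (hFc.measurable.enorm.pow_const 2).aemeasurable]
      exact hmz
    rw [lintegral_eq_zero_iff (hFc.measurable.enorm.pow_const 2)] at h0
    have hne : (ENNReal.ofReal (2 * Real.pi))⁻¹ ≠ 0 := ENNReal.inv_ne_zero.2 ENNReal.ofReal_ne_top
    have hac : ((volume : Measure (ℝ × ℝ)).restrict
        (Ioc 0 (2 * Real.pi) ×ˢ Ioc 0 (2 * Real.pi))) ≪ angle.prod angle := by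
      rw [Measure.volume_eq_prod, ← Measure.prod_restrict]
      exact Measure.AbsolutelyContinuous.prod (Measure.absolutelyContinuous_smul hne)
        (Measure.absolutelyContinuous_smul hne)
    have h3 : F =ᵐ[(volume : Measure (ℝ × ℝ)).restrict
        (Ioc 0 (2 * Real.pi) ×ˢ Ioc 0 (2 * Real.pi))] 0 := by
      filter_upwards [hac.ae_le h0] with p hp
      simpa using hp
    have h4 : EqOn F 0 (Ioc 0 (2 * Real.pi) ×ˢ Ioc 0 (2 * Real.pi)) := by
      refine Measure.eqOn_of_ae_eq h3 hFc.continuousOn continuousOn_const ?_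
      rw [interior_prod_eq, interior_Ioc, closure_prod_eq, closure_Ioo hpi.ne]
      exact prod_mono Ioc_subset_Icc_self Ioc_subset_Icc_self
    have hex : ∀ z : ℂ, ∃ θ ∈ Ioc 0 (2 * Real.pi), circleMap 0 ‖z‖ θ = z := by
      intro z
      have hz : z ∈ sphere (0 : ℂ) |‖z‖| := by simp
      rw [← image_circleMap_Ioc] at hz
      exact hz
    obtain ⟨θ₁, ht₁, e₁⟩ := hex z₁
    obtain ⟨θ₂, ht₂, e₂⟩ := hex z₂
    have := h4 (x := (θ₁, θ₂)) ⟨ht₁, ht₂⟩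
    simpa [hF, e₁, e₂] using this
  have hc₁ : ∀ z₂ ∈ ball (0 : ℂ) 1, ContinuousOn (fun z₁ => f (z₁, z₂)) (ball 0 1) := fun z₂ h₂ =>
    hf.analytic.continuousOn.comp (f := fun z₁ => (z₁, z₂)) (by fun_prop) fun z₁ h₁ => ⟨h₁, h₂⟩
  have hc₂ : ∀ z₁ ∈ ball (0 : ℂ) 1, ContinuousOn (fun z₂ => f (z₁, z₂)) (ball 0 1) := fun z₁ h₁ =>
    hf.analytic.continuousOn.comp (f := fun z₂ => (z₁, z₂)) (by fun_prop) fun z₂ h₂ => ⟨h₁, h₂⟩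
  ext ⟨z₁, z₂⟩
  by_cases hz : (z₁, z₂) ∈ bidisc
  · exact eq_zero_of_punctured (hc₁ z₂ hz.2) (fun w₁ hw₁ hw₁0 =>
      eq_zero_of_punctured (hc₂ w₁ hw₁) (fun w₂ hw₂ hw₂0 => key w₁ hw₁ hw₁0 w₂ hw₂ hw₂0) z₂ hz.2)
      z₁ hz.1
  · exact hf.zero_off _ hz

/-! ### The Dirichlet-type space -/

lemma hardySq_eq {f : ℂ × ℂ → ℂ} (hf : IsHolo f) :
    hardySq f = ⨆ r ∈ Ioo (0 : ℝ) 1, ∫⁻ p, ‖torusFun f r p‖ₑ ^ 2 ∂(angle.prod angle) := by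
  simp only [hardySq, hardyMean_eq hf]

/-- The vector space of all `f ∈ H²(𝔻²)` with `D_{μ₁, μ₂}(f) < ∞`. -/
def dirichletSubmodule (μ₁ μ₂ : Measure (closedBall (0 : ℂ) 1)) [IsFiniteMeasure μ₁]
    [IsFiniteMeasure μ₂] : Submodule ℂ (ℂ × ℂ → ℂ) where
  carrier := {f | IsHolo f ∧ hardySq f < ⊤ ∧ dirichletIntegral μ₁ μ₂ f < ⊤}
  zero_mem' := by
    refine ⟨IsHolo.zero, ?_, ?_⟩
    · simp [hardySq, hardyMean]
    · have h₁ : partial₁ 0 = 0 := by ext; simp [partial₁]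
      have h₂ : partial₂ 0 = 0 := by ext; simp [partial₂]
      simp [dirichletIntegral, dirichletMean₁, dirichletMean₂, h₁, h₂]
  add_mem' := by
    rintro f g ⟨hf, hf₁, hf₂⟩ ⟨hg, hg₁, hg₂⟩
    refine ⟨hf.add hg, ?_, ?_⟩
    · rw [hardySq_eq hf] at hf₁
      rw [hardySq_eq hg] at hg₁
      rw [hardySq_eq (hf.add hg)]
      exact sup_add_lt_top (measurable_torusFun hf) (fun r _ => ae_of_all _ fun p => rfl) hf₁ hg₁
    · simp only [dirichletIntegral, dirichletMean₁_eq, dirichletMean₂_eq, ENNReal.add_lt_top]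
        at hf₂ hg₂ ⊢
      exact ⟨sup_add_lt_top (measurable_derivFun₁ f) (fun r hr => derivFun₁_add μ₁ hf hg hr)
          hf₂.1 hg₂.1,
        sup_add_lt_top (measurable_derivFun₂ f) (fun r hr => derivFun₂_add μ₂ hf hg hr)
          hf₂.2 hg₂.2⟩
  smul_mem' := by
    rintro c f ⟨hf, hf₁, hf₂⟩
    refine ⟨hf.smul c, ?_, ?_⟩
    · rw [hardySq_eq hf] at hf₁
      rw [hardySq_eq (hf.smul c)]
      exact sup_smul_lt_top (c := c) (fun r _ => ae_of_all _ fun p => rfl) hf₁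
    · simp only [dirichletIntegral, dirichletMean₁_eq, dirichletMean₂_eq, ENNReal.add_lt_top]
        at hf₂ ⊢
      exact ⟨sup_smul_lt_top (c := c) (fun r _ => (derivFun₁_smul c r).eventuallyEq) hf₂.1,
        sup_smul_lt_top (c := c) (fun r _ => (derivFun₂_smul c r).eventuallyEq) hf₂.2⟩

/-- The Dirichlet-type space `D(μ₁, μ₂)`. It is a type of its own, so that it carries the norm
topology and not the topology of pointwise convergence. -/
def DirichletSpace (μ₁ μ₂ : Measure (closedBall (0 : ℂ) 1)) [IsFiniteMeasure μ₁]
    [IsFiniteMeasure μ₂] : Type := dirichletSubmodule μ₁ μ₂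

namespace DirichletSpace

variable {μ₁ μ₂ : Measure (closedBall (0 : ℂ) 1)} [IsFiniteMeasure μ₁] [IsFiniteMeasure μ₂]

instance : AddCommGroup (DirichletSpace μ₁ μ₂) :=
  inferInstanceAs (AddCommGroup (dirichletSubmodule μ₁ μ₂))

instance : Module ℂ (DirichletSpace μ₁ μ₂) :=
  inferInstanceAs (Module ℂ (dirichletSubmodule μ₁ μ₂))

/-- The function on the bidisc underlying an element of `D(μ₁, μ₂)`. -/
def toFun (f : DirichletSpace μ₁ μ₂) : ℂ × ℂ → ℂ := Subtype.val f

lemma mem (f : DirichletSpace μ₁ μ₂) :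
    IsHolo f.toFun ∧ hardySq f.toFun < ⊤ ∧ dirichletIntegral μ₁ μ₂ f.toFun < ⊤ := f.2

@[simp] lemma toFun_add (f g : DirichletSpace μ₁ μ₂) : (f + g).toFun = f.toFun + g.toFun := rfl

@[simp] lemma toFun_smul (c : ℂ) (f : DirichletSpace μ₁ μ₂) : (c • f).toFun = c • f.toFun := rfl

/-- `‖f‖² = ‖f‖²_{H²(𝔻²)} + D_{μ₁, μ₂}(f)`. -/
def normSq (f : DirichletSpace μ₁ μ₂) : ℝ :=
  (hardySq f.toFun + dirichletIntegral μ₁ μ₂ f.toFun).toReal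

lemma isHerm_normSq : IsHerm (normSq (μ₁ := μ₁) (μ₂ := μ₂)) := by
  have hD : ∀ f : DirichletSpace μ₁ μ₂,
      (⨆ r ∈ Ioo (0 : ℝ) 1, dirichletMean₁ μ₁ f.toFun r) < ⊤ ∧
      (⨆ r ∈ Ioo (0 : ℝ) 1, dirichletMean₂ μ₂ f.toFun r) < ⊤ := fun f =>
    ENNReal.add_lt_top.1 f.mem.2.2
  have hIoo : ∀ᶠ r in 𝓝[<] (1 : ℝ), r ∈ Ioo (0 : ℝ) 1 := Ioo_mem_nhdsLT zero_lt_one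
  have h₀ : IsHerm fun f : DirichletSpace μ₁ μ₂ => (hardySq f.toFun).toReal := by
    suffices hq : ∀ r ∈ Ioo (0 : ℝ) 1, IsHerm fun f : DirichletSpace μ₁ μ₂ =>
        (hardyMean f.toFun r).toReal from
      IsHerm.of_tendsto (hIoo.mono hq)
        fun f => tendsto_sup (hardyMean_mono f.mem.1) f.mem.2.1
    intro r hr
    simp only [fun f : DirichletSpace μ₁ μ₂ => hardyMean_eq f.mem.1 r]
    refine IsHerm.of_lintegral _ (fun f : DirichletSpace μ₁ μ₂ => torusFun f.toFun r)
      (fun f => measurable_torusFun f.mem.1 r) (fun f => ?_)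
      (fun f g => ae_of_all _ fun p => rfl) (fun c f => ae_of_all _ fun p => rfl)
    rw [← hardyMean_eq f.mem.1]
    exact (le_iSup₂ (f := fun r (_ : r ∈ Ioo (0 : ℝ) 1) => hardyMean f.toFun r) r hr).trans_lt
      f.mem.2.1
  have h₁ : IsHerm fun f : DirichletSpace μ₁ μ₂ =>
      (⨆ r ∈ Ioo (0 : ℝ) 1, dirichletMean₁ μ₁ f.toFun r).toReal := by
    suffices hq : ∀ r ∈ Ioo (0 : ℝ) 1, IsHerm fun f : DirichletSpace μ₁ μ₂ =>
        (dirichletMean₁ μ₁ f.toFun r).toReal from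
      IsHerm.of_tendsto (hIoo.mono hq)
        fun f => tendsto_sup (dirichletMean₁_mono μ₁ f.mem.1) (hD f).1
    intro r hr
    simp only [dirichletMean₁_eq]
    refine IsHerm.of_lintegral _ (fun f : DirichletSpace μ₁ μ₂ => derivFun₁ f.toFun r)
      (fun f => measurable_derivFun₁ _ r) (fun f => ?_)
      (fun f g => derivFun₁_add μ₁ f.mem.1 g.mem.1 hr)
      (fun c f => (derivFun₁_smul c r).eventuallyEq)
    rw [← dirichletMean₁_eq]
    exact (le_iSup₂ (f := fun r (_ : r ∈ Ioo (0 : ℝ) 1) =>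
      dirichletMean₁ μ₁ f.toFun r) r hr).trans_lt (hD f).1
  have h₂ : IsHerm fun f : DirichletSpace μ₁ μ₂ =>
      (⨆ r ∈ Ioo (0 : ℝ) 1, dirichletMean₂ μ₂ f.toFun r).toReal := by
    suffices hq : ∀ r ∈ Ioo (0 : ℝ) 1, IsHerm fun f : DirichletSpace μ₁ μ₂ =>
        (dirichletMean₂ μ₂ f.toFun r).toReal from
      IsHerm.of_tendsto (hIoo.mono hq)
        fun f => tendsto_sup (dirichletMean₂_mono μ₂ f.mem.1) (hD f).2
    intro r hr
    simp only [dirichletMean₂_eq]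
    refine IsHerm.of_lintegral _ (fun f : DirichletSpace μ₁ μ₂ => derivFun₂ f.toFun r)
      (fun f => measurable_derivFun₂ _ r) (fun f => ?_)
      (fun f g => derivFun₂_add μ₂ f.mem.1 g.mem.1 hr)
      (fun c f => (derivFun₂_smul c r).eventuallyEq)
    rw [← dirichletMean₂_eq]
    exact (le_iSup₂ (f := fun r (_ : r ∈ Ioo (0 : ℝ) 1) =>
      dirichletMean₂ μ₂ f.toFun r) r hr).trans_lt (hD f).2
  convert h₀.add (h₁.add h₂) using 2 with f
  rw [normSq, ENNReal.toReal_add f.mem.2.1.ne f.mem.2.2.ne, dirichletIntegral,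
    ENNReal.toReal_add (hD f).1.ne (hD f).2.ne]

/-- The inner product of `D(μ₁, μ₂)`: the one that polarizes the square of the norm. -/
@[reducible]
def core (μ₁ μ₂ : Measure (closedBall (0 : ℂ) 1)) [IsFiniteMeasure μ₁] [IsFiniteMeasure μ₂] :
    InnerProductSpace.Core ℂ (DirichletSpace μ₁ μ₂) where
  inner f g := polar normSq f g
  conj_inner_symm f g := isHerm_normSq.symm f g
  re_inner_nonneg f := by
    rw [isHerm_normSq.self]
    exact isHerm_normSq.nonneg f
  add_left f g h := isHerm_normSq.add_left f g h
  smul_left f g c := isHerm_normSq.smul_left f g c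
  definite f hf := by
    rw [isHerm_normSq.self, Complex.ofReal_eq_zero, normSq, ENNReal.toReal_eq_zero_iff] at hf
    have h := hf.resolve_right (ENNReal.add_lt_top.2 f.mem.2).ne
    exact Subtype.ext (eq_zero_of_hardySq f.mem.1 (add_eq_zero.1 h).1)

instance : NormedAddCommGroup (DirichletSpace μ₁ μ₂) :=
  (core μ₁ μ₂).toNormedAddCommGroup

instance : InnerProductSpace ℂ (DirichletSpace μ₁ μ₂) := InnerProductSpace.ofCore (core μ₁ μ₂).toCore

lemma norm_sq_eq (f : DirichletSpace μ₁ μ₂) :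
    ‖f‖ ^ 2 = (hardySq f.toFun + dirichletIntegral μ₁ μ₂ f.toFun).toReal := by
  have h : inner ℂ f f = polar normSq f f := rfl
  rw [isHerm_normSq.self, inner_self_eq_norm_sq_to_K] at h
  exact Complex.ofReal_injective (by push_cast; exact h)

end DirichletSpace

end Bidisc

end

noncomputable section

namespace Bidisc

/-! ### Parseval's identity on circles and polar coordinates -/

/-! Everything reduces to one variable. Write D_ζ for the Dirichlet integral on the disc attached to
the point mass at ζ, |ζ| ≤ 1. Since U_μ is the integral of its kernels against μ (`weight_eq`),
Tonelli turns the first Dirichlet mean of f at radius r into the integral of D_ζ(f(·, re^{iθ})) over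
θ and ζ (`dirichletMean₁_eq_sliceDirichlet`).

The core is `exists_localDirichlet_pow_mul`: if D_ζ(g) < ∞, some v satisfies D_ζ(z^n g) = D_ζ(g) +
|v|² ∑_{j<n} |ζ|^{2j} and |v|² ≤ 2|g(0)|² + 2 D_ζ(g). For |ζ| < 1, v = g(ζ): the automorphism φ
exchanging 0 and ζ turns D_ζ(g) into (1 - |ζ|²)⁻¹ times the squared H² norm of g∘φ without its
constant term, and multiplication by z into multiplication by φ, an isometry of H². For |ζ| = 1, v
is the sum of the Taylor series of g at ζ: D_ζ(g) is the squared norm of g'/(1 - ζ̄z) for the weight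
1 - |z|², a weighted sum of squares of partial sums, and its increment telescopes.

The difference of order n + 1 of n ↦ D_ζ(z^n g) is then -|v|²(1 - |ζ|²)^n ≤ 0, and the bound on v
makes multiplication by z₁ bounded. Multiplication by z₂ multiplies the Hardy mean and the first
Dirichlet mean of radius r by r², a factor that disappears in the supremum because the means
increase with r. With the variables exchanged, this gives ‖z₁^i z₂^j f‖² = p + q_i + s_j with q and
s completely alternating (`totalSq_orbit`). Mixed differences of such an array vanish, whence the
zero defect, and the remaining ones are differences of q or of s
(`isToralCompletelyHyperexpansive_of_norm_sq`).

For completeness, Cauchy's formula writes f(z) as a functional depending continuously on f, applied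
to a kernel analytic in z with values in C(𝕋²). A Cauchy sequence therefore converges pointwise with
its derivatives to a holomorphic function (`exists_analytic_limit`), and Fatou's lemma gives
convergence in norm. Separability holds because the reproducing kernels at a countable dense set of
points have dense span. -/

lemma integral_exp_int_mul (k : ℤ) :
    ∫ θ in (0 : ℝ)..(2 * Real.pi), Complex.exp (k * θ * I) = if k = 0 then (2 * Real.pi : ℂ) else 0 := by
  split_ifs with hk
  · simp [hk]
  · have hc : (k * I : ℂ) ≠ 0 := mul_ne_zero (by exact_mod_cast hk) I_ne_zero
    have h := integral_exp_mul_complex (a := 0) (b := 2 * Real.pi) hc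
    have e : ∀ θ : ℝ, (k * θ * I : ℂ) = k * I * θ := fun θ => by ring
    simp only [e, h]
    have h1 : (k * I * ((2 * Real.pi : ℝ) : ℂ)) = k * (2 * Real.pi * I) := by push_cast; ring
    rw [h1, Complex.exp_int_mul_two_pi_mul_I]
    simp

/-- Absolute summability at radius r dominates the series uniformly in θ, so it may be integrated
term by term; orthogonality leaves at most the term of index n. -/
lemma fourierCoeffOn_of_hasSum {a : ℕ → ℂ} {g : ℝ → ℂ} {r : ℝ} (hr : 0 ≤ r)
    (hs : Summable fun n => ‖a n‖ * r ^ n)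
    (hg : ∀ θ, HasSum (fun n => a n * circleMap 0 r θ ^ n) (g θ)) (n : ℤ) :
    fourierCoeffOn (show (0 : ℝ) < 2 * Real.pi by positivity) g n =
      if 0 ≤ n then a n.toNat * r ^ n.toNat else 0 := by
  rw [fourierCoeffOn_eq_integral]
  have hpi : (Real.pi : ℂ) ≠ 0 := by exact_mod_cast Real.pi_ne_zero
  have e1 : ∀ (m : ℕ) (θ : ℝ), (fourier (-n) ((θ : ℝ) : AddCircle (2 * Real.pi - 0)) : ℂ) •
      (a m * circleMap 0 r θ ^ m) = a m * r ^ m * Complex.exp (((m - n : ℤ) : ℂ) * θ * I) := by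
    intro m θ
    rw [fourier_coe_apply, circleMap_zero, mul_pow, ← Complex.exp_nat_mul, smul_eq_mul,
      show ((m - n : ℤ) : ℂ) * θ * I = 2 * Real.pi * I * (-n : ℤ) * θ / (2 * Real.pi - 0 : ℝ)
        + m * (θ * I) by push_cast; field_simp; ring, Complex.exp_add]
    ring
  have h1 := intervalIntegral.hasSum_integral_of_dominated_convergence (μ := volume) (a := 0)
    (b := 2 * Real.pi) (F := fun m θ => (fourier (-n) ((θ : ℝ) : AddCircle (2 * Real.pi - 0)) : ℂ) •
      (a m * circleMap 0 r θ ^ m))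
    (f := fun θ => (fourier (-n) ((θ : ℝ) : AddCircle (2 * Real.pi - 0)) : ℂ) • g θ)
    (fun m _ => ‖a m‖ * r ^ m) ?_ ?_ ?_ ?_ ?_
  · simp only [e1, intervalIntegral.integral_const_mul, integral_exp_int_mul] at h1
    split_ifs with hn
    · have h2 := hasSum_single (f := fun m : ℕ => a m * (r : ℂ) ^ m *
        if (m - n : ℤ) = 0 then (2 * Real.pi : ℂ) else 0) n.toNat fun m hm => by
          rw [if_neg (by omega), mul_zero]
      rw [h1.unique h2, if_pos (by omega), Complex.real_smul]
      push_cast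
      field_simp
      ring
    · have h2 : HasSum (fun m : ℕ => a m * (r : ℂ) ^ m *
          if (m - n : ℤ) = 0 then (2 * Real.pi : ℂ) else 0) 0 := by
        convert hasSum_zero using 2 with m
        rw [if_neg (by omega), mul_zero]
      rw [h1.unique h2, smul_zero]
  · intro m
    refine Continuous.aestronglyMeasurable (Continuous.congr ?_ fun θ => (e1 m θ).symm)
    fun_prop
  · refine fun m => ae_of_all _ fun θ _ => ?_
    simp only [e1]
    rw [norm_mul, norm_mul, norm_pow, Complex.norm_real, Real.norm_of_nonneg hr,
      show ((m - n : ℤ) : ℂ) * θ * I = (((m - n : ℤ) * θ : ℝ) : ℂ) * I by push_cast; ring,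
      Complex.norm_exp_ofReal_mul_I, mul_one]
  · exact ae_of_all _ fun θ _ => hs
  · simp
  · exact ae_of_all _ fun θ _ => (hg θ).const_smul _

/-- Parseval's identity for a power series on a circle. -/
lemma circle_parseval {a : ℕ → ℂ} {g : ℝ → ℂ} {r : ℝ} (hr : 0 ≤ r)
    (hs : Summable fun n => ‖a n‖ * r ^ n)
    (hg : ∀ θ, HasSum (fun n => a n * circleMap 0 r θ ^ n) (g θ)) :
    ∫⁻ θ, ‖g θ‖ₑ ^ 2 ∂angle = ∑' n, ‖a n‖ₑ ^ 2 * ENNReal.ofReal (r ^ (2 * n)) := by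
  have h2pi : (0 : ℝ) < 2 * Real.pi := by positivity
  have hcont : Continuous g := by
    have : g = fun θ => ∑' n, a n * circleMap 0 r θ ^ n := funext fun θ => (hg θ).tsum_eq.symm
    rw [this]
    refine continuous_tsum (u := fun n => ‖a n‖ * r ^ n) (fun n => by fun_prop) hs fun n θ => ?_
    simp [abs_of_nonneg hr]
  have hL2 : MemLp g 2 (volume.restrict (Ioc 0 (2 * Real.pi))) := by
    refine MemLp.mono_measure (Measure.restrict_mono Ioc_subset_Icc_self le_rfl) ?_
    obtain ⟨C, hC⟩ := isCompact_Icc.exists_bound_of_continuousOn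
      (s := Icc 0 (2 * Real.pi)) hcont.continuousOn
    exact MemLp.of_bound hcont.aestronglyMeasurable C ((ae_restrict_mem measurableSet_Icc).mono hC)
  have h1 := hasSum_sq_fourierCoeffOn h2pi hL2
  simp only [fourierCoeffOn_of_hasSum hr hs hg] at h1
  have h3 : HasSum (fun n : ℕ => ‖a n‖ ^ 2 * r ^ (2 * n))
      ((2 * Real.pi - 0)⁻¹ • ∫ x in (0 : ℝ)..(2 * Real.pi), ‖g x‖ ^ 2) := by
    -- Coefficients of negative index vanish, so the sum over ℤ is a sum over ℕ.
    rw [← (Nat.cast_injective (R := ℤ)).hasSum_iff] at h1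
    · convert h1 using 2 with n
      simp [mul_pow, abs_of_nonneg hr, pow_mul']
    · intro n hn
      rw [if_neg (fun h => hn ⟨n.toNat, by simp [h]⟩)]
      simp
  have h4 : ∫⁻ θ, ‖g θ‖ₑ ^ 2 ∂angle =
      ENNReal.ofReal ((2 * Real.pi - 0)⁻¹ • ∫ x in (0 : ℝ)..(2 * Real.pi), ‖g x‖ ^ 2) := by
    rw [angle, lintegral_smul_measure, smul_eq_mul, intervalIntegral.integral_of_le h2pi.le,
      smul_eq_mul, sub_zero, ENNReal.ofReal_mul (inv_nonneg.2 h2pi.le),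
      ENNReal.ofReal_inv_of_pos h2pi, ofReal_integral_eq_lintegral_ofReal hL2.integrable_norm_pow'
        (Eventually.of_forall fun _ => by positivity)]
    congr 2
    ext θ
    rw [ENNReal.ofReal_pow (norm_nonneg _), ofReal_norm]
  rw [h4, ← h3.tsum_eq, ENNReal.ofReal_tsum_of_nonneg (fun n => by positivity) h3.summable]
  refine tsum_congr fun n => ?_
  rw [ENNReal.ofReal_mul (by positivity), ENNReal.ofReal_pow (norm_nonneg _), ofReal_norm]

/-- `angle` lives on (0, 2π] and polar coordinates on (-π, π); up to a null set both are fundamental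
domains for translation by 2π. -/
lemma lintegral_angle_of_periodic {F : ℝ → ℝ≥0∞} (hF : Function.Periodic F (2 * Real.pi)) :
    ∫⁻ θ, F θ ∂angle =
      (ENNReal.ofReal (2 * Real.pi))⁻¹ * ∫⁻ θ in Ioo (-Real.pi) Real.pi, F θ := by
  have hT : (0 : ℝ) < 2 * Real.pi := by positivity
  have : VAddInvariantMeasure (AddSubgroup.zmultiples (2 * Real.pi)) ℝ volume :=
    ⟨fun c s _ => measure_preimage_add _ _ _⟩
  rw [angle, lintegral_smul_measure, smul_eq_mul]
  congr 1
  rw [setLIntegral_congr (Ioo_ae_eq_Ioc (μ := volume) (a := -Real.pi) (b := Real.pi))]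
  have h := IsAddFundamentalDomain.setLIntegral_eq (G := AddSubgroup.zmultiples (2 * Real.pi))
    (isAddFundamentalDomain_Ioc hT 0) (isAddFundamentalDomain_Ioc hT (-Real.pi)) F
    hF.map_vadd_zmultiples
  rwa [zero_add, show -Real.pi + 2 * Real.pi = Real.pi by ring] at h

/-- Polar coordinates, with the normalizations r dr dθ / π = 2r dr · dθ / 2π. -/
lemma lintegral_area_polar {F : ℂ → ℝ≥0∞} (hF : Measurable F) :
    ∫⁻ z, F z ∂area =
      ∫⁻ r in Ioo (0 : ℝ) 1, ENNReal.ofReal (2 * r) * ∫⁻ θ, F (circleMap 0 r θ) ∂angle := by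
  have hpi := Real.pi_pos
  have e : ∀ p : ℝ × ℝ, Complex.polarCoord.symm p = circleMap 0 p.1 p.2 := fun p => by
    rw [Complex.polarCoord_symm_apply, circleMap_zero, Complex.exp_mul_I]
    push_cast
    rfl
  have hcm : Measurable fun p : ℝ × ℝ => circleMap 0 p.1 p.2 :=
    Continuous.measurable (by unfold circleMap; fun_prop)
  rw [area, lintegral_smul_measure, smul_eq_mul, ← lintegral_indicator measurableSet_ball,
    ← Complex.lintegral_comp_polarCoord_symm, polarCoord_target, Measure.volume_eq_prod,
    ← Measure.prod_restrict, lintegral_prod, ← lintegral_const_mul',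
    ← lintegral_indicator measurableSet_Ioi, ← lintegral_indicator measurableSet_Ioo]
  · refine lintegral_congr fun r => ?_
    by_cases h0 : 0 < r
    · rw [indicator_of_mem (by exact h0)]
      by_cases h1 : r < 1
      · rw [indicator_of_mem (by exact ⟨h0, h1⟩), lintegral_angle_of_periodic
          (fun θ => by rw [periodic_circleMap]), ← mul_assoc]
        simp only [e, smul_eq_mul]
        rw [lintegral_const_mul', ← mul_assoc]
        · congr 1
          · rw [ENNReal.ofReal_mul (by norm_num), ENNReal.ofReal_mul (by norm_num),
              ENNReal.mul_inv (by simp) (by simp), mul_comm (ENNReal.ofReal 2), mul_assoc,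
              ← mul_assoc (ENNReal.ofReal 2), ENNReal.mul_inv_cancel (by simp) (by simp), one_mul,
              mul_comm]
          · refine lintegral_congr fun θ => indicator_of_mem ?_ _
            simpa [abs_of_pos h0] using h1
        · simp
      · rw [indicator_of_notMem (fun h => h1 h.2)]
        have : ∀ θ : ℝ, (ball (0 : ℂ) 1).indicator F (circleMap 0 r θ) = 0 := fun θ =>
          indicator_of_notMem (by simpa [abs_of_pos h0] using h1) _
        simp [e, this]
    · rw [indicator_of_notMem (by exact h0), indicator_of_notMem (fun h => h0 h.1)]
  · simp [hpi]
  · simp only [e]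
    refine Measurable.aemeasurable ?_
    exact (measurable_fst.ennreal_ofReal).smul ((hF.indicator measurableSet_ball).comp hcm)

/-! ### Two summation identities -/

/-- The partial sum `∑_{k ≤ n} (k + 1) b_{k + 1}`. -/
def derivSum (b : ℕ → ℂ) (n : ℕ) : ℂ := ∑ k ∈ Finset.range (n + 1), ((k : ℂ) + 1) * b (k + 1)

/-- The coefficients of `z g(z)` when `b` are those of `g`. -/
def shift (b : ℕ → ℂ) : ℕ → ℂ
  | 0 => 0
  | n + 1 => b n

@[simp] lemma shift_zero (b : ℕ → ℂ) : shift b 0 = 0 := rfl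

@[simp] lemma shift_succ (b : ℕ → ℂ) (n : ℕ) : shift b (n + 1) = b n := rfl

/-- The weight `1 / ((n + 1)(n + 2))`. -/
def telWeight (n : ℕ) : ℝ := 1 / ((n + 1) * (n + 2))

lemma telWeight_pos (n : ℕ) : 0 < telWeight n := by unfold telWeight; positivity

lemma sum_telWeight (N : ℕ) : ∑ n ∈ Finset.range N, telWeight n = 1 - 1 / (N + 1) := by
  induction N with
  | zero => simp
  | succ N ih =>
    rw [Finset.sum_range_succ, ih, telWeight]
    push_cast
    field_simp
    ring

lemma summable_telWeight : Summable telWeight := by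
  refine summable_of_sum_range_le (c := 1) (fun n => (telWeight_pos n).le) fun N => ?_
  rw [sum_telWeight]
  have : (0 : ℝ) ≤ 1 / (N + 1) := by positivity
  linarith

lemma derivSum_succ (b : ℕ → ℂ) (n : ℕ) :
    derivSum b (n + 1) = derivSum b n + ((n : ℂ) + 2) * b (n + 2) := by
  rw [derivSum, Finset.sum_range_succ, derivSum]
  push_cast
  ring

/-- The shifted series has terms (k + 1) b_k = k b_k + b_k. -/
lemma derivSum_shift_succ (b : ℕ → ℂ) (n : ℕ) :
    derivSum (shift b) (n + 1) = derivSum b n + ∑ k ∈ Finset.range (n + 2), b k := by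
  induction n with
  | zero =>
    simp [derivSum, Finset.sum_range_succ]
    ring
  | succ n ih =>
    rw [derivSum_succ, ih, derivSum_succ, Finset.sum_range_succ _ (n + 2), shift_succ]
    push_cast
    ring

/-- Abel summation of b_k = (1/k) · k b_k, where `telWeight j` = 1/(j + 1) - 1/(j + 2). It lets the
convergence of ∑ b_k be read off from the size of the partial sums of ∑ k b_k. -/
lemma sum_eq_derivSum (b : ℕ → ℂ) (n : ℕ) :
    ∑ k ∈ Finset.range (n + 2), b k =
      b 0 + derivSum b n / (n + 2) + ∑ j ∈ Finset.range (n + 1), derivSum b j * telWeight j := by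
  induction n with
  | zero =>
    simp [derivSum, Finset.sum_range_succ, telWeight]
    ring
  | succ n ih =>
    rw [Finset.sum_range_succ, ih, Finset.sum_range_succ _ (n + 1), derivSum_succ, telWeight]
    push_cast
    have h1 : (n : ℂ) + 2 ≠ 0 := by exact_mod_cast (by positivity : (n : ℝ) + 2 ≠ 0)
    have h2 : (n : ℂ) + 1 + 2 ≠ 0 := by exact_mod_cast (by positivity : (n : ℝ) + 1 + 2 ≠ 0)
    have h3 : (n : ℂ) + 1 + 1 ≠ 0 := by exact_mod_cast (by positivity : (n : ℝ) + 1 + 1 ≠ 0)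
    field_simp
    ring

/-- The increments telescope exactly. In the limit the first term on the right gives |∑ b_k|², and
the second vanishes because `derivSum b N / (N + 2)` tends to zero. -/
lemma sum_telWeight_shift_sub (b : ℕ → ℂ) (N : ℕ) :
    ∑ n ∈ Finset.range (N + 1),
        telWeight n * (‖derivSum (shift b) n‖ ^ 2 - ‖derivSum b n‖ ^ 2) =
      ((N + 1) * ‖∑ k ∈ Finset.range (N + 2), b k‖ ^ 2 -
        2 * ((∑ k ∈ Finset.range (N + 2), b k) * conj (derivSum b N)).re) / (N + 2) := by
  induction N with
  | zero =>
    simp [telWeight, derivSum, Finset.sum_range_succ, Complex.sq_norm,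
      Complex.normSq_apply]
    ring
  | succ N ih =>
    rw [Finset.sum_range_succ, ih, derivSum_shift_succ, derivSum_succ,
      Finset.sum_range_succ _ (N + 2)]
    generalize ∑ k ∈ Finset.range (N + 2), b k = s
    generalize derivSum b N = c
    generalize b (N + 2) = d
    simp only [telWeight, Complex.sq_norm, Complex.normSq_apply, add_re, add_im, mul_re, mul_im,
      conj_re, conj_im, natCast_re, natCast_im, re_ofNat, im_ofNat]
    push_cast
    field_simp
    ring

/-- The terms of a convergent series tend to zero, and 1/(n + 2)² ≤ `telWeight n`. -/
lemma tendsto_derivSum_div {b : ℕ → ℂ}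
    (hb : Summable fun n => ‖derivSum b n‖ ^ 2 * telWeight n) :
    Tendsto (fun n : ℕ => derivSum b n / (n + 2)) atTop (𝓝 0) := by
  rw [tendsto_zero_iff_norm_tendsto_zero]
  have h := hb.tendsto_atTop_zero.sqrt
  rw [Real.sqrt_zero] at h
  refine squeeze_zero (fun _ => norm_nonneg _) (fun n => Real.le_sqrt_of_sq_le ?_) h
  rw [norm_div, div_pow, telWeight, ← div_eq_mul_one_div,
    show ‖(n : ℂ) + 2‖ = n + 2 by rw [← Nat.cast_ofNat, ← Nat.cast_add, Complex.norm_natCast]; simp]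
  gcongr
  nlinarith

/-- If `∑ w_n |c_n|² < ∞` for the partial sums `c_n` of `∑ k b_k`, then `∑ b_k` converges. -/
lemma exists_tendsto_of_summable_derivSum {b : ℕ → ℂ}
    (hb : Summable fun n => ‖derivSum b n‖ ^ 2 * telWeight n) :
    ∃ L, Tendsto (fun N => ∑ k ∈ Finset.range N, b k) atTop (𝓝 L) ∧
      ‖L‖ ^ 2 ≤ 2 * ‖b 0‖ ^ 2 + 2 * ∑' n, ‖derivSum b n‖ ^ 2 * telWeight n := by
  have hsum : Summable fun j => derivSum b j * (telWeight j : ℂ) := by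
    -- Domination by |c| w ≤ w + |c|² w.
    refine Summable.of_norm_bounded (summable_telWeight.add hb) fun j => ?_
    rw [norm_mul, Complex.norm_real, Real.norm_of_nonneg (telWeight_pos j).le]
    nlinarith [telWeight_pos j, sq_nonneg (‖derivSum b j‖ - 1),
      mul_nonneg (telWeight_pos j).le (sq_nonneg (‖derivSum b j‖ - 1)),
      mul_nonneg (telWeight_pos j).le (norm_nonneg (derivSum b j))]
  set D := ∑' n, ‖derivSum b n‖ ^ 2 * telWeight n with hD
  have h0 := tendsto_derivSum_div hb
  have ht := hsum.hasSum.tendsto_sum_nat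
  refine ⟨b 0 + 0 + ∑' j, derivSum b j * (telWeight j : ℂ), ?_, ?_⟩
  · rw [← tendsto_add_atTop_iff_nat 2]
    simp only [sum_eq_derivSum]
    exact (h0.const_add _).add (ht.comp (tendsto_add_atTop_nat 1))
  -- Cauchy–Schwarz with respect to the weights, whose total mass is at most 1.
  · have hle : ‖∑' j, derivSum b j * (telWeight j : ℂ)‖ ^ 2 ≤ D := by
      refine le_of_tendsto (ht.norm.pow 2) (Eventually.of_forall fun N => ?_)
      have h1 : ‖∑ j ∈ Finset.range N, derivSum b j * (telWeight j : ℂ)‖ ≤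
          ∑ j ∈ Finset.range N, ‖derivSum b j‖ * telWeight j := by
        refine (norm_sum_le _ _).trans_eq (Finset.sum_congr rfl fun j _ => ?_)
        rw [norm_mul, Complex.norm_real, Real.norm_of_nonneg (telWeight_pos j).le]
      have h2 := Finset.sum_sq_le_sum_mul_sum_of_sq_le_mul (Finset.range N)
        (r := fun j => ‖derivSum b j‖ * telWeight j) (f := telWeight)
        (g := fun j => ‖derivSum b j‖ ^ 2 * telWeight j) (fun j _ => (telWeight_pos j).le)
        (fun j _ => mul_nonneg (by positivity) (telWeight_pos j).le) (fun j _ => (by ring : _ = _).le)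
      have h3 : ∑ j ∈ Finset.range N, telWeight j ≤ 1 := by
        rw [sum_telWeight]
        have : (0 : ℝ) ≤ 1 / (N + 1) := by positivity
        linarith
      have h4 : ∑ j ∈ Finset.range N, ‖derivSum b j‖ ^ 2 * telWeight j ≤ D :=
        hb.sum_le_tsum _ fun j _ => mul_nonneg (by positivity) (telWeight_pos j).le
      have h5 : 0 ≤ ∑ j ∈ Finset.range N, ‖derivSum b j‖ ^ 2 * telWeight j :=
        Finset.sum_nonneg fun j _ => mul_nonneg (by positivity) (telWeight_pos j).le
      calc _ ≤ (∑ j ∈ Finset.range N, ‖derivSum b j‖ * telWeight j) ^ 2 := by gcongr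
        _ ≤ 1 * ∑ j ∈ Finset.range N, ‖derivSum b j‖ ^ 2 * telWeight j :=
          h2.trans (mul_le_mul_of_nonneg_right h3 h5)
        _ ≤ D := by linarith
    rw [add_zero]
    have h1 := norm_add_le (b 0) (∑' j, derivSum b j * (telWeight j : ℂ))
    have h2 : ‖b 0 + ∑' j, derivSum b j * (telWeight j : ℂ)‖ ^ 2 ≤
        (‖b 0‖ + ‖∑' j, derivSum b j * (telWeight j : ℂ)‖) ^ 2 := by gcongr
    nlinarith [sq_nonneg (‖b 0‖ - ‖∑' j, derivSum b j * (telWeight j : ℂ)‖)]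

/-- This is D_ζ(zg) = D_ζ(g) + |g(ζ)|² at a boundary point, in terms of coefficients: the limit of
`sum_telWeight_shift_sub`. -/
lemma hasSum_derivSum_shift {b : ℕ → ℂ} {L : ℂ}
    (hb : Summable fun n => ‖derivSum b n‖ ^ 2 * telWeight n)
    (hL : Tendsto (fun N => ∑ k ∈ Finset.range N, b k) atTop (𝓝 L)) :
    HasSum (fun n => ‖derivSum (shift b) n‖ ^ 2 * telWeight n)
      ((∑' n, ‖derivSum b n‖ ^ 2 * telWeight n) + ‖L‖ ^ 2) := by
  rw [hasSum_iff_tendsto_nat_of_nonneg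
    fun n => mul_nonneg (by positivity) (telWeight_pos n).le, ← tendsto_add_atTop_iff_nat 1]
  have h0 := tendsto_derivSum_div hb
  have ht := (tendsto_add_atTop_iff_nat 1).2 hb.hasSum.tendsto_sum_nat
  have hL2 := (tendsto_add_atTop_iff_nat 2).2 hL
  have h3 : Tendsto (fun N : ℕ => ((N : ℝ) + 1) / (N + 2)) atTop (𝓝 1) := by
    have h := (tendsto_add_atTop_iff_nat 1).2 (tendsto_natCast_div_add_atTop (1 : ℝ))
    refine h.congr fun n => ?_
    push_cast
    ring
  have h4 := ht.add ((h3.mul (hL2.norm.pow 2)).sub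
    ((Complex.continuous_re.tendsto _).comp
      (hL2.mul ((Complex.continuous_conj.tendsto _).comp h0)) |>.const_mul 2))
  simp only [one_mul, map_zero, mul_zero, Complex.zero_re, sub_zero] at h4
  refine h4.congr fun N => ?_
  have h5 := sum_telWeight_shift_sub b N
  simp only [mul_sub, Finset.sum_sub_distrib] at h5
  have h6 : (conj (derivSum b N / (N + 2)) : ℂ) = conj (derivSum b N) * ((1 / (N + 2) : ℝ) : ℂ) := by
    simp [div_eq_mul_inv, map_ofNat]
  simp only [mul_comm _ (telWeight _), Function.comp, h6, ← mul_assoc, Complex.re_mul_ofReal]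
  rw [eq_add_of_sub_eq h5]
  ring

/-- Multiplication by a Blaschke factor is isometric on `H²`, on the level of coefficients. -/
lemma hasSum_blaschke {f : ℕ → ℂ} {ζ : ℂ} (hζ : ‖ζ‖ < 1)
    (hB : Summable fun n => ‖f (n + 1) - conj ζ * f n‖ ^ 2) :
    HasSum (fun n => ‖ζ * f (n + 1) - f n‖ ^ 2)
      ((∑' n, ‖f (n + 1) - conj ζ * f n‖ ^ 2) + (1 - ‖ζ‖ ^ 2) * ‖f 0‖ ^ 2) := by
  -- For all x and y, |ζx - y|² - |x - ζ̄y|² = (1 - |ζ|²)(|y|² - |x|²); with x = f(n+1), y = f(n)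
  -- this telescopes.
  have htel : ∀ N, ∑ n ∈ Finset.range N, ‖ζ * f (n + 1) - f n‖ ^ 2 =
      ∑ n ∈ Finset.range N, ‖f (n + 1) - conj ζ * f n‖ ^ 2 +
        (1 - ‖ζ‖ ^ 2) * (‖f 0‖ ^ 2 - ‖f N‖ ^ 2) := by
    intro N
    induction N with
    | zero => simp
    | succ N ih =>
      rw [Finset.sum_range_succ, Finset.sum_range_succ, ih]
      simp only [Complex.sq_norm, Complex.normSq_apply, sub_re, sub_im, mul_re, mul_im,
        conj_re, conj_im]
      ring
  have hq : 0 < 1 - ‖ζ‖ ^ 2 := by nlinarith [norm_nonneg ζ]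
  have ht := hB.hasSum.tendsto_sum_nat
  have hsum : Summable fun n => ‖ζ * f (n + 1) - f n‖ ^ 2 := by
    refine summable_of_sum_range_le (c := (∑' n, ‖f (n + 1) - conj ζ * f n‖ ^ 2) +
      (1 - ‖ζ‖ ^ 2) * ‖f 0‖ ^ 2) (fun n => by positivity) fun N => ?_
    have h1 := hB.sum_le_tsum (Finset.range N) fun _ _ => by positivity
    rw [htel]
    nlinarith [mul_nonneg hq.le (sq_nonneg ‖f N‖)]
  -- The telescoped identity, solved for |f N|², shows that |f N| converges.
  have hf : ∃ l, Tendsto (fun N => ‖f N‖) atTop (𝓝 l) := by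
    have h2 := (((ht.sub hsum.hasSum.tendsto_sum_nat).div_const (1 - ‖ζ‖ ^ 2)).add_const
      (‖f 0‖ ^ 2)).sqrt
    refine ⟨_, h2.congr fun N => ?_⟩
    rw [htel]
    conv_rhs => rw [← Real.sqrt_sq (norm_nonneg (f N))]
    congr 1
    field_simp
    ring
  obtain ⟨l, hl⟩ := hf
  -- The limit satisfies l ≤ |ζ| l with |ζ| < 1.
  have hl0 : l = 0 := by
    have h1 : 0 ≤ l := ge_of_tendsto' hl fun _ => norm_nonneg _
    have h2 : Tendsto (fun n => ‖f (n + 1) - conj ζ * f n‖) atTop (𝓝 0) := by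
      have := hB.tendsto_atTop_zero.sqrt
      simpa [Real.sqrt_sq] using this
    have h3 := le_of_tendsto_of_tendsto' (hl.comp (tendsto_add_atTop_nat 1))
      (h2.add (hl.const_mul ‖ζ‖)) fun n => by
        have := norm_add_le (f (n + 1) - conj ζ * f n) (conj ζ * f n)
        simpa using this
    nlinarith
  rw [hasSum_iff_tendsto_nat_of_nonneg fun n => by positivity]
  simp only [htel]
  have h5 := ht.add (((hl.pow 2).const_sub (‖f 0‖ ^ 2)).const_mul (1 - ‖ζ‖ ^ 2))
  simpa [hl0] using h5

/-! ### Taylor coefficients -/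

/-- The Taylor series of `g` on the unit disc has coefficients `a`. -/
def HasCoef (a : ℕ → ℂ) (g : ℂ → ℂ) : Prop := ∀ z ∈ ball (0 : ℂ) 1, HasSum (fun n => a n * z ^ n) (g z)

lemma ofReal_mem_ball {r : ℝ} (hr : r ∈ Ico (0 : ℝ) 1) : (r : ℂ) ∈ ball (0 : ℂ) 1 := by
  simp [abs_of_nonneg hr.1, hr.2]

lemma HasCoef.summable {a : ℕ → ℂ} {g : ℂ → ℂ} (h : HasCoef a g) {r : ℝ} (hr : r ∈ Ico (0 : ℝ) 1) :
    Summable fun n => ‖a n‖ * r ^ n := by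
  simpa [abs_of_nonneg hr.1] using (h r (ofReal_mem_ball hr)).summable.norm

lemma HasCoef.apply_zero {a : ℕ → ℂ} {g : ℂ → ℂ} (h : HasCoef a g) : g 0 = a 0 := by
  have h1 := h 0 (by simp)
  have h2 := hasSum_single (f := fun n => a n * (0 : ℂ) ^ n) 0 fun n hn => by simp [hn]
  simpa using h1.unique h2

/-- Both sequences are read off from the Fourier coefficients on the circle of radius 1/2. -/
lemma HasCoef.unique {a b : ℕ → ℂ} {g : ℂ → ℂ} (ha : HasCoef a g) (hb : HasCoef b g) : a = b := by
  have hr : (1 / 2 : ℝ) ∈ Ico (0 : ℝ) 1 := by norm_num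
  have hm : ∀ θ, circleMap 0 (1 / 2) θ ∈ ball (0 : ℂ) 1 := circleMap_mem (by norm_num)
  ext n
  have h1 := fourierCoeffOn_of_hasSum hr.1 (ha.summable hr) (fun θ => ha _ (hm θ)) n
  have h2 := fourierCoeffOn_of_hasSum hr.1 (hb.summable hr) (fun θ => hb _ (hm θ)) n
  simpa using h1.symm.trans h2

lemma HasCoef.congr {a : ℕ → ℂ} {g h : ℂ → ℂ} (ha : HasCoef a g) (hgh : EqOn g h (ball 0 1)) :
    HasCoef a h := fun z hz => hgh hz ▸ ha z hz

lemma hasCoef_iteratedDeriv {g : ℂ → ℂ} (hg : DifferentiableOn ℂ g (ball 0 1)) :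
    HasCoef (fun n => (n.factorial : ℂ)⁻¹ * iteratedDeriv n g 0) g := by
  intro z hz
  have h := hasSum_taylorSeries_on_ball hg hz
  refine h.congr_fun fun n => ?_
  simp only [sub_zero, smul_eq_mul]
  ring

lemma HasCoef.deriv {a : ℕ → ℂ} {g : ℂ → ℂ} (hg : DifferentiableOn ℂ g (ball 0 1))
    (ha : HasCoef a g) : HasCoef (fun n => ((n : ℂ) + 1) * a (n + 1)) (deriv g) := by
  rw [ha.unique (hasCoef_iteratedDeriv hg)]
  convert hasCoef_iteratedDeriv (hg.deriv isOpen_ball) using 2 with n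
  simp only [iteratedDeriv_succ', Nat.factorial_succ]
  have : (n : ℂ) + 1 ≠ 0 := by exact_mod_cast n.succ_ne_zero
  push_cast
  field_simp

lemma HasCoef.sub {a b : ℕ → ℂ} {g h : ℂ → ℂ} (ha : HasCoef a g) (hb : HasCoef b h) :
    HasCoef (fun n => a n - b n) fun z => g z - h z := fun z hz => by
  simpa only [sub_mul] using (ha z hz).sub (hb z hz)

lemma HasCoef.const_mul {a : ℕ → ℂ} {g : ℂ → ℂ} (c : ℂ) (ha : HasCoef a g) :
    HasCoef (fun n => c * a n) fun z => c * g z := fun z hz => by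
  simpa only [mul_assoc] using (ha z hz).mul_left c

lemma HasCoef.shift {a : ℕ → ℂ} {g : ℂ → ℂ} (ha : HasCoef a g) :
    HasCoef (shift a) fun z => z * g z := by
  intro z hz
  rw [← hasSum_nat_add_iff' 1]
  simp only [shift_succ, Finset.sum_range_one, shift_zero, zero_mul, sub_zero]
  refine ((ha z hz).mul_left z).congr_fun fun n => ?_
  ring

/-- Orthogonality of powers for a radial weight. -/
lemma lintegral_radial {c : ℕ → ℂ} {h : ℂ → ℂ} (hm : Measurable h) (hc : HasCoef c h)
    {ρ : ℝ → ℝ≥0∞} (hρ : Measurable ρ) :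
    ∫⁻ z, ‖h z‖ₑ ^ 2 * ρ ‖z‖ ∂area =
      ∑' n, ‖c n‖ₑ ^ 2 * ∫⁻ r in Ioo (0 : ℝ) 1, ENNReal.ofReal (2 * r ^ (2 * n + 1)) * ρ r := by
  rw [lintegral_area_polar (F := fun z => ‖h z‖ₑ ^ 2 * ρ ‖z‖)
    ((hm.enorm.pow_const 2).mul (hρ.comp measurable_norm))]
  have h1 : ∀ r ∈ Ioo (0 : ℝ) 1, ENNReal.ofReal (2 * r) *
      ∫⁻ θ, ‖h (circleMap 0 r θ)‖ₑ ^ 2 * ρ ‖circleMap 0 r θ‖ ∂angle =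
      ∑' n, ‖c n‖ₑ ^ 2 * (ENNReal.ofReal (2 * r ^ (2 * n + 1)) * ρ r) := by
    intro r hr
    simp only [norm_circleMap_zero, abs_of_pos hr.1]
    have hmr : Measurable fun θ => h (circleMap 0 r θ) := hm.comp (continuous_circleMap 0 r).measurable
    rw [lintegral_mul_const _ (hmr.enorm.pow_const 2),
      circle_parseval hr.1.le (hc.summable ⟨hr.1.le, hr.2⟩) fun θ => hc _ (circleMap_mem hr θ),
      ← ENNReal.tsum_mul_right, ← ENNReal.tsum_mul_left]
    refine tsum_congr fun n => ?_
    rw [show 2 * r ^ (2 * n + 1) = 2 * r * r ^ (2 * n) by ring,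
      ENNReal.ofReal_mul (p := 2 * r) (by linarith [hr.1])]
    ring
  rw [setLIntegral_congr_fun measurableSet_Ioo h1, lintegral_tsum]
  · refine tsum_congr fun n => ?_
    rw [lintegral_const_mul]
    exact (Measurable.ennreal_ofReal (by fun_prop)).mul hρ
  · intro n
    exact (((Measurable.ennreal_ofReal (by fun_prop)).mul hρ).const_mul _).aemeasurable

/-- Through `lintegral_radial`, `telWeight n` is the squared norm of z^n for the weight 1 - |z|². -/
lemma lintegral_pow_mul_one_sub_sq (n : ℕ) :
    ∫⁻ r in Ioo (0 : ℝ) 1, ENNReal.ofReal (2 * r ^ (2 * n + 1)) * ENNReal.ofReal (1 - r ^ 2) =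
      ENNReal.ofReal (telWeight n) := by
  have h1 : ∀ r ∈ Ioo (0 : ℝ) 1, ENNReal.ofReal (2 * r ^ (2 * n + 1)) * ENNReal.ofReal (1 - r ^ 2) =
      ENNReal.ofReal (2 * r ^ (2 * n + 1) - 2 * r ^ (2 * n + 3)) := by
    intro r hr
    have := hr.1
    rw [← ENNReal.ofReal_mul (by positivity)]
    congr 1
    ring
  have hc : Continuous fun r : ℝ => 2 * r ^ (2 * n + 1) - 2 * r ^ (2 * n + 3) := by fun_prop
  rw [setLIntegral_congr_fun measurableSet_Ioo h1, ← ofReal_integral_eq_lintegral_ofReal,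
    ← integral_Ioc_eq_integral_Ioo, ← intervalIntegral.integral_of_le zero_le_one,
    intervalIntegral.integral_sub (Continuous.intervalIntegrable (by fun_prop) _ _)
      (Continuous.intervalIntegrable (by fun_prop) _ _),
    intervalIntegral.integral_const_mul, intervalIntegral.integral_const_mul, integral_pow,
    integral_pow, telWeight]
  · congr 1
    simp
    field_simp
    ring
  · exact (hc.integrableOn_Icc (a := 0) (b := 1)).mono_set Ioo_subset_Icc_self
  · refine (ae_restrict_mem measurableSet_Ioo).mono fun r hr => ?_
    have h0 := hr.1
    have h2 : 0 ≤ 1 - r ^ 2 := by nlinarith [hr.1, hr.2]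
    have h3 : 2 * r ^ (2 * n + 1) - 2 * r ^ (2 * n + 3) = 2 * r ^ (2 * n + 1) * (1 - r ^ 2) := by ring
    simp only [Pi.zero_apply, h3]
    positivity

/-- Through `lintegral_radial`, this is the squared norm of z^n for the weight -log |z|². It cancels
the factor n + 1 that differentiation produces, leaving the plain ℓ² norm of the coefficients. -/
lemma lintegral_pow_mul_log (n : ℕ) :
    ∫⁻ r in Ioo (0 : ℝ) 1, ENNReal.ofReal (2 * r ^ (2 * n + 1)) * ENNReal.ofReal (-Real.log (r ^ 2)) =
      ENNReal.ofReal (1 / ((n : ℝ) + 1) ^ 2) := by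
  -- An antiderivative found by parts, written through r log r to be visibly continuous at 0.
  set F : ℝ → ℝ := fun r => r ^ (2 * n + 2) / ((n : ℝ) + 1) ^ 2 -
    2 * (r ^ (2 * n + 1) * (r * Real.log r)) / ((n : ℝ) + 1) with hF
  have hFc : Continuous F := by
    have := Real.continuous_mul_log
    fun_prop
  have hd : ∀ r ∈ Ioo (0 : ℝ) 1, HasDerivAt F (2 * r ^ (2 * n + 1) * (-Real.log (r ^ 2))) r := by
    intro r hr
    have h1 := ((hasDerivAt_pow (2 * n + 2) r).div_const (((n : ℝ) + 1) ^ 2)).sub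
      ((((hasDerivAt_pow (2 * n + 1) r).mul
        ((hasDerivAt_id r).mul (Real.hasDerivAt_log hr.1.ne'))).const_mul 2).div_const ((n : ℝ) + 1))
    refine HasDerivAt.congr_deriv (f := F) h1 ?_
    rw [Real.log_pow]
    have hr0 := hr.1.ne'
    push_cast
    simp only [id, Pi.mul_apply]
    field_simp
    ring
  have hpos : ∀ r ∈ Ioo (0 : ℝ) 1, 0 ≤ 2 * r ^ (2 * n + 1) * (-Real.log (r ^ 2)) := by
    intro r hr
    have := hr.1
    have h2 : Real.log (r ^ 2) ≤ 0 := Real.log_nonpos (by positivity) (by nlinarith [hr.1, hr.2])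
    have : 0 ≤ -Real.log (r ^ 2) := by linarith
    positivity
  have h1 : ∀ r ∈ Ioo (0 : ℝ) 1, ENNReal.ofReal (2 * r ^ (2 * n + 1)) *
      ENNReal.ofReal (-Real.log (r ^ 2)) =
      ENNReal.ofReal (2 * r ^ (2 * n + 1) * (-Real.log (r ^ 2))) := by
    intro r hr
    have := hr.1
    rw [← ENNReal.ofReal_mul (by positivity)]
  -- A nonnegative derivative of a continuous function is integrable, so the logarithm needs no
  -- estimate.
  have hint := intervalIntegral.integrableOn_deriv_of_nonneg hFc.continuousOn hd hpos
  rw [setLIntegral_congr_fun measurableSet_Ioo h1, ← ofReal_integral_eq_lintegral_ofReal,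
    ← integral_Ioc_eq_integral_Ioo, ← intervalIntegral.integral_of_le zero_le_one,
    intervalIntegral.integral_eq_sub_of_hasDerivAt_of_le zero_le_one hFc.continuousOn hd
      ((intervalIntegrable_iff_integrableOn_Ioc_of_le zero_le_one).2 hint)]
  · congr 1
    simp [hF]
  · exact hint.mono_set Ioo_subset_Ioc_self
  · exact (ae_restrict_mem measurableSet_Ioo).mono hpos

lemma tsum_ofReal_lt_top {f : ℕ → ℝ} (hf : ∀ n, 0 ≤ f n) (h : ∑' n, ENNReal.ofReal (f n) < ⊤) :
    Summable f ∧ ∑' n, ENNReal.ofReal (f n) = ENNReal.ofReal (∑' n, f n) := by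
  have hs : Summable f := by
    simpa [ENNReal.toReal_ofReal (hf _)] using ENNReal.summable_toReal h.ne
  exact ⟨hs, (ENNReal.ofReal_tsum_of_nonneg hf hs).symm⟩

/-! ### The local Dirichlet integral -/

/-- The kernel whose integral against `μ` is the weight `U_μ`. -/
def kernel (ζ w : ℂ) : ℝ≥0∞ :=
  open Classical in if ‖ζ‖ < 1 then greenKernel ζ w else poisson ζ w

/-- The Dirichlet integral of `g` for the point mass at `ζ`. -/
def localDirichlet (ζ : ℂ) (g : ℂ → ℂ) : ℝ≥0∞ := ∫⁻ z, ‖deriv g z‖ₑ ^ 2 * kernel ζ z ∂area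

lemma one_sub_conj_mul_ne_zero {ζ z : ℂ} (hζ : ‖ζ‖ ≤ 1) (hz : z ∈ ball (0 : ℂ) 1) :
    1 - conj ζ * z ≠ 0 := by
  intro h
  have h1 : ‖conj ζ * z‖ = 1 := by rw [← sub_eq_zero.1 h, norm_one]
  rw [norm_mul, RCLike.norm_conj] at h1
  have h2 : ‖z‖ < 1 := by simpa using hz
  nlinarith [norm_nonneg z, norm_nonneg ζ]

/-- For |ζ| = 1 one has |ζ - z| = |1 - ζ̄z|, so the Poisson weight produces the integral of |g'/(1 -
ζ̄z)|² against 1 - |z|². Division by 1 - ζ̄z replaces the coefficients of g' by partial sums, up to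
the unimodular factor ζ^(n+1). -/
lemma localDirichlet_eq_of_norm_eq_one {ζ : ℂ} (hζ : ‖ζ‖ = 1) {g : ℂ → ℂ} {a : ℕ → ℂ}
    (hg : DifferentiableOn ℂ g (ball 0 1)) (ha : HasCoef a g) :
    localDirichlet ζ g =
      ∑' n, ENNReal.ofReal (‖derivSum (fun k => a k * ζ ^ k) n‖ ^ 2 * telWeight n) := by
  set h : ℂ → ℂ := fun z => deriv g z / (1 - conj ζ * z) with hh
  have hm : Measurable h := (measurable_deriv g).div (Continuous.measurable (by fun_prop))
  have hd : DifferentiableOn ℂ h (ball 0 1) := (hg.deriv isOpen_ball).div (by fun_prop)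
    fun z hz => one_sub_conj_mul_ne_zero hζ.le hz
  set d := fun n => (n.factorial : ℂ)⁻¹ * iteratedDeriv n h 0
  have hc : HasCoef d h := hasCoef_iteratedDeriv hd
  have hrel : (fun n => d n - conj ζ * shift d n) = fun n : ℕ => ((n : ℂ) + 1) * a (n + 1) := by
    refine ((hc.sub (hc.shift.const_mul (conj ζ))).congr fun z hz => ?_).unique (ha.deriv hg)
    have := one_sub_conj_mul_ne_zero hζ.le hz
    simp only [hh]
    field_simp
  have hconj : ζ * conj ζ = 1 := by rw [Complex.mul_conj, Complex.normSq_eq_norm_sq, hζ]; simp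
  have hdn : ∀ n, ζ ^ (n + 1) * d n = derivSum (fun k => a k * ζ ^ k) n := by
    intro n
    induction n with
    | zero =>
      have h0 := congrFun hrel 0
      simp only [shift_zero, mul_zero, sub_zero] at h0
      rw [h0]
      simp [derivSum]
      ring
    | succ n ih =>
      have h0 := congrFun hrel (n + 1)
      simp only [shift_succ] at h0
      rw [derivSum_succ, ← ih]
      push_cast at h0
      linear_combination ζ ^ (n + 2) * h0 + d n * ζ ^ (n + 1) * hconj
  have hk : ∀ᵐ z ∂area, ‖deriv g z‖ₑ ^ 2 * kernel ζ z =
      ‖h z‖ₑ ^ 2 * ENNReal.ofReal (1 - ‖z‖ ^ 2) := by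
    filter_upwards [ae_area] with z hz
    have hne := one_sub_conj_mul_ne_zero hζ.le hz
    have h1 : ‖ζ - z‖ = ‖1 - conj ζ * z‖ := by
      rw [show ζ - z = ζ * (1 - conj ζ * z) by linear_combination z * hconj, norm_mul, hζ, one_mul]
    rw [kernel, if_neg (by rw [hζ]; exact lt_irrefl 1), poisson, h1, div_eq_inv_mul,
      ENNReal.ofReal_mul (by positivity), ← mul_assoc]
    congr 1
    simp only [← ofReal_norm, hh, norm_div]
    rw [← ENNReal.ofReal_pow (by positivity), ← ENNReal.ofReal_pow (by positivity),
      ← ENNReal.ofReal_mul (by positivity), div_pow, div_eq_mul_inv]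
  rw [localDirichlet, lintegral_congr_ae hk, lintegral_radial hm hc
    (ρ := fun r => ENNReal.ofReal (1 - r ^ 2)) (Measurable.ennreal_ofReal (by fun_prop))]
  refine tsum_congr fun n => ?_
  rw [lintegral_pow_mul_one_sub_sq, ENNReal.ofReal_mul (by positivity), ← hdn, norm_mul, norm_pow, hζ,
    one_pow, one_mul, ENNReal.ofReal_pow (norm_nonneg _), ofReal_norm]

/-- The value at a boundary point of a function of finite local Dirichlet integral. -/
lemma exists_value_of_norm_eq_one {ζ : ℂ} (hζ : ‖ζ‖ = 1) {g : ℂ → ℂ}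
    (hg : DifferentiableOn ℂ g (ball 0 1)) (hD : localDirichlet ζ g < ⊤) :
    ∃ v : ℂ, ‖v‖ₑ ^ 2 ≤ 2 * ‖g 0‖ₑ ^ 2 + 2 * localDirichlet ζ g ∧
      ∀ n : ℕ, localDirichlet ζ (fun z => z ^ n * g z) = localDirichlet ζ g + n * ‖v‖ₑ ^ 2 := by
  have key : ∀ {g : ℂ → ℂ} {a : ℕ → ℂ}, DifferentiableOn ℂ g (ball 0 1) → HasCoef a g →
      localDirichlet ζ g < ⊤ →
      (Summable fun n => ‖derivSum (fun k => a k * ζ ^ k) n‖ ^ 2 * telWeight n) ∧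
      localDirichlet ζ g =
        ENNReal.ofReal (∑' n, ‖derivSum (fun k => a k * ζ ^ k) n‖ ^ 2 * telWeight n) := by
    intro g a hg ha hD
    rw [localDirichlet_eq_of_norm_eq_one hζ hg ha] at hD ⊢
    exact tsum_ofReal_lt_top (fun n => mul_nonneg (by positivity) (telWeight_pos n).le) hD
  have ha := hasCoef_iteratedDeriv hg
  set a := fun n : ℕ => (n.factorial : ℂ)⁻¹ * iteratedDeriv n g 0
  obtain ⟨hs, hDe⟩ := key hg ha hD
  obtain ⟨v, hv, hle⟩ := exists_tendsto_of_summable_derivSum hs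
  have step : ∀ {g : ℂ → ℂ} {a : ℕ → ℂ} {v : ℂ}, DifferentiableOn ℂ g (ball 0 1) → HasCoef a g →
      localDirichlet ζ g < ⊤ →
      Tendsto (fun N => ∑ k ∈ Finset.range N, a k * ζ ^ k) atTop (𝓝 v) →
      localDirichlet ζ (fun z => z * g z) = localDirichlet ζ g + ‖v‖ₑ ^ 2 := by
    intro g a v hg ha hD hv
    obtain ⟨hs, hDe⟩ := key hg ha hD
    have h1 := hasSum_derivSum_shift hs hv
    have h2 : ∀ n, ‖derivSum (fun k => shift a k * ζ ^ k) n‖ =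
        ‖derivSum (shift fun k => a k * ζ ^ k) n‖ := by
      intro n
      have : derivSum (fun k => shift a k * ζ ^ k) n =
          ζ * derivSum (shift fun k => a k * ζ ^ k) n := by
        simp only [derivSum, Finset.mul_sum, shift_succ]
        exact Finset.sum_congr rfl fun k _ => by ring
      rw [this, norm_mul, hζ, one_mul]
    have hzg : DifferentiableOn ℂ (fun z => z * g z) (ball 0 1) := differentiableOn_id.mul hg
    rw [localDirichlet_eq_of_norm_eq_one hζ hzg ha.shift, hDe]
    simp only [h2]
    rw [← ENNReal.ofReal_tsum_of_nonneg
      (fun n => mul_nonneg (by positivity) (telWeight_pos n).le) h1.summable, h1.tsum_eq,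
      ENNReal.ofReal_add (tsum_nonneg fun n => mul_nonneg (by positivity) (telWeight_pos n).le)
        (by positivity), ENNReal.ofReal_pow (norm_nonneg _), ofReal_norm]
  refine ⟨v, ?_, fun n => ?_⟩
  · have h1 := ENNReal.ofReal_le_ofReal hle
    rw [ENNReal.ofReal_add (by positivity) (mul_nonneg zero_le_two
        (tsum_nonneg fun n => mul_nonneg (by positivity) (telWeight_pos n).le)),
      ENNReal.ofReal_mul zero_le_two, ENNReal.ofReal_mul zero_le_two, ← hDe,
      ENNReal.ofReal_pow (norm_nonneg _), ENNReal.ofReal_pow (norm_nonneg _), ofReal_norm,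
      ofReal_norm] at h1
    simpa [ha.apply_zero] using h1
  -- The induction also carries the coefficients of z^n g and the sum w of their series at ζ: each
  -- step multiplies w by ζ, so |w| stays |v|.
  · have : ∃ b w, HasCoef b (fun z => z ^ n * g z) ∧ ‖w‖ₑ = ‖v‖ₑ ∧
        Tendsto (fun N => ∑ k ∈ Finset.range N, b k * ζ ^ k) atTop (𝓝 w) ∧
        localDirichlet ζ (fun z => z ^ n * g z) = localDirichlet ζ g + n * ‖v‖ₑ ^ 2 := by
      induction n with
      | zero => exact ⟨a, v, by simpa using ha, rfl, hv, by simp⟩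
      | succ n ih =>
        obtain ⟨b, w, hb, hw, hbw, hn⟩ := ih
        have hgn : DifferentiableOn ℂ (fun z => z ^ n * g z) (ball 0 1) :=
          (differentiableOn_id.pow n).mul hg
        have hfun : (fun z => z ^ (n + 1) * g z) = fun z => z * (z ^ n * g z) := by
          ext z
          ring
        refine ⟨shift b, ζ * w, hfun ▸ hb.shift, ?_, ?_, ?_⟩
        · rw [enorm_mul, hw, ← ofReal_norm, hζ, ENNReal.ofReal_one, one_mul]
        · rw [← tendsto_add_atTop_iff_nat 1]
          refine (hbw.const_mul ζ).congr fun N => ?_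
          rw [Finset.sum_range_succ', shift_zero, zero_mul, add_zero, Finset.mul_sum]
          exact Finset.sum_congr rfl fun k _ => by rw [shift_succ]; ring
        · have hlt : localDirichlet ζ (fun z => z ^ n * g z) < ⊤ := by
            rw [hn]
            exact ENNReal.add_lt_top.2 ⟨hD, ENNReal.mul_lt_top (by simp) (by simp)⟩
          rw [hfun, step hgn hb hlt hbw, hn, hw]
          push_cast
          ring
    obtain ⟨_, _, _, _, _, h⟩ := this
    exact h

/-! ### The disc automorphism exchanging `0` and `ζ` -/

/-- The involutive automorphism of the disc which exchanges `0` and `ζ`. -/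
def mobius (ζ z : ℂ) : ℂ := (ζ - z) / (1 - conj ζ * z)

section Mobius

variable {ζ : ℂ}

lemma one_sub_normSq_ne_zero (hζ : ‖ζ‖ < 1) : 1 - conj ζ * ζ ≠ 0 :=
  one_sub_conj_mul_ne_zero hζ.le (by simpa using hζ)

lemma mobius_mem (hζ : ‖ζ‖ < 1) {z : ℂ} (hz : z ∈ ball (0 : ℂ) 1) : mobius ζ z ∈ ball (0 : ℂ) 1 := by
  have hne := one_sub_conj_mul_ne_zero hζ.le hz
  have hz1 : ‖z‖ < 1 := by simpa using hz
  rw [mem_ball_zero_iff, mobius, norm_div, div_lt_one (norm_pos_iff.2 hne)]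
  refine lt_of_pow_lt_pow_left₀ 2 (norm_nonneg _) ?_
  have h1 : 0 < (1 - ‖ζ‖ ^ 2) * (1 - ‖z‖ ^ 2) :=
    mul_pos (by nlinarith [norm_nonneg ζ]) (by nlinarith [norm_nonneg z])
  have h2 : ‖1 - conj ζ * z‖ ^ 2 - ‖ζ - z‖ ^ 2 = (1 - ‖ζ‖ ^ 2) * (1 - ‖z‖ ^ 2) := by
    simp only [Complex.sq_norm, Complex.normSq_apply, sub_re, sub_im, mul_re, mul_im,
      conj_re, conj_im, one_re, one_im]
    ring
  linarith

lemma one_sub_conj_mul_mobius {z : ℂ} (h : 1 - conj ζ * z ≠ 0) :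
    1 - conj ζ * mobius ζ z = (1 - conj ζ * ζ) / (1 - conj ζ * z) := by
  rw [mobius]
  field_simp
  ring

lemma mobius_sub_self {z : ℂ} (h : 1 - conj ζ * z ≠ 0) :
    mobius ζ z - ζ = -(z * (1 - conj ζ * ζ)) / (1 - conj ζ * z) := by
  rw [mobius, div_sub' h]
  congr 1
  ring

lemma mobius_mobius (hζ : ‖ζ‖ < 1) {z : ℂ} (hz : z ∈ ball (0 : ℂ) 1) : mobius ζ (mobius ζ z) = z := by
  have h := one_sub_conj_mul_ne_zero hζ.le hz
  have h2 := one_sub_normSq_ne_zero hζ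
  rw [mobius, ← neg_sub (mobius ζ z), mobius_sub_self h, one_sub_conj_mul_mobius h]
  simp only [neg_div, neg_neg]
  rw [div_div_div_cancel_right₀ h, mul_div_cancel_right₀ _ h2]

lemma differentiableOn_mobius (hζ : ‖ζ‖ < 1) : DifferentiableOn ℂ (mobius ζ) (ball 0 1) :=
  DifferentiableOn.div (by fun_prop) (by fun_prop) fun _ hz => one_sub_conj_mul_ne_zero hζ.le hz

lemma mobius_image (hζ : ‖ζ‖ < 1) : mobius ζ '' ball 0 1 = ball 0 1 :=
  Subset.antisymm (image_subset_iff.2 fun _ hz => mobius_mem hζ hz)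
    fun z hz => ⟨mobius ζ z, mobius_mem hζ hz, mobius_mobius hζ hz⟩

/-- The automorphism is a holomorphic bijection of the disc, and the real Jacobian of a holomorphic
map is the squared modulus of its derivative. -/
lemma lintegral_comp_mobius (hζ : ‖ζ‖ < 1) (F : ℂ → ℝ≥0∞) :
    ∫⁻ w, F w ∂area = ∫⁻ z, ‖deriv (mobius ζ) z‖ₑ ^ 2 * F (mobius ζ z) ∂area := by
  have hd : ∀ z ∈ ball (0 : ℂ) 1, HasFDerivWithinAt (mobius ζ)
      ((ContinuousLinearMap.toSpanSingleton ℂ (deriv (mobius ζ) z)).restrictScalars ℝ)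
      (ball 0 1) z := fun z hz =>
    ((((differentiableOn_mobius hζ).differentiableAt
      (isOpen_ball.mem_nhds hz)).hasDerivAt.hasFDerivAt).restrictScalars ℝ).hasFDerivWithinAt
  have hinj : InjOn (mobius ζ) (ball 0 1) := fun z hz w hw h => by
    rw [← mobius_mobius hζ hz, h, mobius_mobius hζ hw]
  have h := lintegral_image_eq_lintegral_abs_det_fderiv_mul volume measurableSet_ball hd hinj F
  rw [mobius_image hζ] at h
  rw [area, lintegral_smul_measure, lintegral_smul_measure, h]
  congr 1
  refine lintegral_congr fun z => ?_
  congr 1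
  rw [ContinuousLinearMap.det, ContinuousLinearMap.coe_restrictScalars,
    LinearMap.det_restrictScalars]
  simp [Algebra.norm_complex_eq, Complex.normSq_eq_norm_sq, ENNReal.ofReal_pow]

lemma area_singleton (z : ℂ) : area {z} = 0 := by
  simp [area]

/-- Composed with the automorphism, the Green kernel becomes -log |z|² / (1 - |ζ|²), and the
Jacobian turns g' into the derivative of the composition; the weight is now radial and powers are
orthogonal. -/
lemma localDirichlet_eq_of_norm_lt_one (hζ : ‖ζ‖ < 1) {g : ℂ → ℂ} {b : ℕ → ℂ}
    (hg : DifferentiableOn ℂ g (ball 0 1)) (hb : HasCoef b (g ∘ mobius ζ)) :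
    localDirichlet ζ g = ∑' n, ENNReal.ofReal ((1 - ‖ζ‖ ^ 2)⁻¹ * ‖b (n + 1)‖ ^ 2) := by
  have hq : 0 < 1 - ‖ζ‖ ^ 2 := by nlinarith [norm_nonneg ζ]
  have hG : DifferentiableOn ℂ (g ∘ mobius ζ) (ball 0 1) :=
    hg.comp (differentiableOn_mobius hζ) fun z hz => mobius_mem hζ hz
  have hk : ∀ᵐ z ∂area, ‖deriv (mobius ζ) z‖ₑ ^ 2 *
      (‖deriv g (mobius ζ z)‖ₑ ^ 2 * kernel ζ (mobius ζ z)) =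
      ENNReal.ofReal (1 - ‖ζ‖ ^ 2)⁻¹ *
        (‖deriv (g ∘ mobius ζ) z‖ₑ ^ 2 * ENNReal.ofReal (-Real.log (‖z‖ ^ 2))) := by
    -- The automorphism sends 0 to ζ, where the kernel is infinite; this single point is negligible.
    filter_upwards [ae_area, (area_singleton 0) |> compl_mem_ae_iff.2]
      with z hz hz0
    have hz0 : z ≠ 0 := hz0
    have h := one_sub_conj_mul_ne_zero hζ.le hz
    have h2 := one_sub_normSq_ne_zero hζ
    have hne : mobius ζ z ≠ ζ := by
      rw [← sub_ne_zero, mobius_sub_self h]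
      exact div_ne_zero (neg_ne_zero.2 (mul_ne_zero hz0 h2)) h
    have hdiv : (1 - conj ζ * mobius ζ z) / (mobius ζ z - ζ) = -z⁻¹ := by
      rw [one_sub_conj_mul_mobius h, mobius_sub_self h]
      field_simp
    rw [kernel, if_pos hζ, greenKernel, if_neg hne, hdiv, norm_neg, norm_inv, inv_pow, Real.log_inv,
      div_eq_inv_mul, ENNReal.ofReal_mul (inv_nonneg.2 hq.le), deriv_comp z
        (hg.differentiableAt (isOpen_ball.mem_nhds (mobius_mem hζ hz)))
        ((differentiableOn_mobius hζ).differentiableAt (isOpen_ball.mem_nhds hz)), enorm_mul]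
    ring
  rw [localDirichlet, lintegral_comp_mobius hζ, lintegral_congr_ae hk,
    lintegral_const_mul' _ _ ENNReal.ofReal_ne_top,
    lintegral_radial (measurable_deriv _) (hb.deriv hG)
      (ρ := fun r => ENNReal.ofReal (-Real.log (r ^ 2))) (Measurable.ennreal_ofReal (by fun_prop)),
    ← ENNReal.tsum_mul_left]
  refine tsum_congr fun n => ?_
  rw [lintegral_pow_mul_log, ENNReal.ofReal_mul (inv_nonneg.2 hq.le), ← ofReal_norm,
    ← ENNReal.ofReal_pow (norm_nonneg _), ← ENNReal.ofReal_mul (by positivity), norm_mul,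
    show ‖(n : ℂ) + 1‖ = n + 1 by rw [← Nat.cast_add_one, Complex.norm_natCast]; simp]
  congr 2
  field_simp

/-- The increase of the local Dirichlet integral at an interior point. -/
lemma localDirichlet_mul_of_norm_lt_one (hζ : ‖ζ‖ < 1) {g : ℂ → ℂ}
    (hg : DifferentiableOn ℂ g (ball 0 1)) (hD : localDirichlet ζ g < ⊤) :
    localDirichlet ζ (fun z => z * g z) = localDirichlet ζ g + ‖g ζ‖ₑ ^ 2 ∧
      ‖g ζ‖ₑ ^ 2 ≤ 2 * ‖g 0‖ₑ ^ 2 + 2 * localDirichlet ζ g := by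
  have hq : 0 < 1 - ‖ζ‖ ^ 2 := by nlinarith [norm_nonneg ζ]
  have hG : DifferentiableOn ℂ (g ∘ mobius ζ) (ball 0 1) :=
    hg.comp (differentiableOn_mobius hζ) fun z hz => mobius_mem hζ hz
  -- With φ the automorphism, F is chosen so that g∘φ = (1 - ζ̄z)F and (zg)∘φ = (ζ - z)F. The
  -- coefficients of these two products are the sequences compared in `hasSum_blaschke`.
  set F : ℂ → ℂ := fun z => g (mobius ζ z) / (1 - conj ζ * z) with hF
  have hFd : DifferentiableOn ℂ F (ball 0 1) :=
    DifferentiableOn.div hG (by fun_prop) fun z hz => one_sub_conj_mul_ne_zero hζ.le hz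
  have hf := hasCoef_iteratedDeriv hFd
  set f := fun n : ℕ => (n.factorial : ℂ)⁻¹ * iteratedDeriv n F 0
  have hb : HasCoef (fun n => f n - conj ζ * shift f n) (g ∘ mobius ζ) := by
    refine (hf.sub (hf.shift.const_mul (conj ζ))).congr fun z hz => ?_
    have h := one_sub_conj_mul_ne_zero hζ.le hz
    simp only [hF, Function.comp]
    field_simp
  have hb' : HasCoef (fun n => ζ * f n - shift f n) ((fun z => z * g z) ∘ mobius ζ) := by
    refine ((hf.const_mul ζ).sub hf.shift).congr fun z hz => ?_
    simp only [hF, Function.comp]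
    rw [show mobius ζ z = (ζ - z) / (1 - conj ζ * z) from rfl]
    ring
  have hf0 : f 0 = g ζ := by
    have := hf.apply_zero
    rw [← this]
    simp [hF, mobius]
  have hDe := localDirichlet_eq_of_norm_lt_one hζ hg hb
  simp only [shift_succ] at hDe
  obtain ⟨hs, he⟩ := tsum_ofReal_lt_top
    (fun n => mul_nonneg (inv_nonneg.2 hq.le) (sq_nonneg _)) (hDe ▸ hD)
  rw [he] at hDe
  have hs' : Summable fun n => ‖f (n + 1) - conj ζ * f n‖ ^ 2 :=
    (summable_mul_left_iff (inv_ne_zero hq.ne')).1 hs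
  have h1 := hasSum_blaschke hζ hs'
  have hzg : DifferentiableOn ℂ (fun z => z * g z) (ball 0 1) := differentiableOn_id.mul hg
  rw [tsum_mul_left] at hDe
  set S := ∑' n, ‖f (n + 1) - conj ζ * f n‖ ^ 2 with hS
  have hS0 : 0 ≤ S := tsum_nonneg fun n => sq_nonneg _
  constructor
  · rw [localDirichlet_eq_of_norm_lt_one hζ hzg hb', hDe]
    simp only [shift_succ]
    rw [← ENNReal.ofReal_tsum_of_nonneg (fun n => mul_nonneg (inv_nonneg.2 hq.le) (sq_nonneg _))
        (h1.summable.mul_left _), tsum_mul_left, h1.tsum_eq, mul_add, ← mul_assoc,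
      inv_mul_cancel₀ hq.ne', one_mul, hf0, ENNReal.ofReal_add (by positivity) (by positivity),
      ENNReal.ofReal_pow (norm_nonneg (g ζ)), ofReal_norm]
  -- The expansion of g∘φ has constant term g(ζ) and takes the value g(0) at ζ. Its remaining terms
  -- thus sum to g(0) - g(ζ), which Cauchy–Schwarz against the powers of ζ estimates.
  · have hsum := ((hasSum_nat_add_iff' 1).2 (hb ζ (by simpa using hζ)))
    simp only [Function.comp, shift_succ, Finset.sum_range_one, shift_zero, mul_zero, sub_zero,
      pow_zero, mul_one, hf0, mobius, sub_self, zero_div] at hsum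
    have hle : ‖g 0 - g ζ‖ ^ 2 ≤ (1 - ‖ζ‖ ^ 2)⁻¹ * S := by
      refine le_of_tendsto (hsum.tendsto_sum_nat.norm.pow 2) (Eventually.of_forall fun N => ?_)
      have h2 := Finset.sum_sq_le_sum_mul_sum_of_sq_le_mul (Finset.range N)
        (r := fun n => ‖f (n + 1) - conj ζ * f n‖ * ‖ζ‖ ^ (n + 1))
        (f := fun n => ‖f (n + 1) - conj ζ * f n‖ ^ 2) (g := fun n => (‖ζ‖ ^ 2) ^ (n + 1))
        (fun _ _ => by positivity) (fun _ _ => by positivity) fun _ _ => (by ring : _ = _).le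
      have h3 : ∑ n ∈ Finset.range N, (‖ζ‖ ^ 2) ^ (n + 1) ≤ (1 - ‖ζ‖ ^ 2)⁻¹ := by
        have hg := summable_geometric_of_lt_one (sq_nonneg ‖ζ‖) (by linarith)
        rw [← tsum_geometric_of_lt_one (sq_nonneg ‖ζ‖) (by linarith)]
        refine le_trans ?_ (hg.sum_le_tsum (Finset.range (N + 1)) fun _ _ => by positivity)
        rw [Finset.sum_range_succ']
        simp
      have h4 := hs'.sum_le_tsum (Finset.range N) fun _ _ => sq_nonneg _
      calc _ ≤ (∑ n ∈ Finset.range N, ‖f (n + 1) - conj ζ * f n‖ * ‖ζ‖ ^ (n + 1)) ^ 2 := by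
            gcongr
            refine (norm_sum_le _ _).trans_eq (Finset.sum_congr rfl fun n _ => ?_)
            rw [norm_mul, norm_pow]
        _ ≤ S * (1 - ‖ζ‖ ^ 2)⁻¹ := h2.trans (mul_le_mul h4 h3
            (Finset.sum_nonneg fun _ _ => by positivity) hS0)
        _ = _ := mul_comm _ _
    have h5 : ‖g ζ‖ ^ 2 ≤ 2 * ‖g 0‖ ^ 2 + 2 * ((1 - ‖ζ‖ ^ 2)⁻¹ * S) := by
      have h6 := norm_sub_norm_le (g ζ) (g 0)
      rw [norm_sub_rev] at h6
      nlinarith [sq_nonneg (‖g 0‖ - ‖g 0 - g ζ‖), norm_nonneg (g ζ), norm_nonneg (g 0)]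
    have h7 := ENNReal.ofReal_le_ofReal h5
    rwa [ENNReal.ofReal_add (by positivity) (by positivity), ENNReal.ofReal_mul zero_le_two,
      ENNReal.ofReal_mul zero_le_two, ← hDe, ENNReal.ofReal_pow (norm_nonneg _),
      ENNReal.ofReal_pow (norm_nonneg _), ofReal_norm, ofReal_norm, ENNReal.ofReal_ofNat] at h7

end Mobius

/-- The local Dirichlet integrals of `z^n g` grow like the moments of a point mass. -/
lemma exists_localDirichlet_pow_mul {ζ : ℂ} (hζ : ‖ζ‖ ≤ 1) {g : ℂ → ℂ}
    (hg : DifferentiableOn ℂ g (ball 0 1)) (hD : localDirichlet ζ g < ⊤) :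
    ∃ v : ℂ, ‖v‖ₑ ^ 2 ≤ 2 * ‖g 0‖ₑ ^ 2 + 2 * localDirichlet ζ g ∧
      ∀ n : ℕ, localDirichlet ζ (fun z => z ^ n * g z) =
        localDirichlet ζ g + ‖v‖ₑ ^ 2 * ∑ j ∈ Finset.range n, (‖ζ‖ₑ ^ 2) ^ j := by
  rcases hζ.lt_or_eq with h | h
  · refine ⟨g ζ, (localDirichlet_mul_of_norm_lt_one h hg hD).2, fun n => ?_⟩
    -- Each step adds |ζ^n g(ζ)|², the squared value of z^n g at ζ.
    induction n with
    | zero => simp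
    | succ n ih =>
      have hgn : DifferentiableOn ℂ (fun z => z ^ n * g z) (ball 0 1) :=
        (differentiableOn_id.pow n).mul hg
      have hlt : localDirichlet ζ (fun z => z ^ n * g z) < ⊤ := by
        rw [ih]
        exact ENNReal.add_lt_top.2 ⟨hD, ENNReal.mul_lt_top (by simp)
          (ENNReal.sum_lt_top.2 fun j _ => by simp)⟩
      have hfun : (fun z => z ^ (n + 1) * g z) = fun z => z * (z ^ n * g z) := by
        ext z
        ring
      rw [hfun, (localDirichlet_mul_of_norm_lt_one h hgn hlt).1, ih, Finset.sum_range_succ,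
        enorm_mul, enorm_pow]
      ring
  · obtain ⟨v, hv, hn⟩ := exists_value_of_norm_eq_one h hg hD
    refine ⟨v, hv, fun n => ?_⟩
    have h1 : ‖ζ‖ₑ = 1 := by rw [← ofReal_norm, h, ENNReal.ofReal_one]
    rw [hn]
    simp [h1, mul_comm]

/-! ### Dirichlet means as averages of local Dirichlet integrals -/

/-- The two domains of integration are complementary in the closed disc, so a single kernel suffices
and Tonelli can be applied once. -/
lemma weight_eq (μ : Measure (closedBall (0 : ℂ) 1)) (w : ℂ) :
    weight μ w = ∫⁻ ζ, kernel ζ w ∂μ := by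
  have hm : MeasurableSet {ζ : closedBall (0 : ℂ) 1 | ‖(ζ : ℂ)‖ < 1} :=
    (isOpen_lt (by fun_prop) continuous_const).measurableSet
  have hc : {ζ : closedBall (0 : ℂ) 1 | ‖(ζ : ℂ)‖ = 1} =
      ({ζ : closedBall (0 : ℂ) 1 | ‖(ζ : ℂ)‖ < 1}ᶜ : Set (closedBall (0 : ℂ) 1)) := by
    ext ζ
    have : ‖(ζ : ℂ)‖ ≤ 1 := mem_closedBall_zero_iff.1 ζ.2
    change ‖(ζ : ℂ)‖ = 1 ↔ ¬ ‖(ζ : ℂ)‖ < 1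
    rw [not_lt]
    exact ⟨fun h => h.ge, fun h => le_antisymm this h⟩
  rw [← lintegral_add_compl _ hm, weight, hc]
  congr 1
  · exact setLIntegral_congr_fun hm fun ζ hζ => (if_pos (show ‖(ζ : ℂ)‖ < 1 from hζ)).symm
  · exact setLIntegral_congr_fun hm.compl fun ζ hζ => (if_neg (show ¬ ‖(ζ : ℂ)‖ < 1 from hζ)).symm

lemma measurable_kernel : Measurable fun p : ℂ × ℂ => kernel p.1 p.2 := by
  refine Measurable.ite (measurableSet_lt (by fun_prop) measurable_const) ?_ ?_
  · refine Measurable.ite (measurableSet_eq_fun (by fun_prop) (by fun_prop)) (by fun_prop) ?_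
    refine ENNReal.measurable_ofReal.comp (Measurable.div (Real.measurable_log.comp ?_) ?_)
    · refine (Measurable.norm (Measurable.div ?_ ?_)).pow_const 2
      · exact (Continuous.measurable (by fun_prop))
      · exact (Continuous.measurable (by fun_prop))
    · exact (Continuous.measurable (by fun_prop))
  · refine ENNReal.measurable_ofReal.comp (Measurable.div ?_ ?_)
    · exact (Continuous.measurable (by fun_prop))
    · exact (Continuous.measurable (by fun_prop))

lemma IsHolo.differentiableOn_slice {f : ℂ × ℂ → ℂ} (hf : IsHolo f) {w : ℂ}
    (hw : w ∈ ball (0 : ℂ) 1) : DifferentiableOn ℂ (fun z => f (z, w)) (ball 0 1) := fun z hz =>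
  ((hf.analytic (z, w) ⟨hz, hw⟩).differentiableAt.comp z (f := fun z => (z, w))
    (by fun_prop)).differentiableWithinAt

lemma IsHolo.deriv_slice {f : ℂ × ℂ → ℂ} (hf : IsHolo f) {z w : ℂ} (hz : z ∈ ball (0 : ℂ) 1)
    (hw : w ∈ ball (0 : ℂ) 1) : deriv (fun z => f (z, w)) z = partial₁ f (z, w) := by
  have h1 := (hf.analytic (z, w) ⟨hz, hw⟩).differentiableAt.hasFDerivAt
  have h2 : HasDerivAt (fun z : ℂ => (z, w)) (1, 0) z :=
    (hasDerivAt_id z).prodMk (hasDerivAt_const z w)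
  exact (h1.comp_hasDerivAt z h2).deriv

/-- The local Dirichlet integral at `p.2` of the slice of `f` at height `r e^{i p.1}`. -/
def sliceDirichlet (f : ℂ × ℂ → ℂ) (r : ℝ) (p : ℝ × closedBall (0 : ℂ) 1) : ℝ≥0∞ :=
  localDirichlet p.2 fun z => f (z, circleMap 0 r p.1)

section Slices

variable {f : ℂ × ℂ → ℂ} (hf : IsHolo f) {r : ℝ} (hr : r ∈ Ioo (0 : ℝ) 1)
include hf hr

lemma sliceDirichlet_eq (p : ℝ × closedBall (0 : ℂ) 1) :
    sliceDirichlet f r p =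
      ∫⁻ z, ‖partial₁ f (z, circleMap 0 r p.1)‖ₑ ^ 2 * kernel p.2 z ∂area := by
  refine lintegral_congr_ae ?_
  filter_upwards [ae_area] with z hz
  rw [hf.deriv_slice hz (circleMap_mem hr _)]

lemma measurable_sliceDirichlet : Measurable (sliceDirichlet f r) := by
  rw [funext (sliceDirichlet_eq hf hr)]
  refine Measurable.lintegral_prod_right' (f := fun q : (ℝ × closedBall (0 : ℂ) 1) × ℂ =>
    ‖partial₁ f (q.2, circleMap 0 r q.1.1)‖ₑ ^ 2 * kernel q.1.2 q.2) ?_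
  refine Measurable.mul ?_ (measurable_kernel.comp (g := fun p : ℂ × ℂ => kernel p.1 p.2)
    (f := fun q : (ℝ × closedBall (0 : ℂ) 1) × ℂ => ((q.1.2 : ℂ), q.2)) (by fun_prop))
  exact ((measurable_partial₁ f).comp (Continuous.measurable (by fun_prop))).enorm.pow_const 2

/-- Tonelli exchanges μ with the area measure. All one-variable results enter through this formula.
-/
lemma dirichletMean₁_eq_sliceDirichlet (μ : Measure (closedBall (0 : ℂ) 1)) [IsFiniteMeasure μ] :
    dirichletMean₁ μ f r = ∫⁻ p, sliceDirichlet f r p ∂(angle.prod μ) := by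
  rw [lintegral_prod _ (measurable_sliceDirichlet hf hr).aemeasurable, dirichletMean₁]
  refine lintegral_congr fun θ => ?_
  simp only [sliceDirichlet_eq hf hr, weight_eq]
  have hk : Measurable fun p : closedBall (0 : ℂ) 1 × ℂ => kernel p.1 p.2 :=
    measurable_kernel.comp (g := fun p : ℂ × ℂ => kernel p.1 p.2)
      (f := fun q : closedBall (0 : ℂ) 1 × ℂ => ((q.1 : ℂ), q.2)) (by fun_prop)
  have hm : Measurable fun z => ‖partial₁ f (z, circleMap 0 r θ)‖ₑ ^ 2 :=
    ((measurable_partial₁ f).comp (g := partial₁ f) (f := fun z => (z, circleMap 0 r θ))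
      (Continuous.measurable (by fun_prop))).enorm.pow_const 2
  rw [lintegral_lintegral_swap]
  · refine lintegral_congr fun z => ?_
    rw [lintegral_const_mul]
    exact hk.comp measurable_prodMk_right
  · exact ((hm.comp measurable_snd).mul hk).aemeasurable

/-- On each slice, |f(0, ·)|² is the term of index 0 in Parseval's identity. -/
lemma lintegral_slice_zero_le :
    ∫⁻ θ, ‖f (0, circleMap 0 r θ)‖ₑ ^ 2 ∂angle ≤ hardyMean f r := by
  have h1 : ∀ θ, ‖f (0, circleMap 0 r θ)‖ₑ ^ 2 ≤
      ∫⁻ t, ‖f (circleMap 0 r t, circleMap 0 r θ)‖ₑ ^ 2 ∂angle := by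
    intro θ
    have hc := hasCoef_iteratedDeriv (hf.differentiableOn_slice (circleMap_mem hr θ))
    have h0 := hc.apply_zero
    rw [circle_parseval hr.1.le (hc.summable ⟨hr.1.le, hr.2⟩) fun t => hc _ (circleMap_mem hr t),
      h0]
    refine le_trans ?_ (ENNReal.le_tsum 0)
    simp
  refine (lintegral_mono h1).trans_eq ?_
  rw [hardyMean, lintegral_lintegral_swap]
  exact ((hf.measurable.comp (Continuous.measurable (by fun_prop))).enorm.pow_const 2).aemeasurable

end Slices

/-! ### Multiplication by the coordinates and the means of radius r -/

/-- Multiplication by `z₁ ^ k`. -/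
def mulFst (k : ℕ) (f : ℂ × ℂ → ℂ) (z : ℂ × ℂ) : ℂ := z.1 ^ k * f z

/-- Multiplication by `z₂`. -/
def mulSnd (f : ℂ × ℂ → ℂ) (z : ℂ × ℂ) : ℂ := z.2 * f z

lemma IsHolo.mulFst {f : ℂ × ℂ → ℂ} (hf : IsHolo f) (k : ℕ) : IsHolo (mulFst k f) :=
  ⟨fun z hz => (analyticAt_fst.pow k).mul (hf.analytic z hz),
    fun z hz => by simp [Bidisc.mulFst, hf.zero_off z hz]⟩

lemma IsHolo.mulSnd {f : ℂ × ℂ → ℂ} (hf : IsHolo f) : IsHolo (mulSnd f) :=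
  ⟨fun z hz => analyticAt_snd.mul (hf.analytic z hz),
    fun z hz => by simp [Bidisc.mulSnd, hf.zero_off z hz]⟩

lemma mulFst_mulFst (j k : ℕ) (f : ℂ × ℂ → ℂ) : mulFst j (mulFst k f) = mulFst (j + k) f := by
  ext z
  simp only [mulFst]
  ring

/-- Differences of a sequence with geometric increments. -/
lemma sum_alternating_choose {d : ℕ → ℝ} {c x : ℝ}
    (hd : ∀ k, d k = d 0 + c * ∑ j ∈ Finset.range k, x ^ j) (n : ℕ) :
    ∑ k ∈ Finset.range (n + 2), (-1 : ℝ) ^ k * ((n + 1).choose k : ℝ) * d k = -(c * (1 - x) ^ n) := by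
  -- Pascal's rule reduces the difference of order n + 1 of d to that of order n of d k - d (k + 1)
  -- = -c x^k, which the binomial theorem sums.
  have h1 := Finset.sum_choose_succ_mul (R := ℝ) (fun k _ => (-1 : ℝ) ^ k * d k) n
  have h2 : (1 - x) ^ n = ∑ k ∈ Finset.range (n + 1), (-1 : ℝ) ^ k * x ^ k * (n.choose k : ℝ) := by
    rw [sub_eq_add_neg, add_comm, add_pow]
    refine Finset.sum_congr rfl fun k _ => ?_
    rw [neg_pow]
    ring
  calc _ = ∑ k ∈ Finset.range (n + 2), ((n + 1).choose k : ℝ) * ((-1 : ℝ) ^ k * d k) :=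
        Finset.sum_congr rfl fun k _ => by ring
    _ = _ := by
        rw [h1, h2, Finset.mul_sum, ← Finset.sum_add_distrib, ← Finset.sum_neg_distrib]
        refine Finset.sum_congr rfl fun k _ => ?_
        rw [hd (k + 1), hd k, Finset.sum_range_succ]
        ring

lemma hardyMean_mulFst (f : ℂ × ℂ → ℂ) {r : ℝ} (hr : r ∈ Ioo (0 : ℝ) 1) :
    hardyMean (mulFst 1 f) r = ENNReal.ofReal (r ^ 2) * hardyMean f r := by
  have h : ∀ θ, ‖circleMap 0 r θ‖ₑ ^ 2 = ENNReal.ofReal (r ^ 2) := fun θ => by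
    rw [← ofReal_norm, norm_circleMap_zero, abs_of_pos hr.1, ENNReal.ofReal_pow hr.1.le]
  simp only [hardyMean, mulFst, pow_one, enorm_mul, mul_pow, h]
  simp only [lintegral_const_mul' _ _ ENNReal.ofReal_ne_top]

lemma hardyMean_mulSnd (f : ℂ × ℂ → ℂ) {r : ℝ} (hr : r ∈ Ioo (0 : ℝ) 1) :
    hardyMean (mulSnd f) r = ENNReal.ofReal (r ^ 2) * hardyMean f r := by
  have h : ∀ θ, ‖circleMap 0 r θ‖ₑ ^ 2 = ENNReal.ofReal (r ^ 2) := fun θ => by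
    rw [← ofReal_norm, norm_circleMap_zero, abs_of_pos hr.1, ENNReal.ofReal_pow hr.1.le]
  simp only [hardyMean, mulSnd, enorm_mul, mul_pow, h]
  simp only [lintegral_const_mul' _ _ ENNReal.ofReal_ne_top]

section Growth

variable {f : ℂ × ℂ → ℂ} (hf : IsHolo f) {r : ℝ} (hr : r ∈ Ioo (0 : ℝ) 1)
  (μ : Measure (closedBall (0 : ℂ) 1)) [IsFiniteMeasure μ]
include hf hr

/-- The estimate of |v|² is integrated over all slices: 3 is 1 + 2, and the values at z₁ = 0 are
controlled by the Hardy mean. -/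
lemma dirichletMean₁_mulFst_le :
    dirichletMean₁ μ (mulFst 1 f) r ≤ 3 * dirichletMean₁ μ f r + 2 * μ univ * hardyMean f r := by
  -- A finite mean ensures that almost every slice has a finite local Dirichlet integral.
  by_cases htop : dirichletMean₁ μ f r = ⊤
  · simp [htop]
  have hm := measurable_sliceDirichlet hf hr
  rw [dirichletMean₁_eq_sliceDirichlet (hf.mulFst 1) hr]
  rw [dirichletMean₁_eq_sliceDirichlet hf hr] at htop ⊢
  have hm0 : Measurable fun p : ℝ × closedBall (0 : ℂ) 1 => ‖f (0, circleMap 0 r p.1)‖ₑ ^ 2 :=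
    (hf.measurable.comp (Continuous.measurable (by fun_prop))).enorm.pow_const 2
  calc ∫⁻ p, sliceDirichlet (mulFst 1 f) r p ∂(angle.prod μ)
      ≤ ∫⁻ p, (3 * sliceDirichlet f r p + 2 * ‖f (0, circleMap 0 r p.1)‖ₑ ^ 2) ∂(angle.prod μ) := by
        refine lintegral_mono_ae ?_
        filter_upwards [ae_lt_top hm htop] with p hp
        obtain ⟨v, hv, hn⟩ := exists_localDirichlet_pow_mul (mem_closedBall_zero_iff.1 p.2.2)
          (hf.differentiableOn_slice (circleMap_mem hr p.1)) hp
        have h1 := hn 1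
        simp only [Finset.range_one, Finset.sum_singleton, pow_zero, mul_one] at h1
        calc sliceDirichlet (mulFst 1 f) r p = sliceDirichlet f r p + ‖v‖ₑ ^ 2 := h1
          _ ≤ sliceDirichlet f r p +
              (2 * ‖f (0, circleMap 0 r p.1)‖ₑ ^ 2 + 2 * sliceDirichlet f r p) := by
                gcongr
                exact hv
          _ = _ := by ring
    _ = 3 * (∫⁻ p, sliceDirichlet f r p ∂(angle.prod μ)) +
        2 * (μ univ * ∫⁻ θ, ‖f (0, circleMap 0 r θ)‖ₑ ^ 2 ∂angle) := by
        rw [lintegral_add_left (hm.const_mul 3), lintegral_const_mul _ hm, lintegral_const_mul _ hm0,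
          lintegral_prod _ hm0.aemeasurable]
        simp only [lintegral_const]
        rw [lintegral_mul_const, mul_comm (μ univ)]
        exact (hf.measurable.comp (Continuous.measurable (by fun_prop))).enorm.pow_const 2
    _ ≤ _ := by
        rw [mul_assoc]
        gcongr
        exact lintegral_slice_zero_le hf hr

/-- Finiteness of every mean allows the sum to be moved under the integral, where it equals -|v|²(1
- |ζ|²)^n almost everywhere. -/
lemma sum_alternating_dirichletMean₁ (hfin : ∀ k, dirichletMean₁ μ (mulFst k f) r < ⊤) (n : ℕ) :
    ∑ k ∈ Finset.range (n + 2), (-1 : ℝ) ^ k * ((n + 1).choose k : ℝ) *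
      (dirichletMean₁ μ (mulFst k f) r).toReal ≤ 0 := by
  have hm : ∀ k, Measurable (sliceDirichlet (mulFst k f) r) := fun k =>
    measurable_sliceDirichlet (hf.mulFst k) hr
  simp only [fun k => dirichletMean₁_eq_sliceDirichlet (hf.mulFst k) hr μ] at hfin ⊢
  have hlt : ∀ k, ∀ᵐ p ∂(angle.prod μ), sliceDirichlet (mulFst k f) r p < ⊤ := fun k =>
    ae_lt_top (hm k) (hfin k).ne
  have hint : ∀ k, Integrable (fun p => (sliceDirichlet (mulFst k f) r p).toReal) (angle.prod μ) :=
    fun k => integrable_toReal_of_lintegral_ne_top (hm k).aemeasurable (hfin k).ne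
  simp only [fun k => (integral_toReal (hm k).aemeasurable (hlt k)).symm, ← integral_const_mul]
  rw [← integral_finsetSum _ fun k _ => (hint k).const_mul _]
  refine integral_nonpos_of_ae ?_
  filter_upwards [hlt 0] with p hp
  have h0 : mulFst 0 f = f := by
    ext z
    simp [mulFst]
  rw [h0] at hp
  have hζ : ‖(p.2 : ℂ)‖ ≤ 1 := mem_closedBall_zero_iff.1 p.2.2
  obtain ⟨v, -, hn⟩ := exists_localDirichlet_pow_mul hζ
    (hf.differentiableOn_slice (circleMap_mem hr p.1)) hp
  have hd : ∀ k, (sliceDirichlet (mulFst k f) r p).toReal =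
      (sliceDirichlet f r p).toReal + ‖v‖ ^ 2 * ∑ j ∈ Finset.range k, (‖(p.2 : ℂ)‖ ^ 2) ^ j := by
    intro k
    have h1 : sliceDirichlet (mulFst k f) r p =
      sliceDirichlet f r p + ‖v‖ₑ ^ 2 * ∑ j ∈ Finset.range k, (‖(p.2 : ℂ)‖ₑ ^ 2) ^ j := hn k
    have h2 : ∑ j ∈ Finset.range k, (‖(p.2 : ℂ)‖ₑ ^ 2) ^ j ≠ ⊤ :=
      (ENNReal.sum_lt_top.2 fun j _ => by simp).ne
    rw [h1, ENNReal.toReal_add hp.ne (ENNReal.mul_ne_top (by simp) h2), ENNReal.toReal_mul,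
      ENNReal.toReal_sum (fun j _ => by simp)]
    simp
  have h2 := sum_alternating_choose (d := fun k => (sliceDirichlet (mulFst k f) r p).toReal)
    (fun k => by rw [hd k, h0]) n
  simp only [Pi.zero_apply, h2]
  have h3 : 0 ≤ 1 - ‖(p.2 : ℂ)‖ ^ 2 := by nlinarith [norm_nonneg (p.2 : ℂ)]
  have : 0 ≤ ‖v‖ ^ 2 * (1 - ‖(p.2 : ℂ)‖ ^ 2) ^ n := by positivity
  linarith

/-- On each slice the second coordinate is a constant of modulus r. -/
lemma dirichletMean₁_mulSnd :
    dirichletMean₁ μ (mulSnd f) r = ENNReal.ofReal (r ^ 2) * dirichletMean₁ μ f r := by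
  rw [dirichletMean₁_eq_sliceDirichlet hf.mulSnd hr, dirichletMean₁_eq_sliceDirichlet hf hr,
    ← lintegral_const_mul' _ _ ENNReal.ofReal_ne_top]
  refine lintegral_congr fun p => ?_
  simp only [sliceDirichlet, localDirichlet, mulSnd, deriv_const_mul_field, enorm_mul, mul_pow]
  rw [← lintegral_const_mul' _ _ ENNReal.ofReal_ne_top, ← ofReal_norm (circleMap 0 r p.1),
    norm_circleMap_zero, abs_of_pos hr.1, ENNReal.ofReal_pow hr.1.le]
  simp only [mul_assoc]

end Growth

/-- As r tends to 1 the factor r² is lost, and monotonicity puts the supremum near 1. Hence a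
multiplication that only costs r² at radius r preserves the supremum. -/
lemma iSup_sq_mul {A : ℝ → ℝ≥0∞} (hA : MonotoneOn A (Ioo 0 1)) :
    ⨆ r ∈ Ioo (0 : ℝ) 1, ENNReal.ofReal (r ^ 2) * A r = ⨆ r ∈ Ioo (0 : ℝ) 1, A r := by
  refine le_antisymm (iSup₂_mono fun r hr => ?_) (iSup₂_le fun s hs => ?_)
  · refine mul_le_of_le_one_left zero_le (ENNReal.ofReal_le_one.2 ?_)
    nlinarith [hr.1, hr.2]
  · have h1 : Tendsto (fun r : ℝ => ENNReal.ofReal (r ^ 2) * A s) (𝓝[<] 1) (𝓝 (1 * A s)) := by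
      refine ENNReal.Tendsto.mul_const ?_ (Or.inl one_ne_zero)
      have h2 : Tendsto (fun r : ℝ => ENNReal.ofReal (r ^ 2)) (𝓝 1) (𝓝 (ENNReal.ofReal (1 ^ 2))) :=
        (ENNReal.continuous_ofReal.comp (continuous_pow 2)).tendsto 1
      rw [one_pow, ENNReal.ofReal_one] at h2
      exact h2.mono_left nhdsWithin_le_nhds
    rw [one_mul] at h1
    refine le_of_tendsto h1 ?_
    filter_upwards [Ioo_mem_nhdsLT hs.2] with r hr
    have hr1 : r ∈ Ioo (0 : ℝ) 1 := ⟨hs.1.trans hr.1, hr.2⟩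
    exact (mul_le_mul_right (hA hs hr1 hr.1.le) _).trans
      (le_iSup₂ (f := fun r (_ : r ∈ Ioo (0 : ℝ) 1) => ENNReal.ofReal (r ^ 2) * A r) r hr1)

/-! ### The Cauchy kernel of the bidisc -/

instance : IsProbabilityMeasure angle := by
  refine ⟨?_⟩
  rw [angle, Measure.smul_apply, Measure.restrict_apply MeasurableSet.univ, univ_inter,
    Real.volume_Ioc, sub_zero, smul_eq_mul]
  exact ENNReal.inv_mul_cancel (by simp [Real.pi_pos]) ENNReal.ofReal_ne_top

/-- Cauchy's formula with respect to the normalized angle. -/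
lemma integral_angle_cauchy {g : ℂ → ℂ} (hg : DifferentiableOn ℂ g (ball 0 1)) {ρ : ℝ}
    (hρ : ρ ∈ Ioo (0 : ℝ) 1) {w : ℂ} (hw : ‖w‖ < ρ) :
    ∫ θ, g (circleMap 0 ρ θ) * (1 - w * ((ρ : ℂ)⁻¹ * Complex.exp (-(θ * I))))⁻¹ ∂angle = g w := by
  have h := (hg.mono (closedBall_subset_ball hρ.2)).circleIntegral_sub_inv_smul
    (mem_ball_zero_iff.2 hw)
  have hpi : (Real.pi : ℂ) ≠ 0 := by exact_mod_cast Real.pi_ne_zero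
  have hρ0 : (ρ : ℂ) ≠ 0 := by exact_mod_cast hρ.1.ne'
  have e : ∀ θ : ℝ, deriv (circleMap 0 ρ) θ • ((circleMap 0 ρ θ - w)⁻¹ • g (circleMap 0 ρ θ)) =
      I * (g (circleMap 0 ρ θ) * (1 - w * ((ρ : ℂ)⁻¹ * Complex.exp (-(θ * I))))⁻¹) := by
    intro θ
    have hz : circleMap 0 ρ θ ≠ 0 := by simp [circleMap, hρ0]
    have h1 : (ρ : ℂ)⁻¹ * Complex.exp (-(θ * I)) = (circleMap 0 ρ θ)⁻¹ := by
      rw [circleMap_zero, mul_inv, Complex.exp_neg]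
    have h2 : circleMap 0 ρ θ - w ≠ 0 := by
      intro h
      have h3 := norm_circleMap_zero ρ θ
      rw [sub_eq_zero.1 h, abs_of_pos hρ.1] at h3
      exact hw.ne h3
    have h3 : 1 - w * (circleMap 0 ρ θ)⁻¹ ≠ 0 := by
      rw [← div_eq_mul_inv, one_sub_div hz]
      exact div_ne_zero h2 hz
    rw [h1, deriv_circleMap, smul_eq_mul, smul_eq_mul]
    field_simp
  rw [circleIntegral] at h
  simp only [e, intervalIntegral.integral_const_mul] at h
  rw [angle, integral_smul_measure, ENNReal.toReal_inv, ENNReal.toReal_ofReal (by positivity),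
    ← intervalIntegral.integral_of_le (by positivity), Complex.real_smul]
  rw [smul_eq_mul] at h
  push_cast
  rw [inv_mul_eq_iff_eq_mul₀ (by simp [hpi])]
  refine mul_left_cancel₀ I_ne_zero ?_
  rw [h]
  ring

/-- The conjugated first coordinate on the torus, divided by `ρ`. -/
def torusCoord₁ (ρ : ℝ) : C(Circle × Circle, ℂ) :=
  ⟨fun p => (ρ : ℂ)⁻¹ * ((p.1⁻¹ : Circle) : ℂ), by fun_prop⟩

/-- The conjugated second coordinate on the torus, divided by `ρ`. -/
def torusCoord₂ (ρ : ℝ) : C(Circle × Circle, ℂ) :=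
  ⟨fun p => (ρ : ℂ)⁻¹ * ((p.2⁻¹ : Circle) : ℂ), by fun_prop⟩

/-- The Cauchy kernel, as a function on the torus which depends on a point of the bidisc. -/
def cauchyKernel (ρ : ℝ) (z : ℂ × ℂ) : C(Circle × Circle, ℂ) :=
  Ring.inverse (1 - z.1 • torusCoord₁ ρ) * Ring.inverse (1 - z.2 • torusCoord₂ ρ)

lemma norm_smul_lt_one {ρ : ℝ} (hρ : 0 < ρ) {w : ℂ} (hw : ‖w‖ < ρ) {u : C(Circle × Circle, ℂ)}
    (hu : ∀ p, ‖u p‖ = ρ⁻¹) : ‖w • u‖ < 1 := by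
  have h1 : ‖u‖ ≤ ρ⁻¹ := (ContinuousMap.norm_le _ (by positivity)).2 fun p => (hu p).le
  calc ‖w • u‖ = ‖w‖ * ‖u‖ := norm_smul _ _
    _ ≤ ‖w‖ * ρ⁻¹ := by gcongr
    _ < ρ * ρ⁻¹ := by gcongr
    _ = 1 := mul_inv_cancel₀ hρ.ne'

section CauchyKernel

variable {ρ : ℝ} (hρ : 0 < ρ) {z : ℂ × ℂ} (hz₁ : ‖z.1‖ < ρ) (hz₂ : ‖z.2‖ < ρ)
include hρ hz₁ hz₂

lemma isUnit_cauchyKernel :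
    IsUnit (1 - z.1 • torusCoord₁ ρ) ∧ IsUnit (1 - z.2 • torusCoord₂ ρ) :=
  ⟨isUnit_one_sub_of_norm_lt_one (norm_smul_lt_one hρ hz₁ fun p => by
      rw [torusCoord₁, ContinuousMap.coe_mk, norm_mul, Circle.norm_coe]; simp [abs_of_pos hρ]),
    isUnit_one_sub_of_norm_lt_one (norm_smul_lt_one hρ hz₂ fun p => by
      rw [torusCoord₂, ContinuousMap.coe_mk, norm_mul, Circle.norm_coe]; simp [abs_of_pos hρ])⟩

/-- Inversion is analytic on the units of the Banach algebra C(𝕋²). Analyticity as a vector-valued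
map is what makes every continuous functional of the kernel analytic in z. -/
lemma analyticAt_cauchyKernel : AnalyticAt ℂ (cauchyKernel ρ) z := by
  obtain ⟨h1, h2⟩ := isUnit_cauchyKernel hρ hz₁ hz₂
  have a1 := (analyticOnNhd_inverse (𝕜 := ℂ) (A := C(Circle × Circle, ℂ)) _ h1)
  have a2 := (analyticOnNhd_inverse (𝕜 := ℂ) (A := C(Circle × Circle, ℂ)) _ h2)
  exact (a1.comp (f := fun z : ℂ × ℂ => 1 - z.1 • torusCoord₁ ρ) (x := z)
    (analyticAt_const.sub (analyticAt_fst.smul analyticAt_const))).mul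
    (a2.comp (f := fun z : ℂ × ℂ => 1 - z.2 • torusCoord₂ ρ) (x := z)
    (analyticAt_const.sub (analyticAt_snd.smul analyticAt_const)))

lemma cauchyKernel_apply (p : Circle × Circle) : cauchyKernel ρ z p =
    (1 - z.1 * torusCoord₁ ρ p)⁻¹ * (1 - z.2 * torusCoord₂ ρ p)⁻¹ := by
  obtain ⟨h1, h2⟩ := isUnit_cauchyKernel hρ hz₁ hz₂
  have e1 := congrArg (fun u : C(Circle × Circle, ℂ) => u p) (Ring.inverse_mul_cancel _ h1)
  have e2 := congrArg (fun u : C(Circle × Circle, ℂ) => u p) (Ring.inverse_mul_cancel _ h2)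
  simp only [ContinuousMap.mul_apply, ContinuousMap.one_apply, ContinuousMap.sub_apply,
    ContinuousMap.smul_apply, smul_eq_mul] at e1 e2
  rw [cauchyKernel, ContinuousMap.mul_apply, eq_inv_of_mul_eq_one_left e1,
    eq_inv_of_mul_eq_one_left e2]

end CauchyKernel

/-! ### Pairing a function with the Cauchy kernel on a torus -/

lemma continuous_torusFun {f : ℂ × ℂ → ℂ} (hf : IsHolo f) {r : ℝ} (hr : r ∈ Ioo (0 : ℝ) 1) :
    Continuous (torusFun f r) :=
  hf.analytic.continuousOn.comp_continuous (by fun_prop)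
    fun p => ⟨circleMap_mem hr _, circleMap_mem hr _⟩

lemma exists_norm_torusFun_le {f : ℂ × ℂ → ℂ} (hf : IsHolo f) {r : ℝ} (hr : r ∈ Ioo (0 : ℝ) 1) :
    ∃ C, ∀ p, ‖torusFun f r p‖ ≤ C := by
  have hsub : closedBall (0 : ℂ) r ×ˢ closedBall (0 : ℂ) r ⊆ bidisc :=
    prod_mono (closedBall_subset_ball hr.2) (closedBall_subset_ball hr.2)
  obtain ⟨C, hC⟩ := ((isCompact_closedBall (0 : ℂ) r).prod
    (isCompact_closedBall (0 : ℂ) r)).exists_bound_of_continuousOn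
    (hf.analytic.continuousOn.mono hsub)
  exact ⟨C, fun p => hC _ ⟨by simp [abs_of_pos hr.1], by simp [abs_of_pos hr.1]⟩⟩

lemma integrable_torusFun_mul {f : ℂ × ℂ → ℂ} (hf : IsHolo f) {r : ℝ} (hr : r ∈ Ioo (0 : ℝ) 1)
    (u : C(Circle × Circle, ℂ)) :
    Integrable (fun p : ℝ × ℝ => torusFun f r p * u (Circle.exp p.1, Circle.exp p.2))
      (angle.prod angle) := by
  obtain ⟨C, hC⟩ := exists_norm_torusFun_le hf hr
  have hc := continuous_torusFun hf hr
  refine Integrable.of_bound (Continuous.aestronglyMeasurable (by fun_prop)) (C * ‖u‖)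
    (ae_of_all _ fun p => ?_)
  rw [norm_mul]
  have := (norm_nonneg _).trans (hC p)
  gcongr
  · exact hC p
  · exact u.norm_coe_le_norm _

/-- For the probability measure dθ₁dθ₂/4π² the L¹ norm is at most the L² norm. This makes the
pairing continuous jointly in f, for the Hardy norm, and in u, for the uniform norm. -/
lemma norm_integral_torusFun_mul_le {f : ℂ × ℂ → ℂ} (hf : IsHolo f) {r : ℝ}
    (hr : r ∈ Ioo (0 : ℝ) 1) (u : C(Circle × Circle, ℂ)) :
    ‖∫ p : ℝ × ℝ, torusFun f r p * u (Circle.exp p.1, Circle.exp p.2) ∂(angle.prod angle)‖ ≤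
      √(hardyMean f r).toReal * ‖u‖ := by
  obtain ⟨C, hC⟩ := exists_norm_torusFun_le hf hr
  have hc := continuous_torusFun hf hr
  have hL : MemLp (torusFun f r) 2 (angle.prod angle) :=
    MemLp.of_bound hc.aestronglyMeasurable C (ae_of_all _ hC)
  have h1 : ∫ p, ‖torusFun f r p‖ ∂(angle.prod angle) ≤ √(hardyMean f r).toReal := by
    have h2 := eLpNorm_le_eLpNorm_of_exponent_le (p := 1) (q := 2) (by norm_num)
      hc.aestronglyMeasurable (μ := angle.prod angle)
    rw [integral_norm_eq_lintegral_enorm hc.aestronglyMeasurable, ← eLpNorm_one_eq_lintegral_enorm]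
    refine Real.le_sqrt_of_sq_le ?_
    rw [← ENNReal.toReal_pow]
    have h3 : eLpNorm (torusFun f r) 2 (angle.prod angle) ^ 2 = hardyMean f r := by
      rw [hardyMean_eq hf, eLpNorm_eq_lintegral_rpow_enorm_toReal two_ne_zero ENNReal.ofNat_ne_top]
      simp only [ENNReal.toReal_ofNat, ENNReal.rpow_ofNat]
      rw [← ENNReal.rpow_natCast, ← ENNReal.rpow_mul]
      simp
    rw [← h3]
    exact ENNReal.toReal_mono (ENNReal.pow_ne_top hL.eLpNorm_ne_top) (by gcongr)
  calc _ ≤ ∫ p, ‖torusFun f r p‖ * ‖u‖ ∂(angle.prod angle) := by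
        refine norm_integral_le_of_norm_le ((hL.integrable (by norm_num)).norm.mul_const _)
          (ae_of_all _ fun p => ?_)
        rw [norm_mul]
        gcongr
        exact u.norm_coe_le_norm _
    _ ≤ _ := by
        rw [integral_mul_const]
        gcongr

/-- Cauchy's formula in each variable in turn. -/
lemma integral_torusFun_mul_cauchyKernel {f : ℂ × ℂ → ℂ} (hf : IsHolo f) {ρ : ℝ}
    (hρ : ρ ∈ Ioo (0 : ℝ) 1) {z : ℂ × ℂ} (hz₁ : ‖z.1‖ < ρ) (hz₂ : ‖z.2‖ < ρ) :
    ∫ p : ℝ × ℝ, torusFun f ρ p * cauchyKernel ρ z (Circle.exp p.1, Circle.exp p.2)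
      ∂(angle.prod angle) = f z := by
  rw [integral_prod _ (integrable_torusFun_mul hf hρ _)]
  have e1 : ∀ θ₁ θ₂ : ℝ, torusFun f ρ (θ₁, θ₂) * cauchyKernel ρ z (Circle.exp θ₁, Circle.exp θ₂) =
      (1 - z.1 * ((ρ : ℂ)⁻¹ * Complex.exp (-(θ₁ * I))))⁻¹ *
        (f (circleMap 0 ρ θ₁, circleMap 0 ρ θ₂) *
          (1 - z.2 * ((ρ : ℂ)⁻¹ * Complex.exp (-(θ₂ * I))))⁻¹) := by
    intro θ₁ θ₂
    rw [cauchyKernel_apply hρ.1 hz₁ hz₂]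
    simp only [torusFun, torusCoord₁, torusCoord₂, ContinuousMap.coe_mk, ← Circle.exp_neg,
      Circle.coe_exp]
    push_cast
    simp only [neg_mul]
    ring
  simp only [e1, integral_const_mul]
  have e2 : ∀ θ₁ : ℝ, ∫ θ₂, f (circleMap 0 ρ θ₁, circleMap 0 ρ θ₂) *
      (1 - z.2 * ((ρ : ℂ)⁻¹ * Complex.exp (-(θ₂ * I))))⁻¹ ∂angle = f (circleMap 0 ρ θ₁, z.2) :=
    fun θ₁ => integral_angle_cauchy (g := fun w => f (circleMap 0 ρ θ₁, w)) (fun w hw =>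
      ((hf.analytic (circleMap 0 ρ θ₁, w) ⟨circleMap_mem hρ _, hw⟩).differentiableAt.comp w
        (f := fun w => (circleMap 0 ρ θ₁, w)) (by fun_prop)).differentiableWithinAt) hρ hz₂
  simp only [e2]
  have h2 : z.2 ∈ ball (0 : ℂ) 1 := mem_ball_zero_iff.2 (hz₂.trans hρ.2)
  have h := integral_angle_cauchy (hf.differentiableOn_slice h2) hρ hz₁
  simp only [mul_comm (f _)] at h
  exact h

namespace DirichletSpace

variable {μ₁ μ₂ : Measure (closedBall (0 : ℂ) 1)} [IsFiniteMeasure μ₁] [IsFiniteMeasure μ₂]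

/-! ### Completeness and separability -/

lemma ofReal_norm_sq (f : DirichletSpace μ₁ μ₂) :
    ENNReal.ofReal (‖f‖ ^ 2) = hardySq f.toFun + dirichletIntegral μ₁ μ₂ f.toFun := by
  rw [norm_sq_eq, ENNReal.ofReal_toReal (ENNReal.add_lt_top.2 f.mem.2).ne]

lemma hardyMean_le (f : DirichletSpace μ₁ μ₂) {r : ℝ} (hr : r ∈ Ioo (0 : ℝ) 1) :
    hardyMean f.toFun r ≤ ENNReal.ofReal (‖f‖ ^ 2) := by
  rw [ofReal_norm_sq]
  exact (le_iSup₂ (f := fun r (_ : r ∈ Ioo (0 : ℝ) 1) => hardyMean f.toFun r) r hr).trans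
    le_self_add

lemma dirichletMean₁_le (f : DirichletSpace μ₁ μ₂) {r : ℝ} (hr : r ∈ Ioo (0 : ℝ) 1) :
    dirichletMean₁ μ₁ f.toFun r ≤ ENNReal.ofReal (‖f‖ ^ 2) := by
  rw [ofReal_norm_sq]
  exact ((le_iSup₂ (f := fun r (_ : r ∈ Ioo (0 : ℝ) 1) => dirichletMean₁ μ₁ f.toFun r) r hr).trans
    le_self_add).trans le_add_self

lemma dirichletMean₂_le (f : DirichletSpace μ₁ μ₂) {r : ℝ} (hr : r ∈ Ioo (0 : ℝ) 1) :
    dirichletMean₂ μ₂ f.toFun r ≤ ENNReal.ofReal (‖f‖ ^ 2) := by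
  rw [ofReal_norm_sq]
  exact ((le_iSup₂ (f := fun r (_ : r ∈ Ioo (0 : ℝ) 1) => dirichletMean₂ μ₂ f.toFun r) r hr).trans
    le_add_self).trans le_add_self

/-- Integration over the torus of radius `ρ` against a function of `D(μ₁, μ₂)`. -/
def torusPairing {ρ : ℝ} (hρ : ρ ∈ Ioo (0 : ℝ) 1) :
    DirichletSpace μ₁ μ₂ →L[ℂ] C(Circle × Circle, ℂ) →L[ℂ] ℂ :=
  LinearMap.mkContinuous₂ (LinearMap.mk₂ ℂ (fun f u => ∫ p : ℝ × ℝ, torusFun f.toFun ρ p *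
      u (Circle.exp p.1, Circle.exp p.2) ∂(angle.prod angle))
    (fun f g u => by
      rw [← integral_add (integrable_torusFun_mul f.mem.1 hρ u)
        (integrable_torusFun_mul g.mem.1 hρ u)]
      refine integral_congr_ae (ae_of_all _ fun p => ?_)
      simp [torusFun, add_mul])
    (fun c f u => by
      rw [smul_eq_mul, ← integral_const_mul]
      refine integral_congr_ae (ae_of_all _ fun p => ?_)
      simp [torusFun, mul_assoc])
    (fun f u v => by
      rw [← integral_add (integrable_torusFun_mul f.mem.1 hρ u)
        (integrable_torusFun_mul f.mem.1 hρ v)]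
      refine integral_congr_ae (ae_of_all _ fun p => ?_)
      simp [mul_add])
    (fun c f u => by
      rw [smul_eq_mul, ← integral_const_mul]
      refine integral_congr_ae (ae_of_all _ fun p => ?_)
      simp [mul_left_comm])) 1 fun f u => by
    refine (norm_integral_torusFun_mul_le f.mem.1 hρ u).trans ?_
    rw [one_mul]
    gcongr
    refine Real.sqrt_le_iff.2 ⟨norm_nonneg _, ?_⟩
    exact ENNReal.toReal_le_of_le_ofReal (by positivity) (f.hardyMean_le hρ)

lemma torusPairing_cauchyKernel {ρ : ℝ} (hρ : ρ ∈ Ioo (0 : ℝ) 1) (f : DirichletSpace μ₁ μ₂)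
    {z : ℂ × ℂ} (hz₁ : ‖z.1‖ < ρ) (hz₂ : ‖z.2‖ < ρ) :
    torusPairing hρ f (cauchyKernel ρ z) = f.toFun z :=
  integral_torusFun_mul_cauchyKernel f.mem.1 hρ hz₁ hz₂

lemma exists_radius {z : ℂ × ℂ} (hz : z ∈ bidisc) :
    ∃ ρ ∈ Ioo (0 : ℝ) 1, ‖z.1‖ < ρ ∧ ‖z.2‖ < ρ := by
  have h1 : ‖z.1‖ < 1 := mem_ball_zero_iff.1 hz.1
  have h2 : ‖z.2‖ < 1 := mem_ball_zero_iff.1 hz.2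
  obtain ⟨ρ, h, h'⟩ := exists_between (max_lt h1 h2)
  exact ⟨ρ, ⟨((norm_nonneg _).trans (le_max_left _ _)).trans_lt h, h'⟩,
    (le_max_left _ _).trans_lt h, (le_max_right _ _).trans_lt h⟩

/-- Evaluation at a point of the bidisc is a bounded functional. -/
lemma exists_evaluation {z : ℂ × ℂ} (hz : z ∈ bidisc) :
    ∃ φ : DirichletSpace μ₁ μ₂ →L[ℂ] ℂ, ∀ f, φ f = f.toFun z := by
  obtain ⟨ρ, hρ, h1, h2⟩ := exists_radius hz
  exact ⟨(torusPairing hρ).flip (cauchyKernel ρ z), fun f => torusPairing_cauchyKernel hρ f h1 h2⟩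

/-- The functionals attached to u n converge in the dual of C(𝕋²). Near z each u n and the limit are
functionals applied to one and the same analytic kernel, so values and derivatives both pass to the
limit. -/
lemma exists_analytic_limit {u : ℕ → DirichletSpace μ₁ μ₂} (hu : CauchySeq u) :
    ∃ F : ℂ × ℂ → ℂ, IsHolo F ∧ (∀ z, Tendsto (fun n => (u n).toFun z) atTop (𝓝 (F z))) ∧
      ∀ z ∈ bidisc, Tendsto (fun n => fderiv ℂ (u n).toFun z) atTop (𝓝 (fderiv ℂ F z)) := by
  have hlim : ∀ {ρ : ℝ} (hρ : ρ ∈ Ioo (0 : ℝ) 1), ∃ ℓ : C(Circle × Circle, ℂ) →L[ℂ] ℂ,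
      Tendsto (fun n => torusPairing hρ (u n)) atTop (𝓝 ℓ) := fun hρ =>
    cauchySeq_tendsto_of_complete ((torusPairing hρ).uniformContinuous.comp_cauchySeq hu)
  have hpt : ∀ z, ∃ y, Tendsto (fun n => (u n).toFun z) atTop (𝓝 y) := by
    intro z
    by_cases hz : z ∈ bidisc
    · obtain ⟨φ, hφ⟩ := exists_evaluation (μ₁ := μ₁) (μ₂ := μ₂) hz
      simp only [← hφ]
      exact cauchySeq_tendsto_of_complete (φ.uniformContinuous.comp_cauchySeq hu)
    · exact ⟨0, tendsto_const_nhds.congr fun n => ((u n).mem.1.zero_off z hz).symm⟩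
  choose F hF using hpt
  have hloc : ∀ z ∈ bidisc, ∃ ρ, ∃ hρ : ρ ∈ Ioo (0 : ℝ) 1, ∃ ℓ : C(Circle × Circle, ℂ) →L[ℂ] ℂ,
      ‖z.1‖ < ρ ∧ ‖z.2‖ < ρ ∧ Tendsto (fun n => torusPairing hρ (u n)) atTop (𝓝 ℓ) ∧
      (∀ n, (u n).toFun =ᶠ[𝓝 z] fun w => torusPairing hρ (u n) (cauchyKernel ρ w)) ∧
      F =ᶠ[𝓝 z] fun w => ℓ (cauchyKernel ρ w) := by
    intro z hz
    obtain ⟨ρ, hρ, h1, h2⟩ := exists_radius hz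
    obtain ⟨ℓ, hℓ⟩ := hlim hρ
    have hev : ∀ᶠ w : ℂ × ℂ in 𝓝 z, ‖w.1‖ < ρ ∧ ‖w.2‖ < ρ :=
      ((continuous_fst.norm.tendsto z).eventually_lt_const h1).and
        ((continuous_snd.norm.tendsto z).eventually_lt_const h2)
    refine ⟨ρ, hρ, ℓ, h1, h2, hℓ, fun n => ?_, ?_⟩
    · filter_upwards [hev] with w hw
      exact (torusPairing_cauchyKernel hρ _ hw.1 hw.2).symm
    · filter_upwards [hev] with w hw
      refine tendsto_nhds_unique (hF w) ?_
      refine (((ContinuousLinearMap.apply ℂ ℂ (cauchyKernel ρ w)).continuous.tendsto ℓ).comp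
        hℓ).congr fun n => torusPairing_cauchyKernel hρ _ hw.1 hw.2
  refine ⟨F, ⟨fun z hz => ?_, fun z hz => ?_⟩, hF, fun z hz => ?_⟩
  · obtain ⟨ρ, hρ, ℓ, h1, h2, -, -, h⟩ := hloc z hz
    exact ((ℓ.analyticAt _).comp (analyticAt_cauchyKernel hρ.1 h1 h2)).congr h.symm
  · exact tendsto_nhds_unique (hF z)
      (tendsto_const_nhds.congr fun n => ((u n).mem.1.zero_off z hz).symm)
  · obtain ⟨ρ, hρ, ℓ, h1, h2, hℓ, hn, h⟩ := hloc z hz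
    have hd := (analyticAt_cauchyKernel hρ.1 h1 h2).differentiableAt.hasFDerivAt
    have hc : ∀ L : C(Circle × Circle, ℂ) →L[ℂ] ℂ, fderiv ℂ (fun w => L (cauchyKernel ρ w)) z =
        L.comp (fderiv ℂ (cauchyKernel ρ) z) := fun L => (L.hasFDerivAt.comp z hd).fderiv
    rw [h.fderiv_eq, hc]
    refine Tendsto.congr (fun n => ((hn n).fderiv_eq.trans (hc _)).symm) ?_
    exact ((ContinuousLinearMap.compL ℂ (ℂ × ℂ) C(Circle × Circle, ℂ) ℂ).flip
      (fderiv ℂ (cauchyKernel ρ) z)).continuous.tendsto ℓ |>.comp hℓ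

/-- A form of Fatou's lemma. -/
lemma lintegral_sq_le_of_tendsto {X : Type*} [MeasurableSpace X] {ν : Measure X} {G : ℕ → X → ℂ}
    {G' : X → ℂ} {c : ℝ≥0∞} (hm : ∀ n, Measurable (G n))
    (hG : ∀ᵐ x ∂ν, Tendsto (fun n => G n x) atTop (𝓝 (G' x)))
    (hc : ∀ᶠ n in atTop, ∫⁻ x, ‖G n x‖ₑ ^ 2 ∂ν ≤ c) : ∫⁻ x, ‖G' x‖ₑ ^ 2 ∂ν ≤ c := by
  calc ∫⁻ x, ‖G' x‖ₑ ^ 2 ∂ν = ∫⁻ x, liminf (fun n => ‖G n x‖ₑ ^ 2) atTop ∂ν := by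
        refine lintegral_congr_ae (hG.mono fun x hx => ?_)
        exact (((ENNReal.continuous_pow 2).tendsto _).comp
          ((continuous_enorm.tendsto _).comp hx)).liminf_eq.symm
    _ ≤ liminf (fun n => ∫⁻ x, ‖G n x‖ₑ ^ 2 ∂ν) atTop :=
        lintegral_liminf_le fun n => (hm n).enorm.pow_const 2
    _ ≤ c := liminf_le_of_frequently_le' hc.frequently

/-- For fixed m, Fatou's lemma in n bounds each mean of u m - F by the bound on ‖u m - u n‖². This
puts F in the space and gives convergence in norm. -/
instance : CompleteSpace (DirichletSpace μ₁ μ₂) := by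
  refine Metric.complete_of_cauchySeq_tendsto fun u hu => ?_
  obtain ⟨F, hF, hpt, hder⟩ := exists_analytic_limit hu
  have key : ∀ ε > 0, ∃ N, ∀ m ≥ N, (∀ r ∈ Ioo (0 : ℝ) 1,
      hardyMean ((u m).toFun - F) r ≤ ENNReal.ofReal (ε ^ 2) ∧
      dirichletMean₁ μ₁ ((u m).toFun - F) r ≤ ENNReal.ofReal (ε ^ 2) ∧
      dirichletMean₂ μ₂ ((u m).toFun - F) r ≤ ENNReal.ofReal (ε ^ 2)) := by
    intro ε hε
    obtain ⟨N, hN⟩ := Metric.cauchySeq_iff.1 hu ε hε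
    refine ⟨N, fun m hm r hr => ?_⟩
    have hdist : ∀ᶠ n in atTop, ENNReal.ofReal (‖u m - u n‖ ^ 2) ≤ ENNReal.ofReal (ε ^ 2) := by
      filter_upwards [eventually_ge_atTop N] with n hn
      have := hN m hm n hn
      rw [dist_eq_norm] at this
      gcongr
    have hsub : ∀ n, (u m - u n).toFun = (u m).toFun - (u n).toFun := fun n => rfl
    have hder' : ∀ z ∈ bidisc, Tendsto (fun n => fderiv ℂ (u m - u n).toFun z) atTop
        (𝓝 (fderiv ℂ ((u m).toFun - F) z)) := by
      intro z hz
      have h1 := ((u m).mem.1.analytic z hz).differentiableAt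
      rw [fderiv_sub h1 (hF.analytic z hz).differentiableAt]
      simp only [hsub, fun n => fderiv_sub h1 ((u n).mem.1.analytic z hz).differentiableAt]
      exact (hder z hz).const_sub _
    have happ : ∀ z ∈ bidisc, ∀ v, Tendsto (fun n => fderiv ℂ (u m - u n).toFun z v) atTop
        (𝓝 (fderiv ℂ ((u m).toFun - F) z v)) := fun z hz v =>
      ((ContinuousLinearMap.apply ℂ ℂ v).continuous.tendsto _).comp (hder' z hz)
    have hH : IsHolo ((u m).toFun - F) := by
      rw [sub_eq_add_neg, ← neg_one_smul ℂ F]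
      exact (u m).mem.1.add (hF.smul _)
    refine ⟨?_, ?_, ?_⟩
    · rw [hardyMean_eq hH]
      refine lintegral_sq_le_of_tendsto (G := fun n => torusFun (u m - u n).toFun r)
        (fun n => measurable_torusFun (u m - u n).mem.1 r)
        (ae_of_all _ fun p => (hpt _).const_sub _) (hdist.mono fun n hn => ?_)
      rw [← hardyMean_eq (u m - u n).mem.1]
      exact ((u m - u n).hardyMean_le hr).trans hn
    · rw [dirichletMean₁_eq]
      refine lintegral_sq_le_of_tendsto (G := fun n => derivFun₁ (u m - u n).toFun r)
        (fun n => measurable_derivFun₁ _ r) ?_ (hdist.mono fun n hn => ?_)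
      · filter_upwards [ae_prodWeight μ₁] with p hp
        exact happ _ ⟨hp, circleMap_mem hr _⟩ _
      · rw [← dirichletMean₁_eq]
        exact ((u m - u n).dirichletMean₁_le hr).trans hn
    · rw [dirichletMean₂_eq]
      refine lintegral_sq_le_of_tendsto (G := fun n => derivFun₂ (u m - u n).toFun r)
        (fun n => measurable_derivFun₂ _ r) ?_ (hdist.mono fun n hn => ?_)
      · filter_upwards [ae_prodWeight μ₂] with p hp
        exact happ _ ⟨circleMap_mem hr _, hp⟩ _
      · rw [← dirichletMean₂_eq]
        exact ((u m - u n).dirichletMean₂_le hr).trans hn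
  have hsup : ∀ ε > 0, ∃ N, ∀ m ≥ N,
      hardySq ((u m).toFun - F) + dirichletIntegral μ₁ μ₂ ((u m).toFun - F) ≤
        ENNReal.ofReal (3 * ε ^ 2) := by
    intro ε hε
    obtain ⟨N, hN⟩ := key ε hε
    refine ⟨N, fun m hm => ?_⟩
    calc _ ≤ ENNReal.ofReal (ε ^ 2) + (ENNReal.ofReal (ε ^ 2) + ENNReal.ofReal (ε ^ 2)) :=
          add_le_add (iSup₂_le fun r hr => (hN m hm r hr).1)
            (add_le_add (iSup₂_le fun r hr => (hN m hm r hr).2.1)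
              (iSup₂_le fun r hr => (hN m hm r hr).2.2))
      _ = _ := by
        rw [← ENNReal.ofReal_add (by positivity) (by positivity),
          ← ENNReal.ofReal_add (by positivity) (by positivity)]
        congr 1
        ring
  have hmem : ∀ m, hardySq ((u m).toFun - F) + dirichletIntegral μ₁ μ₂ ((u m).toFun - F) < ⊤ →
      (u m).toFun - F ∈ dirichletSubmodule μ₁ μ₂ := by
    intro m hm
    refine ⟨?_, ENNReal.add_lt_top.1 hm⟩
    rw [sub_eq_add_neg, ← neg_one_smul ℂ F]
    exact (u m).mem.1.add (hF.smul _)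
  obtain ⟨N₀, hN₀⟩ := hsup 1 one_pos
  -- F is the difference of the two members u N₀ and u N₀ - F.
  have hFmem : F ∈ dirichletSubmodule μ₁ μ₂ := by
    have h1 := (dirichletSubmodule μ₁ μ₂).sub_mem (show (u N₀).toFun ∈ _ from (u N₀).mem)
      (hmem N₀ ((hN₀ N₀ le_rfl).trans_lt ENNReal.ofReal_lt_top))
    rwa [sub_sub_cancel] at h1
  let f : DirichletSpace μ₁ μ₂ := (⟨F, hFmem⟩ : dirichletSubmodule μ₁ μ₂)
  refine ⟨f, Metric.tendsto_atTop.2 fun ε hε => ?_⟩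
  -- The three means contribute 3(ε/2)², which is less than ε².
  obtain ⟨N, hN⟩ := hsup (ε / 2) (by positivity)
  refine ⟨N, fun n hn => ?_⟩
  rw [dist_eq_norm]
  have h1 : ‖u n - f‖ ^ 2 ≤ 3 * (ε / 2) ^ 2 := by
    rw [norm_sq_eq]
    exact ENNReal.toReal_le_of_le_ofReal (by positivity) (hN n hn)
  refine lt_of_pow_lt_pow_left₀ 2 hε.le (h1.trans_lt ?_)
  nlinarith

/-- A function orthogonal to the reproducing kernels at a countable dense set vanishes on that set,
hence on the bidisc by continuity, and outside it by convention. -/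
instance : TopologicalSpace.SeparableSpace (DirichletSpace μ₁ μ₂) := by
  obtain ⟨s, hsc, hsd⟩ := TopologicalSpace.exists_countable_dense bidisc
  have hφ : ∀ z : bidisc, ∃ k : DirichletSpace μ₁ μ₂, ∀ f, inner ℂ k f = f.toFun z := by
    intro z
    obtain ⟨φ, hφ⟩ := exists_evaluation (μ₁ := μ₁) (μ₂ := μ₂) z.2
    exact ⟨(InnerProductSpace.toDual ℂ _).symm φ, fun f => by
      rw [InnerProductSpace.toDual_symm_apply, hφ]⟩
  choose k hk using hφ
  set S := Submodule.span ℂ (k '' s) with hS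
  have hbot : Sᗮ = ⊥ := by
    refine (Submodule.eq_bot_iff _).2 fun f hf => ?_
    have h0 : EqOn (fun z : bidisc => f.toFun z) (fun _ => 0) s := fun z hz => by
      change f.toFun z = 0
      rw [← hk z f]
      exact (Submodule.mem_orthogonal _ _).1 hf _ (Submodule.subset_span (mem_image_of_mem k hz))
    have hc : Continuous fun z : bidisc => f.toFun z :=
      f.mem.1.analytic.continuousOn.comp_continuous continuous_subtype_val fun z => z.2
    have h1 := hc.ext_on hsd continuous_const h0
    refine Subtype.ext (funext fun z => ?_)
    by_cases hz : z ∈ bidisc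
    · exact congrFun h1 ⟨z, hz⟩
    · exact f.mem.1.zero_off z hz
  have hdense : Dense (S : Set (DirichletSpace μ₁ μ₂)) := by
    rw [← Submodule.topologicalClosure_eq_top_iff] at hbot
    exact Submodule.dense_iff_topologicalClosure_eq_top.2 hbot
  have hsep : TopologicalSpace.IsSeparable (S : Set (DirichletSpace μ₁ μ₂)) :=
    (hsc.image k).isSeparable.span
  have := hsep.closure
  rw [hdense.closure_eq] at this
  exact TopologicalSpace.isSeparable_univ_iff.1 this

end DirichletSpace

/-! ### Exchanging the variables -/

lemma IsHolo.swap {f : ℂ × ℂ → ℂ} (hf : IsHolo f) : IsHolo (f ∘ Prod.swap) := by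
  refine ⟨fun z hz => ?_, fun z hz => hf.zero_off _ fun h => hz ⟨h.2, h.1⟩⟩
  exact (hf.analytic z.swap ⟨hz.2, hz.1⟩).comp (f := fun z : ℂ × ℂ => (z.2, z.1))
    (analyticAt_snd.prod analyticAt_fst)

lemma partial₁_comp_swap (f : ℂ × ℂ → ℂ) (z : ℂ × ℂ) :
    partial₁ (f ∘ Prod.swap) z = partial₂ f z.swap := by
  have h := (ContinuousLinearEquiv.prodComm ℂ ℂ ℂ).comp_right_fderiv (f := f) (x := z)
  change fderiv ℂ (f ∘ Prod.swap) z = (fderiv ℂ f z.swap).comp _ at h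
  rw [partial₁, partial₂, h]
  rfl

/-- Through this identity all results on ∂₁ apply to ∂₂. -/
lemma dirichletMean₂_eq_swap (μ : Measure (closedBall (0 : ℂ) 1)) (f : ℂ × ℂ → ℂ) (r : ℝ) :
    dirichletMean₂ μ f r = dirichletMean₁ μ (f ∘ Prod.swap) r := by
  simp only [dirichletMean₂, dirichletMean₁, partial₁_comp_swap, Prod.swap_prod_mk]

lemma hardyMean_swap {f : ℂ × ℂ → ℂ} (hf : IsHolo f) (r : ℝ) :
    hardyMean (f ∘ Prod.swap) r = hardyMean f r := by
  rw [hardyMean, hardyMean, lintegral_lintegral_swap]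
  · rfl
  · exact ((hf.swap.measurable.comp (Continuous.measurable (by fun_prop))).enorm.pow_const
      2).aemeasurable

lemma mulFst_one_comp_swap (f : ℂ × ℂ → ℂ) :
    mulFst 1 f ∘ Prod.swap = mulSnd (f ∘ Prod.swap) := by
  ext z
  simp [mulFst, mulSnd]

lemma mulSnd_comp_swap (f : ℂ × ℂ → ℂ) :
    mulSnd f ∘ Prod.swap = mulFst 1 (f ∘ Prod.swap) := by
  ext z
  simp [mulFst, mulSnd]

/-! ### The two Dirichlet integrals of a product -/

/-- The part of the Dirichlet integral which comes from `∂₁ f`. -/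
def dirichletSq₁ (μ : Measure (closedBall (0 : ℂ) 1)) (f : ℂ × ℂ → ℂ) : ℝ≥0∞ :=
  ⨆ r ∈ Ioo (0 : ℝ) 1, dirichletMean₁ μ f r

section Squares

variable {f : ℂ × ℂ → ℂ} (hf : IsHolo f) (μ : Measure (closedBall (0 : ℂ) 1)) [IsFiniteMeasure μ]
include hf

lemma hardySq_swap : hardySq (f ∘ Prod.swap) = hardySq f := by
  simp only [hardySq, hardyMean_swap hf]

lemma hardySq_mulFst : hardySq (mulFst 1 f) = hardySq f := by
  rw [hardySq, hardySq, ← iSup_sq_mul (hardyMean_mono hf)]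
  exact biSup_congr fun r hr => hardyMean_mulFst f hr

lemma hardySq_mulSnd : hardySq (mulSnd f) = hardySq f := by
  rw [hardySq, hardySq, ← iSup_sq_mul (hardyMean_mono hf)]
  exact biSup_congr fun r hr => hardyMean_mulSnd f hr

lemma dirichletSq₁_mulSnd : dirichletSq₁ μ (mulSnd f) = dirichletSq₁ μ f := by
  rw [dirichletSq₁, dirichletSq₁, ← iSup_sq_mul (dirichletMean₁_mono μ hf)]
  exact biSup_congr fun r hr => dirichletMean₁_mulSnd hf hr μ

lemma dirichletSq₁_mulFst_le :
    dirichletSq₁ μ (mulFst 1 f) ≤ 3 * dirichletSq₁ μ f + 2 * μ univ * hardySq f := by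
  refine iSup₂_le fun r hr => (dirichletMean₁_mulFst_le hf hr μ).trans ?_
  gcongr
  · exact le_iSup₂ (f := fun r (_ : r ∈ Ioo (0 : ℝ) 1) => dirichletMean₁ μ f r) r hr
  · exact le_iSup₂ (f := fun r (_ : r ∈ Ioo (0 : ℝ) 1) => hardyMean f r) r hr

/-- By monotonicity the suprema are limits as r tends to 1, and limits, unlike suprema, pass through
alternating sums. -/
lemma sum_alternating_dirichletSq₁ (hfin : ∀ k, dirichletSq₁ μ (mulFst k f) < ⊤) (n : ℕ) :
    ∑ k ∈ Finset.range (n + 2), (-1 : ℝ) ^ k * ((n + 1).choose k : ℝ) *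
      (dirichletSq₁ μ (mulFst k f)).toReal ≤ 0 := by
  have h1 : Tendsto (fun r => ∑ k ∈ Finset.range (n + 2), (-1 : ℝ) ^ k * ((n + 1).choose k : ℝ) *
      (dirichletMean₁ μ (mulFst k f) r).toReal) (𝓝[<] 1) (𝓝 (∑ k ∈ Finset.range (n + 2),
      (-1 : ℝ) ^ k * ((n + 1).choose k : ℝ) * (dirichletSq₁ μ (mulFst k f)).toReal)) :=
    tendsto_finsetSum _ fun k _ =>
      (tendsto_sup (dirichletMean₁_mono μ (hf.mulFst k)) (hfin k)).const_mul _
  refine le_of_tendsto h1 ?_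
  filter_upwards [Ioo_mem_nhdsLT zero_lt_one] with r hr
  exact sum_alternating_dirichletMean₁ hf hr μ (fun k => (le_iSup₂
    (f := fun r (_ : r ∈ Ioo (0 : ℝ) 1) => dirichletMean₁ μ (mulFst k f) r) r hr).trans_lt
    (hfin k)) n

end Squares

lemma dirichletIntegral_eq (μ₁ μ₂ : Measure (closedBall (0 : ℂ) 1)) (f : ℂ × ℂ → ℂ) :
    dirichletIntegral μ₁ μ₂ f = dirichletSq₁ μ₁ f + dirichletSq₁ μ₂ (f ∘ Prod.swap) := by
  simp only [dirichletIntegral, dirichletSq₁, dirichletMean₂_eq_swap]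

/-- The square of the norm, for arbitrary functions. -/
def totalSq (μ₁ μ₂ : Measure (closedBall (0 : ℂ) 1)) (f : ℂ × ℂ → ℂ) : ℝ≥0∞ :=
  hardySq f + dirichletIntegral μ₁ μ₂ f

lemma totalSq_swap (μ₁ μ₂ : Measure (closedBall (0 : ℂ) 1)) {f : ℂ × ℂ → ℂ} (hf : IsHolo f) :
    totalSq μ₁ μ₂ (f ∘ Prod.swap) = totalSq μ₂ μ₁ f := by
  have h : (f ∘ Prod.swap) ∘ Prod.swap = f := by
    ext z
    simp
  rw [totalSq, totalSq, hardySq_swap hf, dirichletIntegral_eq, dirichletIntegral_eq, h,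
    add_comm (dirichletSq₁ μ₁ _)]

section Total

variable (μ₁ μ₂ : Measure (closedBall (0 : ℂ) 1)) [IsFiniteMeasure μ₁] [IsFiniteMeasure μ₂]

lemma totalSq_mulFst_le {f : ℂ × ℂ → ℂ} (hf : IsHolo f) :
    totalSq μ₁ μ₂ (mulFst 1 f) ≤ (3 + 2 * μ₁ univ) * totalSq μ₁ μ₂ f := by
  rw [totalSq, totalSq, dirichletIntegral_eq, dirichletIntegral_eq, hardySq_mulFst hf,
    mulFst_one_comp_swap, dirichletSq₁_mulSnd hf.swap]
  calc _ ≤ hardySq f + ((3 * dirichletSq₁ μ₁ f + 2 * μ₁ univ * hardySq f) +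
        dirichletSq₁ μ₂ (f ∘ Prod.swap)) := by
        gcongr
        exact dirichletSq₁_mulFst_le hf μ₁
    -- The terms added are exactly those missing from the expanded product.
    _ ≤ hardySq f + ((3 * dirichletSq₁ μ₁ f + 2 * μ₁ univ * hardySq f) +
        dirichletSq₁ μ₂ (f ∘ Prod.swap)) + (2 * hardySq f + 2 * dirichletSq₁ μ₂ (f ∘ Prod.swap) +
        2 * μ₁ univ * (dirichletSq₁ μ₁ f + dirichletSq₁ μ₂ (f ∘ Prod.swap))) := le_self_add
    _ = _ := by ring

lemma totalSq_mulSnd_le {f : ℂ × ℂ → ℂ} (hf : IsHolo f) :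
    totalSq μ₁ μ₂ (mulSnd f) ≤ (3 + 2 * μ₂ univ) * totalSq μ₁ μ₂ f := by
  rw [← totalSq_swap μ₂ μ₁ hf.mulSnd, mulSnd_comp_swap, ← totalSq_swap μ₂ μ₁ hf]
  exact totalSq_mulFst_le μ₂ μ₁ hf.swap

end Total

/-! ### Toral complete hyperexpansivity from the norms -/

section Operators

variable {H : Type*} [NormedAddCommGroup H] [InnerProductSpace ℂ H] [CompleteSpace H]
  {T₁ T₂ : H →L[ℂ] H}

lemma adjoint_pow (T : H →L[ℂ] H) (n : ℕ) : (T†) ^ n = (T ^ n)† := by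
  simp only [← ContinuousLinearMap.star_eq_adjoint, star_pow]

/-- The adjoints move across the inner product and the powers commute, so the sign of the operator
is decided by the squared norms along orbits. -/
lemma inner_betaOp (hc : T₁ * T₂ = T₂ * T₁) (a : ℕ × ℕ) (x : H) :
    inner ℂ (betaOp T₁ T₂ a x) x = ((∑ i ∈ Finset.range (a.1 + 1), ∑ j ∈ Finset.range (a.2 + 1),
      ((-1 : ℝ) ^ i * (a.1.choose i : ℝ)) * ((-1 : ℝ) ^ j * (a.2.choose j : ℝ)) *
        ‖(T₁ ^ i * T₂ ^ j) x‖ ^ 2 : ℝ) : ℂ) := by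
  have hI : Finset.Iic a = Finset.range (a.1 + 1) ×ˢ Finset.range (a.2 + 1) := by
    ext b
    simp [Prod.le_def]
  rw [betaOp, hI, Finset.sum_product, _root_.sum_apply, sum_inner,
    Complex.ofReal_sum]
  refine Finset.sum_congr rfl fun i _ => ?_
  rw [_root_.sum_apply, sum_inner, Complex.ofReal_sum]
  refine Finset.sum_congr rfl fun j _ => ?_
  have hcomm : T₁ ^ i * T₂ ^ j = T₂ ^ j * T₁ ^ i := (Commute.pow_pow hc i j)
  rw [_root_.smul_apply, inner_smul_left, adjoint_pow, adjoint_pow,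
    mul_apply_eq_comp, mul_apply_eq_comp,
    ContinuousLinearMap.adjoint_inner_left, ContinuousLinearMap.adjoint_inner_left,
    ← mul_apply_eq_comp (T₂ ^ j), ← hcomm, inner_self_eq_norm_sq_to_K]
  simp only [map_mul, map_pow, map_neg, map_one, map_natCast, Complex.coe_algebraMap,
    Complex.ofReal_mul, Complex.ofReal_pow, Complex.ofReal_neg, Complex.ofReal_one,
    Complex.ofReal_natCast]
  ring

lemma inner_defectOp (hc : T₁ * T₂ = T₂ * T₁) (x : H) :
    inner ℂ (defectOp T₁ T₂ x) x =
      ((‖x‖ ^ 2 - ‖T₁ x‖ ^ 2 - ‖T₂ x‖ ^ 2 + ‖T₁ (T₂ x)‖ ^ 2 : ℝ) : ℂ) := by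
  have h : T₂ (T₁ x) = T₁ (T₂ x) := (DFunLike.congr_fun hc x).symm
  simp only [defectOp, _root_.add_apply, _root_.sub_apply,
    mul_apply_eq_comp, one_apply_eq_self, inner_add_left, inner_sub_left,
    ContinuousLinearMap.adjoint_inner_left, h, inner_self_eq_norm_sq_to_K]
  push_cast
  rfl

/-- A commuting pair is toral completely hyperexpansive with defect zero as soon as its orbits
satisfy `‖T₁ ^ i T₂ ^ j x‖² = p + q i + s j` with `q` and `s` completely alternating. -/
lemma isToralCompletelyHyperexpansive_of_norm_sq (hc : T₁ * T₂ = T₂ * T₁)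
    (h : ∀ x, ∃ (p : ℝ) (q s : ℕ → ℝ), (∀ i j, ‖(T₁ ^ i * T₂ ^ j) x‖ ^ 2 = p + q i + s j) ∧
      (∀ n, ∑ k ∈ Finset.range (n + 2), (-1 : ℝ) ^ k * ((n + 1).choose k : ℝ) * q k ≤ 0) ∧
      ∀ n, ∑ k ∈ Finset.range (n + 2), (-1 : ℝ) ^ k * ((n + 1).choose k : ℝ) * s k ≤ 0) :
    IsToralCompletelyHyperexpansive T₁ T₂ ∧ defectOp T₁ T₂ = 0 := by
  have halt : ∀ n, ∑ k ∈ Finset.range (n + 2), (-1 : ℝ) ^ k * ((n + 1).choose k : ℝ) = 0 := by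
    intro n
    have := Int.alternating_sum_range_choose (n := n + 1)
    rw [if_neg n.succ_ne_zero] at this
    exact_mod_cast this
  -- The double sum factors. By `halt`, everything vanishes if both entries of the multi-index are
  -- positive; if exactly one is, only the difference of q or of s in that direction remains.
  have hsum : ∀ (A B : Finset ℕ) (u v q s : ℕ → ℝ) (p : ℝ),
      ∑ i ∈ A, ∑ j ∈ B, u i * v j * (p + q i + s j) =
        p * (∑ i ∈ A, u i) * (∑ j ∈ B, v j) + (∑ i ∈ A, u i * q i) * (∑ j ∈ B, v j) +
          (∑ i ∈ A, u i) * ∑ j ∈ B, v j * s j := by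
    intro A B u v q s p
    rw [mul_assoc, Finset.sum_mul_sum, Finset.sum_mul_sum, Finset.sum_mul_sum, Finset.mul_sum,
      ← Finset.sum_add_distrib, ← Finset.sum_add_distrib]
    refine Finset.sum_congr rfl fun i _ => ?_
    rw [Finset.mul_sum, ← Finset.sum_add_distrib, ← Finset.sum_add_distrib]
    exact Finset.sum_congr rfl fun j _ => by ring
  refine ⟨⟨hc, fun a ha => ?_⟩, ?_⟩
  · rw [ContinuousLinearMap.le_def, ContinuousLinearMap.isPositive_iff_complex]
    intro x
    obtain ⟨p, q, s, hx, hq, hs⟩ := h x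
    rw [zero_sub, _root_.neg_apply, inner_neg_left, inner_betaOp hc]
    simp only [hx, hsum]
    rw [← Complex.ofReal_neg]
    refine ⟨rfl, ?_⟩
    change 0 ≤ -_
    rw [neg_nonneg]
    obtain ⟨m, n⟩ := a
    rcases m with _ | m
    · rcases n with _ | n
      · exact absurd rfl ha
      · have := halt n
        simpa [this] using hs n
    · rcases n with _ | n
      · have := halt m
        simpa [this] using hq m
      · simp [halt m, halt n]
  -- On a complex space an operator with zero quadratic form is zero; here the form is the mixed
  -- second difference of p + q i + s j.
  · refine ContinuousLinearMap.coe_injective ((inner_map_self_eq_zero _).1 fun x => ?_)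
    obtain ⟨p, q, s, hx, -, -⟩ := h x
    have h00 := hx 0 0
    have h10 := hx 1 0
    have h01 := hx 0 1
    have h11 := hx 1 1
    simp only [pow_zero, pow_one, one_mul, mul_one, one_apply_eq_self,
      mul_apply_eq_comp] at h00 h10 h01 h11
    rw [ContinuousLinearMap.coe_coe, inner_defectOp hc, h00, h10, h01, h11, Complex.ofReal_eq_zero]
    ring

end Operators

/-! ### The coordinate multiplications -/

namespace DirichletSpace

variable {μ₁ μ₂ : Measure (closedBall (0 : ℂ) 1)} [IsFiniteMeasure μ₁] [IsFiniteMeasure μ₂]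

lemma ext {f g : DirichletSpace μ₁ μ₂} (h : f.toFun = g.toFun) : f = g := Subtype.ext h

lemma norm_sq_eq_totalSq (f : DirichletSpace μ₁ μ₂) :
    ‖f‖ ^ 2 = (totalSq μ₁ μ₂ f.toFun).toReal := norm_sq_eq f

lemma totalSq_lt_top (f : DirichletSpace μ₁ μ₂) : totalSq μ₁ μ₂ f.toFun < ⊤ :=
  ENNReal.add_lt_top.2 f.mem.2

/-- An operator on functions which is bounded for the norm of `D(μ₁, μ₂)`. -/
lemma exists_operator (Φ : (ℂ × ℂ → ℂ) →ₗ[ℂ] ℂ × ℂ → ℂ) {C : ℝ≥0∞} (hC : C ≠ ⊤)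
    (hΦ : ∀ f, IsHolo f → IsHolo (Φ f))
    (hle : ∀ f, IsHolo f → totalSq μ₁ μ₂ (Φ f) ≤ C * totalSq μ₁ μ₂ f) :
    ∃ M : DirichletSpace μ₁ μ₂ →L[ℂ] DirichletSpace μ₁ μ₂, ∀ f, (M f).toFun = Φ f.toFun := by
  have hmem : ∀ f : DirichletSpace μ₁ μ₂, Φ f.toFun ∈ dirichletSubmodule μ₁ μ₂ := fun f =>
    ⟨hΦ _ f.mem.1, ENNReal.add_lt_top.1 ((hle _ f.mem.1).trans_lt
      (ENNReal.mul_lt_top hC.lt_top f.totalSq_lt_top))⟩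
  let L : DirichletSpace μ₁ μ₂ →ₗ[ℂ] DirichletSpace μ₁ μ₂ :=
    { toFun := fun f => (⟨Φ f.toFun, hmem f⟩ : dirichletSubmodule μ₁ μ₂)
      map_add' := fun f g => ext (map_add Φ f.toFun g.toFun)
      map_smul' := fun c f => ext (map_smul Φ c f.toFun) }
  refine ⟨L.mkContinuous (√C.toReal) fun f => ?_, fun f => rfl⟩
  refine le_of_sq_le_sq ?_ (by positivity)
  rw [mul_pow, Real.sq_sqrt ENNReal.toReal_nonneg, norm_sq_eq_totalSq, norm_sq_eq_totalSq,
    ← ENNReal.toReal_mul]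
  exact ENNReal.toReal_mono (ENNReal.mul_ne_top hC f.totalSq_lt_top.ne) (hle _ f.mem.1)

end DirichletSpace

/-! ### Powers of the coordinate multiplications -/

lemma mulFst_zero (f : ℂ × ℂ → ℂ) : mulFst 0 f = f := by
  ext z
  simp [mulFst]

lemma IsHolo.mulSnd_iterate {f : ℂ × ℂ → ℂ} (hf : IsHolo f) (j : ℕ) : IsHolo (Bidisc.mulSnd^[j] f) := by
  induction j with
  | zero => exact hf
  | succ j ih =>
    rw [Function.iterate_succ_apply']
    exact ih.mulSnd

lemma mulSnd_iterate_apply (j : ℕ) (f : ℂ × ℂ → ℂ) (z : ℂ × ℂ) :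
    mulSnd^[j] f z = z.2 ^ j * f z := by
  induction j with
  | zero => simp
  | succ j ih =>
    rw [Function.iterate_succ_apply', mulSnd, ih]
    ring

lemma mulFst_mulSnd_iterate (i j : ℕ) (f : ℂ × ℂ → ℂ) :
    mulFst i (mulSnd^[j] f) = mulSnd^[j] (mulFst i f) := by
  ext z
  simp only [mulFst, mulSnd_iterate_apply]
  ring

lemma mulSnd_iterate_comp_swap (j : ℕ) (f : ℂ × ℂ → ℂ) :
    mulSnd^[j] f ∘ Prod.swap = mulFst j (f ∘ Prod.swap) := by
  ext z
  simp [mulFst, mulSnd_iterate_apply]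

lemma mulFst_comp_swap (i : ℕ) (f : ℂ × ℂ → ℂ) :
    mulFst i f ∘ Prod.swap = mulSnd^[i] (f ∘ Prod.swap) := by
  ext z
  simp [mulFst, mulSnd_iterate_apply]

lemma hardySq_mulSnd_iterate {f : ℂ × ℂ → ℂ} (hf : IsHolo f) (j : ℕ) :
    hardySq (mulSnd^[j] f) = hardySq f := by
  induction j with
  | zero => rfl
  | succ j ih => rw [Function.iterate_succ_apply', hardySq_mulSnd (hf.mulSnd_iterate j), ih]

lemma dirichletSq₁_mulSnd_iterate {f : ℂ × ℂ → ℂ} (hf : IsHolo f)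
    (μ : Measure (closedBall (0 : ℂ) 1)) [IsFiniteMeasure μ] (j : ℕ) :
    dirichletSq₁ μ (mulSnd^[j] f) = dirichletSq₁ μ f := by
  induction j with
  | zero => rfl
  | succ j ih => rw [Function.iterate_succ_apply', dirichletSq₁_mulSnd (hf.mulSnd_iterate j), ih]

/-- The norms of the orbit of `f` under the two coordinate multiplications. -/
lemma totalSq_orbit {f : ℂ × ℂ → ℂ} (hf : IsHolo f) (μ₁ μ₂ : Measure (closedBall (0 : ℂ) 1))
    [IsFiniteMeasure μ₁] [IsFiniteMeasure μ₂] (i j : ℕ) :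
    totalSq μ₁ μ₂ (mulFst i (mulSnd^[j] f)) = hardySq f +
      (dirichletSq₁ μ₁ (mulFst i f) + dirichletSq₁ μ₂ (mulFst j (f ∘ Prod.swap))) := by
  have h := hf.mulSnd_iterate j
  -- Iterates are stripped from the second variable only, so z₁^i is removed after exchanging the
  -- variables.
  rw [totalSq, dirichletIntegral_eq, ← hardySq_swap (h.mulFst i), mulFst_comp_swap,
    hardySq_mulSnd_iterate h.swap, hardySq_swap h, hardySq_mulSnd_iterate hf,
    dirichletSq₁_mulSnd_iterate h.swap, mulFst_mulSnd_iterate,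
    dirichletSq₁_mulSnd_iterate (hf.mulFst i), mulSnd_iterate_comp_swap]

end Bidisc

end

/-! ### The coordinate multiplications on the Dirichlet-type space -/

open Bidisc in
theorem mainTheorem3 (μ₁ μ₂ : MeasureTheory.Measure (Metric.closedBall (0 : ℂ) 1))
    [MeasureTheory.IsFiniteMeasure μ₁] [MeasureTheory.IsFiniteMeasure μ₂] :
    ∃ (_ : CompleteSpace (Bidisc.DirichletSpace μ₁ μ₂)),
      TopologicalSpace.SeparableSpace (Bidisc.DirichletSpace μ₁ μ₂) ∧
      ∃ M₁ M₂ : Bidisc.DirichletSpace μ₁ μ₂ →L[ℂ] Bidisc.DirichletSpace μ₁ μ₂,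
        (∀ f z, (M₁ f).toFun z = z.1 * f.toFun z) ∧
        (∀ f z, (M₂ f).toFun z = z.2 * f.toFun z) ∧
        Bidisc.IsToralCompletelyHyperexpansive M₁ M₂ ∧
        Bidisc.defectOp M₁ M₂ = 0 := by
  refine ⟨inferInstance, inferInstance, ?_⟩
  obtain ⟨M₁, hM₁⟩ := DirichletSpace.exists_operator (μ₁ := μ₁) (μ₂ := μ₂)
    { toFun := mulFst 1
      map_add' := fun f g => by ext z; simp [mulFst, mul_add]
      map_smul' := fun c f => by ext z; simp [mulFst, mul_left_comm] }
    (C := 3 + 2 * μ₁ univ) (by finiteness) (fun f hf => hf.mulFst 1)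
    fun f hf => totalSq_mulFst_le μ₁ μ₂ hf
  obtain ⟨M₂, hM₂⟩ := DirichletSpace.exists_operator (μ₁ := μ₁) (μ₂ := μ₂)
    { toFun := mulSnd
      map_add' := fun f g => by ext z; simp [mulSnd, mul_add]
      map_smul' := fun c f => by ext z; simp [mulSnd, mul_left_comm] }
    (C := 3 + 2 * μ₂ univ) (by finiteness) (fun f hf => hf.mulSnd)
    fun f hf => totalSq_mulSnd_le μ₁ μ₂ hf
  replace hM₁ : ∀ f, (M₁ f).toFun = mulFst 1 f.toFun := hM₁
  replace hM₂ : ∀ f, (M₂ f).toFun = mulSnd f.toFun := hM₂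
  have hM₁z : ∀ f z, (M₁ f).toFun z = z.1 * f.toFun z := fun f z => by simp [hM₁, mulFst]
  have hM₂z : ∀ f z, (M₂ f).toFun z = z.2 * f.toFun z := fun f z => by simp [hM₂, mulSnd]
  have hpow₁ : ∀ i f, ((M₁ ^ i) f).toFun = mulFst i f.toFun := by
    intro i
    induction i with
    | zero => exact fun f => (mulFst_zero _).symm
    | succ i ih =>
      intro f
      rw [pow_succ', mul_apply_eq_comp, hM₁, ih, mulFst_mulFst, add_comm]
  have hpow₂ : ∀ j f, ((M₂ ^ j) f).toFun = mulSnd^[j] f.toFun := by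
    intro j
    induction j with
    | zero => exact fun f => rfl
    | succ j ih =>
      intro f
      rw [pow_succ', mul_apply_eq_comp, hM₂, ih, Function.iterate_succ_apply']
  have horbit : ∀ i j f, ((M₁ ^ i * M₂ ^ j) f).toFun = mulFst i (mulSnd^[j] f.toFun) := by
    intro i j f
    rw [mul_apply_eq_comp, hpow₁, hpow₂]
  refine ⟨M₁, M₂, hM₁z, hM₂z, isToralCompletelyHyperexpansive_of_norm_sq ?_ fun f => ?_⟩
  · refine ContinuousLinearMap.ext fun f => DirichletSpace.ext (funext fun z => ?_)
    rw [mul_apply_eq_comp, mul_apply_eq_comp, hM₁z, hM₂z, hM₂z, hM₁z]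
    ring
  -- The orbit of f stays in the space, so each part of its norm is finite without a separate
  -- estimate for powers.
  have htot : ∀ i j, hardySq f.toFun + (dirichletSq₁ μ₁ (mulFst i f.toFun) +
      dirichletSq₁ μ₂ (mulFst j (f.toFun ∘ Prod.swap))) < ⊤ := fun i j => by
    rw [← totalSq_orbit f.mem.1, ← horbit]
    exact DirichletSpace.totalSq_lt_top _
  have hfin₁ : ∀ i, dirichletSq₁ μ₁ (mulFst i f.toFun) < ⊤ := fun i =>
    (ENNReal.add_lt_top.1 (ENNReal.add_lt_top.1 (htot i 0)).2).1
  have hfin₂ : ∀ j, dirichletSq₁ μ₂ (mulFst j (f.toFun ∘ Prod.swap)) < ⊤ := fun j =>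
    (ENNReal.add_lt_top.1 (ENNReal.add_lt_top.1 (htot 0 j)).2).2
  refine ⟨(hardySq f.toFun).toReal, fun i => (dirichletSq₁ μ₁ (mulFst i f.toFun)).toReal,
    fun j => (dirichletSq₁ μ₂ (mulFst j (f.toFun ∘ Prod.swap))).toReal, fun i j => ?_,
    sum_alternating_dirichletSq₁ f.mem.1 μ₁ hfin₁,
    sum_alternating_dirichletSq₁ f.mem.1.swap μ₂ hfin₂⟩
  rw [DirichletSpace.norm_sq_eq_totalSq, horbit, totalSq_orbit f.mem.1,
    ENNReal.toReal_add f.mem.2.1.ne (ENNReal.add_lt_top.2 ⟨hfin₁ i, hfin₂ j⟩).ne,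
    ENNReal.toReal_add (hfin₁ i).ne (hfin₂ j).ne, add_assoc]
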